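/- Let $n,m_\pm,\nu_\pm,e,Z,\varepsilon_0,\mu_0,\alpha>0$ be constants. Consider on $[0,\infty)\times\mathbb R^3$ the two-fluid incompressible Navier–Stokes–Maxwell system $$ \begin{cases} nm_-\partial_t v_-=\nu_-\Delta v_- - nm_-(v_-\cdot\nabla)v_- - en(E+v_-\times B)-R-\nabla p_-,\\ nm_+\partial_t v_+=\nu_+\Delta v_+ - nm_+(v_+\cdot\nabla)v_+ + eZn(E+v_+\times B)+R-\nabla p_+,\\ \partial_t E=\frac1{\varepsilon_0\mu_0}\nabla\times B-\frac{ne}{\varepsilon_0}(Zv_+-v_-),\qquad \partial_t B=-\nabla\times E,\\ R:=-\alpha(v_+-v_-),\qquad \operatorname{div}v_-=\operatorname{div}v_+=0 . \end{cases} $$ Let $v_{-,0},v_{+,0},E_0,B_0\in L^2(\mathbb R^3;\mathbb R^3)$ with $\operatorname{div}v_{-,0}=\operatorname{div}v_{+,0}=0$ in the sense of distributions. Then there are fields $$v_\pm\in L^\infty(0,\infty;L^2)\cap L^2(0,\infty;\dot H^1),\qquad E,B\in L^\infty(0,\infty;L^2),\qquad R\in L^2(0,\infty;L^2),$$ weakly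 continuous from $[0,\infty)$ to $L^2$, with $(v_-,v_+,E,B)|_{t=0}=(v_{-,0},v_{+,0},E_0,B_0)$, which are a weak solution of the system with these initial data: $\operatorname{div}v_\pm(t)=0$ for all $t\ge0$, the two momentum equations hold when tested with all divergence-free fields in $C_c^\infty([0,\infty)\times\mathbb R^3;\mathbb R^3)$, and the two Maxwell equations when tested with all fields in $C_c^\infty([0,\infty)\times\mathbb R^3;\mathbb R^3)$, the initial data being included in each weak form. If $\operatorname{div}E_0=0$, then $\operatorname{div}E(t)=0$ for all $t\ge0$, and if $\operatorname{div}B_0=0$, then $\operatorname{div}B(t)=0$ for all $t\ge0$. Moreover, with $\|v\|_{\dot H^1}=\|\nabla v\|_{L^2}$, for every $t\ge0$, $$ \begin{aligned} &\tfrac{nm_-}{2\varepsilon_0}\|v_-(t)\|_{L^2}^2+\tfrac{nm_+}{2\varepsilon_0}\|v_+(t)\|_{L^2}^2+\tfrac12\|E(t)\|_{L^2}^2+\tfrac1{2\varepsilon_0\mu_0}\|B(t)\|_{L^2}^2\\ &\quad+\tfrac{\nu_-}{\varepsilon_0}\int_0^t\|v_-\|_{\dot H^1}^2ds+\tfrac{\nu_+}{\varepsilon_0}\int_0^t\|v_+\|_{\dot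 H^1}^2ds+\tfrac{\alpha}{\varepsilon_0}\int_0^t\|v_--v_+\|_{L^2}^2ds\\ &\le\tfrac{nm_-}{2\varepsilon_0}\|v_{-,0}\|_{L^2}^2+\tfrac{nm_+}{2\varepsilon_0}\|v_{+,0}\|_{L^2}^2+\tfrac12\|E_0\|_{L^2}^2+\tfrac1{2\varepsilon_0\mu_0}\|B_0\|_{L^2}^2 . \end{aligned} $$ -/

import Mathlib

open MeasureTheory Set
open scoped ENNReal ContDiff

noncomputable section

namespace NSM

/-- Physical space `ℝ³` with its Euclidean norm. -/
abbrev E3 : Type := EuclideanSpace ℝ (Fin 3)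

/-- Vector fields in `L²(ℝ³; ℝ³)`. -/
abbrev L2 : Type := Lp E3 2 (volume : Measure E3)

/-- Triples `(∂₀u, ∂₁u, ∂₂u)` of `L²` vector fields; `‖G‖² = ∑ᵢ ‖Gᵢ‖²_{L²}`. -/
abbrev GradL2 : Type := PiLp 2 (fun _ : Fin 3 => L2)

/-- The physical constants of the two-fluid Navier-Stokes-Maxwell system: number density `n`,
masses `m₋, m₊`, viscosities `ν₋, ν₊`, elementary charge `e`, charge number `Z`,
vacuum dielectric constant `ε₀`, vacuum permeability `μ₀`, Rayleigh friction coefficient `α`. -/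
structure Constants where
  n : ℝ
  mMinus : ℝ
  mPlus : ℝ
  νMinus : ℝ
  νPlus : ℝ
  e : ℝ
  Z : ℝ
  ε₀ : ℝ
  μ₀ : ℝ
  α : ℝ
  n_pos : 0 < n
  mMinus_pos : 0 < mMinus
  mPlus_pos : 0 < mPlus
  νMinus_pos : 0 < νMinus
  νPlus_pos : 0 < νPlus
  e_pos : 0 < e
  Z_pos : 0 < Z
  ε₀_pos : 0 < ε₀
  μ₀_pos : 0 < μ₀
  α_pos : 0 < α

/-- Cross product on `ℝ³`. -/
def cross (a b : E3) : E3 := WithLp.toLp 2 (crossProduct a.ofLp b.ofLp)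

/-- Partial derivative `∂ᵢ f` of a differentiable function on `ℝ³`. -/
def pd {F : Type*} [NormedAddCommGroup F] [NormedSpace ℝ F] (i : Fin 3) (f : E3 → F) (x : E3) : F :=
  fderiv ℝ f x (EuclideanSpace.single i 1)

/-- Divergence of a differentiable vector field. -/
def divergence (f : E3 → E3) (x : E3) : ℝ := ∑ i, pd i f x i

/-- Curl of a differentiable vector field. -/
def curl (f : E3 → E3) (x : E3) : E3 :=
  !₂[pd 1 f x 2 - pd 2 f x 1, pd 2 f x 0 - pd 0 f x 2, pd 0 f x 1 - pd 1 f x 0]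

/-- `div u = 0` in the sense of distributions. -/
def IsDivFree (u : L2) : Prop :=
  ∀ ψ : E3 → ℝ, ContDiff ℝ ∞ ψ → HasCompactSupport ψ →
    ∫ x, inner ℝ (u x) (gradient ψ x) = 0

/-- `G` is the gradient of `u` in the sense of distributions: `∂ᵢ u = Gᵢ` for each `i`.
Such a `G` is unique, and `‖u‖_{Ḣ¹} = ‖G‖`. -/
def IsWeakGradient (u : L2) (G : GradL2) : Prop :=
  ∀ i : Fin 3, ∀ ψ : E3 → ℝ, ContDiff ℝ ∞ ψ → HasCompactSupport ψ →
    ∫ x, pd i ψ x • u x = - ∫ x, ψ x • (G i) x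

/-- Smooth compactly supported space-time test fields `φ(t, x)`. They need not vanish at `t = 0`. -/
def IsTestField (φ : ℝ → E3 → E3) : Prop :=
  ContDiff ℝ ∞ (Function.uncurry φ) ∧ HasCompactSupport (Function.uncurry φ)

/-- Test fields that are divergence free in `x` at every time. -/
def IsSolenoidalTestField (φ : ℝ → E3 → E3) : Prop :=
  IsTestField φ ∧ ∀ t x, divergence (φ t) x = 0

/-- The time derivative `∂ₜφ` of a test field. -/
def dt (φ : ℝ → E3 → E3) (t : ℝ) (x : E3) : E3 := deriv (fun s => φ s x) t

/-- The map `u : [0,∞) → L²` is continuous for the weak topology of `L²`. -/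
def IsWeaklyContinuous (u : ℝ → L2) : Prop :=
  ∀ w : L2, ContinuousOn (fun t => inner ℝ (u t) w) (Ici 0)

/-- Weak form on `[0,∞) × ℝ³`, with initial value `v₀` and after elimination of the pressure by
divergence-free test fields, of the momentum equation
`n m ∂ₜv = ν Δv - n m (v·∇)v + q n (E + v × B) + F - ∇p`, where `div v = 0`.
By `div v = 0`, `(v·∇)v = div (v ⊗ v)`, and `(v ⊗ v) : ∇φ = v · (Dφ v)`. -/
def WeakMomentum (n m ν q : ℝ) (v₀ : L2) (v E B F : ℝ → L2) : Prop :=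
  ∀ φ : ℝ → E3 → E3, IsSolenoidalTestField φ →
    -(n * m) * (∫ t in Ioi (0 : ℝ), ∫ x, inner ℝ (v t x) (dt φ t x))
        - n * m * (∫ x, inner ℝ (v₀ x) (φ 0 x)) =
      ∫ t in Ioi (0 : ℝ), ∫ x,
        (ν * inner ℝ (v t x) (Laplacian.laplacian (φ t) x)
          + n * m * inner ℝ (v t x) (fderiv ℝ (φ t) x (v t x))
          + q * n * inner ℝ (E t x + cross (v t x) (B t x)) (φ t x)
          + inner ℝ (F t x) (φ t x))

/-- Weak form on `[0,∞) × ℝ³`, with initial value `U₀`, of `∂ₜU = k curl W + J`. -/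
def WeakMaxwell (k : ℝ) (U₀ : L2) (U W J : ℝ → L2) : Prop :=
  ∀ φ : ℝ → E3 → E3, IsTestField φ →
    -(∫ t in Ioi (0 : ℝ), ∫ x, inner ℝ (U t x) (dt φ t x))
        - (∫ x, inner ℝ (U₀ x) (φ 0 x)) =
      ∫ t in Ioi (0 : ℝ), ∫ x,
        (k * inner ℝ (W t x) (curl (φ t) x) + inner ℝ (J t x) (φ t x))

/-- The Rayleigh friction `R = -α (v₊ - v₋)`. -/
def friction (c : Constants) (vm vp : ℝ → L2) (t : ℝ) : L2 := -c.α • (vp t - vm t)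

/-- The four fields `v₋ = vm`, `v₊ = vp`, `E`, `B`, assumed to be in `L^∞(0,∞; L²)`, are a weak
solution on `[0,∞) × ℝ³` of the two-fluid incompressible Navier-Stokes-Maxwell system
* `n m₋ ∂ₜv₋ = ν₋ Δv₋ - n m₋ (v₋·∇)v₋ - e n (E + v₋ × B) - R - ∇p₋`,
* `n m₊ ∂ₜv₊ = ν₊ Δv₊ - n m₊ (v₊·∇)v₊ + e Z n (E + v₊ × B) + R - ∇p₊`,
* `∂ₜE = (ε₀ μ₀)⁻¹ curl B - (n e / ε₀) (Z v₊ - v₋)`,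
* `∂ₜB = - curl E`,
* `div v₋ = div v₊ = 0`, and `div E = 0`, `div B = 0` when these hold at time `0`,

with the given initial data, attained in the weak topology of `L²`. -/
structure IsWeakSolution (c : Constants) (vm₀ vp₀ E₀ B₀ : L2) (vm vp E B : ℝ → L2) : Prop where
  momentum_minus : WeakMomentum c.n c.mMinus c.νMinus (-c.e) vm₀ vm E B
    (fun t => -friction c vm vp t)
  momentum_plus : WeakMomentum c.n c.mPlus c.νPlus (c.e * c.Z) vp₀ vp E B
    (fun t => friction c vm vp t)
  ampere : WeakMaxwell (1 / (c.ε₀ * c.μ₀)) E₀ E B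
    (fun t => -(c.n * c.e / c.ε₀) • (c.Z • vp t - vm t))
  faraday : WeakMaxwell (-1) B₀ B E (fun _ => 0)
  div_minus : ∀ t, 0 ≤ t → IsDivFree (vm t)
  div_plus : ∀ t, 0 ≤ t → IsDivFree (vp t)
  gauss_electric : IsDivFree E₀ → ∀ t, 0 ≤ t → IsDivFree (E t)
  gauss_magnetic : IsDivFree B₀ → ∀ t, 0 ≤ t → IsDivFree (B t)
  continuous_minus : IsWeaklyContinuous vm
  continuous_plus : IsWeaklyContinuous vp
  continuous_electric : IsWeaklyContinuous E
  continuous_magnetic : IsWeaklyContinuous B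
  initial_minus : vm 0 = vm₀
  initial_plus : vp 0 = vp₀
  initial_electric : E 0 = E₀
  initial_magnetic : B 0 = B₀

/-- The energy of a state `(v₋, v₊, E, B)`. -/
def energy (c : Constants) (vm vp E B : L2) : ℝ :=
  c.n * c.mMinus / (2 * c.ε₀) * ‖vm‖ ^ 2 + c.n * c.mPlus / (2 * c.ε₀) * ‖vp‖ ^ 2
    + 1 / 2 * ‖E‖ ^ 2 + 1 / (2 * c.ε₀ * c.μ₀) * ‖B‖ ^ 2

end NSM

end

/-! The formal energy law comes from testing the momentum equations with `v₋/ε₀` and `v₊/ε₀`,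
Ampère's law with `E` and Faraday's law with `B/(ε₀μ₀)`. Convection and the force `v × B` do no
work, the two curl terms cancel because the curl is symmetric, the work of `E` on the fluids cancels
against the current in Ampère's law, and friction leaves `-(α/ε₀)‖v₋ - v₊‖²` (`systemForm_self`).

The Galerkin spaces consist of smooth compactly supported states with solenoidal velocities, scaled
so that the energy is half the squared Hilbert norm. The energy law then holds exactly for the
approximations and makes them global. They are tested with the members of a sequence that is dense
for a norm controlling every derivative in the weak form, so it is enough to pass to the limit for
each member of that sequence. Approximating the initial data uses the density of solenoidal test
fields among divergence free `L²` fields (`mem_closure_solenoidal`), which follows from `Δ = grad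
div - curl curl` and the absence of nonzero harmonic fields in `L²`.

The energy bound makes the pairings with a fixed test state equi-Lipschitz in time, and a diagonal
extraction gives weak convergence at every time (`exists_subseq_weak_limit`). Maxwell's equations do
not regularize, so `E` and `B` converge only weakly; but each quadratic term, `v ⊗ v` or `v × B`,
has a velocity factor whose gradient is bounded in `L²` of space-time. Mollifying that factor costs
`δ‖∇v‖`, and multiplication by a compactly supported coefficient after mollification turns weak
convergence into strong convergence at each time (`exists_smoothing`, `tendsto_integral_actL`). This
takes the place of an Aubin–Lions argument.

The energy inequality follows from weak lower semicontinuity and Fatou's lemma. The limit satisfies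
the equations integrated in time against fixed test fields, and `weak_form_of_integrated` passes to
test fields that depend on time. -/

noncomputable section

open Filter Topology

namespace NSM

/-! ### Weak convergence in Hilbert spaces. -/

section WeakCompactness

variable {H : Type*} [NormedAddCommGroup H] [InnerProductSpace ℝ H]

/-- A bounded sequence in `K` whose pairings with a dense sequence of `K` converge is weakly
convergent. -/
theorem exists_weak_limit_of_cauchySeq_inner [CompleteSpace H] (K : Submodule ℝ H)
    [K.HasOrthogonalProjection] {d : ℕ → H} {x : ℕ → H} {C : ℝ}
    (hd : ∀ y ∈ K, ∀ ε > 0, ∃ k, ‖y - d k‖ < ε) (hxK : ∀ N, x N ∈ K) (hxC : ∀ N, ‖x N‖ ≤ C)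
    (hx : ∀ k, CauchySeq fun N => inner ℝ (x N) (d k)) :
    ∃ x₀ : H, ∀ y, Tendsto (fun N => inner ℝ (x N) y) atTop (𝓝 (inner ℝ x₀ y)) := by
  have hC : 0 ≤ C := (norm_nonneg _).trans (hxC 0)
  have hK : ∀ y ∈ K, CauchySeq fun N => inner ℝ (x N) y := by
    intro y hy
    rw [Metric.cauchySeq_iff']
    intro ε hε
    -- The denominator has `C + 1` because `C` may vanish.
    obtain ⟨k, hk⟩ := hd y hy (ε / (4 * (C + 1))) (by positivity)
    obtain ⟨N, hN⟩ := Metric.cauchySeq_iff'.1 (hx k) (ε / 4) (by positivity)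
    refine ⟨N, fun n hn => ?_⟩
    have h1 : ∀ m, |inner ℝ (x m) y - inner ℝ (x m) (d k)| ≤ ε / 4 := by
      intro m
      rw [← inner_sub_right]
      refine (abs_real_inner_le_norm _ _).trans ?_
      calc ‖x m‖ * ‖y - d k‖ ≤ (C + 1) * (ε / (4 * (C + 1))) := by
            gcongr
            linarith [hxC m]
        _ = ε / 4 := by field_simp
    have h2 := hN n hn
    rw [Real.dist_eq] at h2 ⊢
    have h3 := h1 n
    have h4 := h1 N
    rw [abs_le] at h3 h4
    rw [abs_lt] at h2 ⊢
    constructor <;> linarith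
  have hall : ∀ y, ∃ l, Tendsto (fun N => inner ℝ (x N) y) atTop (𝓝 l) := by
    intro y
    obtain ⟨l, hl⟩ := cauchySeq_tendsto_of_complete (hK _ (K.starProjection_apply_mem y))
    refine ⟨l, hl.congr fun N => ?_⟩
    -- All `x N` lie in `K`, so they only see the projection of `y` onto `K`.
    have h5 : inner ℝ (x N) (y - K.starProjection y) = 0 := by
      exact Submodule.inner_right_of_mem_orthogonal (hxK N)
        (K.sub_starProjection_mem_orthogonal y)
    rw [inner_sub_right] at h5
    linarith
  choose l hl using hall
  let L : H →ₗ[ℝ] ℝ :=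
    { toFun := l
      map_add' := fun y z => tendsto_nhds_unique (hl (y + z))
        (by simpa only [inner_add_right] using (hl y).add (hl z))
      map_smul' := fun c y => tendsto_nhds_unique (hl (c • y))
        (by simpa only [inner_smul_right, smul_eq_mul, RingHom.id_apply] using
          (hl y).const_mul c) }
  have hLb : ∀ y, ‖L y‖ ≤ C * ‖y‖ := by
    intro y
    refine le_of_tendsto (hl y).norm (Eventually.of_forall fun N => ?_)
    exact (abs_real_inner_le_norm _ _).trans (by gcongr; exact hxC N)
  refine ⟨(InnerProductSpace.toDual ℝ H).symm (L.mkContinuous C hLb), fun y => ?_⟩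
  rw [InnerProductSpace.toDual_symm_apply]
  exact hl y

/-- Bounded functions `u N : ℝ → K` whose pairings with a dense sequence of `K` are eventually
equi-Lipschitz have a subsequence converging weakly at every time. -/
theorem exists_subseq_weak_limit [CompleteSpace H] (K : Submodule ℝ H)
    [K.HasOrthogonalProjection] {d : ℕ → H} {u : ℕ → ℝ → H} {C : ℝ}
    (hd : ∀ y ∈ K, ∀ ε > 0, ∃ k, ‖y - d k‖ < ε) (huK : ∀ N t, u N t ∈ K)
    (huC : ∀ N t, ‖u N t‖ ≤ C)
    (hu : ∀ k, ∃ L : ℝ, ∃ N₀, ∀ N ≥ N₀, ∀ s t,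
      |inner ℝ (u N s) (d k) - inner ℝ (u N t) (d k)| ≤ L * |s - t|) :
    ∃ φ : ℕ → ℕ, StrictMono φ ∧ ∃ U : ℝ → H, ∀ t y,
      Tendsto (fun N => inner ℝ (u (φ N) t) y) atTop (𝓝 (inner ℝ (U t) y)) := by
  -- Tychonoff in place of a diagonal argument: all pairings at all rational times form one point of
  -- a product of compact intervals. The equi-Lipschitz bound then carries convergence from rational
  -- times to every time.
  let p : ℕ → (ℕ × ℚ → ℝ) := fun N i => inner ℝ (u N i.2) (d i.1)
  have hp : ∀ N, p N ∈ Set.univ.pi fun i : ℕ × ℚ => Icc (-(C * ‖d i.1‖)) (C * ‖d i.1‖) := by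
    intro N i _
    exact abs_le.1 ((abs_real_inner_le_norm _ _).trans (by gcongr; exact huC N _))
  obtain ⟨a, -, φ, hφ, ha⟩ :=
    (isCompact_univ_pi fun i : ℕ × ℚ => isCompact_Icc).tendsto_subseq hp
  refine ⟨φ, hφ, ?_⟩
  have hcauchy : ∀ t k, CauchySeq fun N => inner ℝ (u (φ N) t) (d k) := by
    intro t k
    obtain ⟨L, N₀, hL⟩ := hu k
    rw [Metric.cauchySeq_iff']
    intro ε hε
    obtain ⟨q, hq1, hq2⟩ := exists_rat_btwn
      (show t < t + ε / (4 * (|L| + 1)) by linarith [show 0 < ε / (4 * (|L| + 1)) by positivity])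
    have hcq : CauchySeq fun N => inner ℝ (u (φ N) q) (d k) :=
      ((tendsto_pi_nhds.1 ha) (k, q)).cauchySeq
    obtain ⟨N, hN⟩ := Metric.cauchySeq_iff.1 hcq (ε / 4) (by positivity)
    have h1 : ∀ m ≥ N₀, |inner ℝ (u (φ m) t) (d k) - inner ℝ (u (φ m) q) (d k)| ≤ ε / 4 := by
      intro m hm
      refine (hL _ (hm.trans (hφ.id_le m)) t q).trans ?_
      have h2 : |t - q| ≤ ε / (4 * (|L| + 1)) := by
        rw [abs_le]; constructor <;> linarith
      calc L * |t - q| ≤ (|L| + 1) * (ε / (4 * (|L| + 1))) := by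
            gcongr
            linarith [le_abs_self L]
        _ = ε / 4 := by field_simp
    refine ⟨max N N₀, fun n hn => ?_⟩
    have h2 := hN n ((le_max_left _ _).trans hn) (max N N₀) (le_max_left _ _)
    have h3 := h1 n ((le_max_right _ _).trans hn)
    have h4 := h1 (max N N₀) (le_max_right _ _)
    rw [Real.dist_eq] at h2 ⊢
    rw [abs_le] at h3 h4
    rw [abs_lt] at h2 ⊢
    constructor <;> linarith
  choose U hU using fun t => exists_weak_limit_of_cauchySeq_inner K hd (fun N => huK (φ N) t)
    (fun N => huC (φ N) t) (hcauchy t)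
  exact ⟨U, hU⟩

/-- Bounded sequences in a separable Hilbert space have weakly convergent subsequences. -/
theorem exists_subseq_weak_limit_of_bounded [CompleteSpace H] [TopologicalSpace.SeparableSpace H]
    {x : ℕ → H} {C : ℝ} (hx : ∀ N, ‖x N‖ ≤ C) :
    ∃ φ : ℕ → ℕ, StrictMono φ ∧ ∃ x₀ : H, ∀ y,
      Tendsto (fun N => inner ℝ (x (φ N)) y) atTop (𝓝 (inner ℝ x₀ y)) := by
  obtain ⟨φ, hφ, U, hU⟩ := exists_subseq_weak_limit (⊤ : Submodule ℝ H)
    (d := TopologicalSpace.denseSeq H) (u := fun N _ => x N) (C := C)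
    (fun y _ ε hε => by
      obtain ⟨k, hk⟩ := (TopologicalSpace.denseRange_denseSeq H).exists_dist_lt y hε
      exact ⟨k, by rwa [← dist_eq_norm]⟩)
    (fun _ _ => trivial) (fun N _ => hx N) (fun k => ⟨0, 0, by simp⟩)
  exact ⟨φ, hφ, U 0, hU 0⟩

/-- Expanding `‖x N - x₀‖² ≥ 0` gives `2⟪x N, x₀⟫ - ‖x₀‖² ≤ ‖x N‖²`, and the left side converges.
With values in `ℝ≥0∞` the liminf needs no boundedness. -/
theorem norm_sq_le_liminf_of_weak {x : ℕ → H} {x₀ : H}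
    (h : ∀ y, Tendsto (fun N => inner ℝ (x N) y) atTop (𝓝 (inner ℝ x₀ y))) :
    ENNReal.ofReal (‖x₀‖ ^ 2) ≤ liminf (fun N => ENNReal.ofReal (‖x N‖ ^ 2)) atTop := by
  have h1 : Tendsto (fun N => ENNReal.ofReal (2 * inner ℝ (x N) x₀ - ‖x₀‖ ^ 2)) atTop
      (𝓝 (ENNReal.ofReal (‖x₀‖ ^ 2))) := by
    refine ENNReal.tendsto_ofReal ?_
    have := ((h x₀).const_mul 2).sub_const (‖x₀‖ ^ 2)
    rw [real_inner_self_eq_norm_sq] at this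
    convert this using 2
    ring
  rw [← h1.liminf_eq]
  refine liminf_le_liminf (Eventually.of_forall fun N => ENNReal.ofReal_le_ofReal ?_)
  have := norm_sub_sq_real (x N) x₀
  nlinarith [sq_nonneg ‖x N - x₀‖]

theorem norm_le_of_weak {x : ℕ → H} {x₀ : H} {C : ℝ} (hC : ∀ N, ‖x N‖ ≤ C)
    (h : ∀ y, Tendsto (fun N => inner ℝ (x N) y) atTop (𝓝 (inner ℝ x₀ y))) : ‖x₀‖ ≤ C := by
  by_contra! hlt
  have h1 := le_of_tendsto (h x₀) (Eventually.of_forall fun N =>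
    (real_inner_le_norm (x N) x₀).trans (mul_le_mul_of_nonneg_right (hC N) (norm_nonneg _)))
  rw [real_inner_self_eq_norm_sq] at h1
  have h2 := (norm_nonneg _).trans (hC 0)
  nlinarith

/-- The basic product limit: one factor may converge only weakly if the other converges in norm. -/
theorem tendsto_inner_of_weak_of_strong {x y : ℕ → H} {x₀ y₀ : H} {C : ℝ}
    (hC : ∀ N, ‖x N‖ ≤ C)
    (hx : ∀ z, Tendsto (fun N => inner ℝ (x N) z) atTop (𝓝 (inner ℝ x₀ z)))
    (hy : Tendsto y atTop (𝓝 y₀)) :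
    Tendsto (fun N => inner ℝ (x N) (y N)) atTop (𝓝 (inner ℝ x₀ y₀)) := by
  have h1 : Tendsto (fun N => inner ℝ (x N) (y N - y₀)) atTop (𝓝 0) := by
    refine squeeze_zero_norm (a := fun N => C * ‖y N - y₀‖)
      (fun N => (abs_real_inner_le_norm _ _).trans (by gcongr; exact hC N)) ?_
    simpa using (tendsto_iff_norm_sub_tendsto_zero.1 hy).const_mul C
  simpa [inner_sub_right] using h1.add (hx y₀)

/-- Pettis: in a separable Hilbert space, measurability of the pairings with a dense set of
vectors gives strong measurability. -/
theorem stronglyMeasurable_of_inner {α : Type*} [MeasurableSpace α] [CompleteSpace H]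
    [TopologicalSpace.SeparableSpace H] {f : α → H} {S : Set H} (hS : Dense S)
    (hf : ∀ y ∈ S, Measurable fun a => inner ℝ (f a) y) : StronglyMeasurable f := by
  have hall : ∀ y, Measurable fun a => inner ℝ (f a) y := by
    intro y
    obtain ⟨s, hsS, hs⟩ := mem_closure_iff_seq_limit.1 (hS y)
    refine measurable_of_tendsto_metrizable (fun n => hf (s n) (hsS n)) ?_
    rw [tendsto_pi_nhds]
    exact fun a => tendsto_const_nhds.inner hs
  let d := TopologicalSpace.denseSeq H
  let V : ℕ → Submodule ℝ H := fun n => Submodule.span ℝ (d '' Iic n)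
  have : ∀ n, FiniteDimensional ℝ (V n) := fun n =>
    FiniteDimensional.span_of_finite ℝ ((Set.finite_Iic n).image d)
  have hmono : Monotone V := fun m n hmn => Submodule.span_mono (image_mono (Iic_subset_Iic.2 hmn))
  have htop : ⊤ ≤ (⨆ n, V n).topologicalClosure := by
    intro y _
    have h1 : closure (range d) ⊆ closure ((⨆ n, V n : Submodule ℝ H) : Set H) := by
      refine closure_mono ?_
      rintro _ ⟨k, rfl⟩
      exact Submodule.mem_iSup_of_mem k (Submodule.subset_span ⟨k, self_mem_Iic, rfl⟩)
    exact h1 (TopologicalSpace.denseRange_denseSeq H y)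
  -- `f` is the pointwise limit of its projections onto an increasing exhausting family of finite
  -- dimensional subspaces. Each projection is a finite sum of measurable scalars times fixed
  -- vectors.
  refine stronglyMeasurable_of_tendsto atTop (f := fun n a => (V n).starProjection (f a))
    (fun n => ?_) ?_
  · let b := stdOrthonormalBasis ℝ (V n)
    have h2 : (fun a => (V n).starProjection (f a)) =
        fun a => ∑ i, inner ℝ (f a) (b i : H) • (b i : H) := by
      funext a
      have := b.sum_repr' ((V n).orthogonalProjectionOnto (f a))
      rw [Submodule.starProjection_apply, ← this]
      push_cast
      refine Finset.sum_congr rfl fun i _ => ?_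
      congr 1
      rw [Submodule.inner_orthogonalProjectionOnto_eq_of_mem_left, real_inner_comm]
    rw [h2]
    exact Finset.stronglyMeasurable_fun_sum _ fun i _ =>
      (hall _).stronglyMeasurable.smul_const _
  · rw [tendsto_pi_nhds]
    exact fun a => Submodule.starProjection_tendsto_self V hmono (f a) htop

end WeakCompactness

/-! ### Global solutions of dissipative ordinary differential equations. -/

section ODE

/-- Global solvability, on a given time interval, of the Cauchy problem for a `C¹` dissipative
vector field on a finite dimensional space. -/
theorem exists_solution_of_dissipative {X : Type*} [NormedAddCommGroup X] [InnerProductSpace ℝ X]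
    [FiniteDimensional ℝ X] {f : X → X} (hf : ContDiff ℝ 1 f) (hdiss : ∀ x, inner ℝ (f x) x ≤ 0)
    (x₀ : X) {T : ℝ} (hT : 0 ≤ T) :
    ∃ c : ℝ → X, c 0 = x₀ ∧ ∀ t ∈ Icc 0 T, HasDerivWithinAt c (f (c t)) (Icc 0 T) t := by
  -- Cutting `f` off outside a ball makes it bounded and globally Lipschitz, so one application of
  -- Picard–Lindelöf covers all of `[0, T]`. The cut-off field is still dissipative, so the norm
  -- never exceeds `‖x₀‖ < R` and the cut-off is not felt.
  let R : ℝ := ‖x₀‖ + 1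
  let χ : ContDiffBump (0 : X) := ⟨R, R + 1, by positivity, by linarith⟩
  let g : X → X := fun x => χ x • f x
  have hg : ContDiff ℝ 1 g := χ.contDiff.smul hf
  have hgs : HasCompactSupport g := χ.hasCompactSupport.smul_right
  obtain ⟨K, hK⟩ := hg.lipschitzWith_of_hasCompactSupport hgs one_ne_zero
  obtain ⟨M, hM⟩ := hg.continuous.bounded_above_of_compact_support hgs
  have hM0 : 0 ≤ M := (norm_nonneg _).trans (hM 0)
  let L : NNReal := ⟨M, hM0⟩
  -- Radius `M T`: the farthest a curve of speed at most `M` can travel in time `T`.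
  let a : NNReal := L * ⟨T, hT⟩
  have hPL : IsPicardLindelof (fun _ : ℝ => g) (⟨0, by simp [hT]⟩ : Icc (0 : ℝ) T) x₀ a 0 L K :=
    { lipschitzOnWith := fun _ _ => hK.lipschitzOnWith
      continuousOn := fun _ _ => continuousOn_const
      norm_le := fun _ _ x _ => hM x
      mul_max_le := by
        change M * max (T - 0) (0 - 0) ≤ M * T - 0
        simp [hT] }
  obtain ⟨c, hc0, hc⟩ := hPL.exists_eq_forall_mem_Icc_hasDerivWithinAt₀
  have hsq : ∀ t ∈ Icc 0 T, HasDerivWithinAt (fun s => ‖c s‖ ^ 2) (2 * inner ℝ (c t) (g (c t)))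
      (Icc 0 T) t := fun t ht => (hc t ht).norm_sq
  have hanti : AntitoneOn (fun s => ‖c s‖ ^ 2) (Icc 0 T) := by
    refine antitoneOn_of_hasDerivWithinAt_nonpos (convex_Icc 0 T)
      (fun t ht => (hsq t ht).continuousWithinAt)
      (fun t ht => (hsq t (interior_subset ht)).mono interior_subset) (fun t _ => ?_)
    have h1 : inner ℝ (c t) (g (c t)) = χ (c t) * inner ℝ (f (c t)) (c t) := by
      simp only [g, inner_smul_right, real_inner_comm]
    rw [h1]
    nlinarith [hdiss (c t), χ.nonneg (x := c t), mul_nonneg (χ.nonneg (x := c t)) (neg_nonneg.2 (hdiss (c t)))]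
  refine ⟨c, hc0, fun t ht => ?_⟩
  have h2 : ‖c t‖ ^ 2 ≤ ‖x₀‖ ^ 2 := by
    have := hanti (left_mem_Icc.2 hT) ht ht.1
    simpa [hc0] using this
  have h3 : χ (c t) = 1 := by
    refine χ.one_of_mem_closedBall ?_
    rw [mem_closedBall_zero_iff]
    have := abs_le_of_sq_le_sq h2 (norm_nonneg _)
    exact (le_abs_self _).trans (this.trans (by simp [χ, R]))
  have := hc t ht
  simpa [g, h3] using this

end ODE

/-! ### Abstract Galerkin scheme. -/

/-- Galerkin approximation of a dissipative evolution equation `⟪u', w⟫ = A u w`, where `E` is a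
space of test vectors embedded in `H` by `J`, and `V` is a finite dimensional subspace of `E`. -/
theorem exists_galerkin_solution {H : Type*} [NormedAddCommGroup H] [InnerProductSpace ℝ H]
    {E : Type*} [AddCommGroup E] [Module ℝ E] {J : E →ₗ[ℝ] H} (hJ : Function.Injective J)
    {A : H → E →ₗ[ℝ] ℝ} (hA : ∀ w, ContDiff ℝ 1 fun Y => A Y w) (hdiss : ∀ w, A (J w) w ≤ 0)
    (V : Submodule ℝ E) [FiniteDimensional ℝ V] {u₀ : E} (hu₀ : u₀ ∈ V) {T : ℝ} (hT : 0 ≤ T) :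
    ∃ (n : ℕ) (b : Fin n → E) (c : ℝ → Fin n → ℝ), Continuous c ∧ ∑ k, c 0 k • b k = u₀ ∧
      (∀ t, ∑ k, c t k • b k ∈ V) ∧ (∀ t, c t = c (max 0 (min T t))) ∧
      (∀ w ∈ V, ∀ t ∈ Icc 0 T,
        HasDerivWithinAt (fun s => inner ℝ (J (∑ k, c s k • b k)) (J w))
          (A (J (∑ k, c t k • b k)) w) (Icc 0 T) t) ∧
      ∀ t ∈ Icc 0 T, HasDerivWithinAt (fun s => ‖J (∑ k, c s k • b k)‖ ^ 2)
        (2 * A (J (∑ k, c t k • b k)) (∑ k, c t k • b k)) (Icc 0 T) t := by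
  -- The coordinates refer to a basis of `V` whose image is orthonormal in `H`: the Euclidean norm
  -- of the coordinates is then the norm of the state, and no mass matrix has to be inverted.
  let W : Submodule ℝ H := V.map J
  let e := stdOrthonormalBasis ℝ W
  have hb : ∀ k, ∃ b ∈ V, J b = (e k : H) := fun k => (e k).2
  choose b hbV hb using hb
  have hbw : ∀ w ∈ V, w = ∑ k, inner ℝ (J (b k)) (J w) • b k := by
    intro w hw
    refine hJ ?_
    have h1 := e.sum_repr' (⟨J w, w, hw, rfl⟩ : W)
    have h2 := congrArg (Subtype.val) h1
    change _ = J w at h2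
    refine h2.symm.trans ?_
    simp only [map_sum, map_smul, hb]
    push_cast
    rfl
  have horth : ∀ j k, inner ℝ (J (b j)) (J (b k)) = if j = k then (1 : ℝ) else 0 := by
    intro j k
    rw [hb, hb, ← orthonormal_iff_ite.1 e.orthonormal j k]
    rfl
  let u : EuclideanSpace ℝ (Fin (Module.finrank ℝ W)) → E := fun c => ∑ k, c k • b k
  have hJu : ∀ c : EuclideanSpace ℝ (Fin (Module.finrank ℝ W)), J (u c) = ∑ k, c k • J (b k) := fun c => by simp [u]
  have hJuC : ContDiff ℝ 1 fun c : EuclideanSpace ℝ (Fin (Module.finrank ℝ W)) => J (u c) := by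
    simp only [hJu]
    fun_prop
  have hJin : ∀ (c : EuclideanSpace ℝ (Fin (Module.finrank ℝ W))) w, inner ℝ (J (u c)) w = ∑ k, c k * inner ℝ (J (b k)) w := by
    intro c w
    rw [hJu, sum_inner]
    simp [inner_smul_left]
  have hinner : ∀ (c : EuclideanSpace ℝ (Fin (Module.finrank ℝ W))) k, inner ℝ (J (u c)) (J (b k)) = c k := by
    intro c k
    rw [hJin]
    simp [horth]
  have hnorm : ∀ c : EuclideanSpace ℝ (Fin (Module.finrank ℝ W)), ‖J (u c)‖ ^ 2 = ∑ k, c k ^ 2 := by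
    intro c
    rw [← real_inner_self_eq_norm_sq, hJin]
    refine Finset.sum_congr rfl fun k _ => ?_
    rw [real_inner_comm, hinner, sq]
  -- By linearity of `A Y` in the test vector, `⟪f c, c⟫` is `A (J u) u`, so the dissipativity of
  -- `A` is that of the differential equation.
  let f : EuclideanSpace ℝ (Fin (Module.finrank ℝ W)) → EuclideanSpace ℝ (Fin (Module.finrank ℝ W)) := fun c => WithLp.toLp 2 fun k => A (J (u c)) (b k)
  have hf : ContDiff ℝ 1 f := by
    refine (contDiff_piLp 2).2 fun k => ?_
    exact (hA (b k)).comp hJuC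
  have hfd : ∀ c, inner ℝ (f c) c ≤ 0 := by
    intro c
    have h1 : inner ℝ (f c) c = A (J (u c)) (u c) := by
      rw [PiLp.inner_apply]
      simp [f, u]
    exact h1 ▸ hdiss _
  obtain ⟨c, hc0, hc⟩ := exists_solution_of_dissipative hf hfd
    (WithLp.toLp 2 fun k => inner ℝ (J (b k)) (J u₀)) hT
  have hcont : ContinuousOn c (Icc 0 T) := fun t ht => (hc t ht).continuousWithinAt
  -- The solution is frozen outside `[0, T]`, so that the coordinates are continuous on the whole
  -- line.
  have hmem : ∀ t, max 0 (min T t) ∈ Icc 0 T := fun t =>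
    ⟨le_max_left _ _, max_le hT (min_le_left _ _)⟩
  have hclamp : ∀ t ∈ Icc 0 T, max 0 (min T t) = t := fun t ht => by
    rw [min_eq_right ht.2, max_eq_right ht.1]
  have hck : ∀ k, ∀ t ∈ Icc 0 T, HasDerivWithinAt (fun s => c (max 0 (min T s)) k)
      (A (J (u (c (max 0 (min T t))))) (b k)) (Icc 0 T) t := by
    intro k t ht
    rw [hclamp t ht]
    have h1 := (PiLp.hasFDerivAt_apply (𝕜 := ℝ) 2 (c t) k).comp_hasDerivWithinAt t (hc t ht)
    refine h1.congr (fun s hs => ?_) ?_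
    · simp [hclamp s hs]
    · simp [hclamp t ht]
  refine ⟨_, b, fun t => (c (max 0 (min T t))).ofLp, ?_, ?_, fun t => ?_, fun t => ?_,
    fun w hw t ht => ?_, fun t ht => ?_⟩
  · exact (PiLp.continuous_ofLp 2 _).comp (hcont.comp_continuous (by fun_prop) hmem)
  · simp only [hclamp 0 (left_mem_Icc.2 hT), hc0]
    exact (hbw u₀ hu₀).symm
  · exact V.sum_mem fun k _ => V.smul_mem _ (hbV k)
  · simp only [hclamp _ (hmem t)]
  · have h1 : HasDerivWithinAt (fun s => ∑ k, c (max 0 (min T s)) k * inner ℝ (J (b k)) (J w))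
        (∑ k, A (J (u (c (max 0 (min T t))))) (b k) * inner ℝ (J (b k)) (J w)) (Icc 0 T) t :=
      HasDerivWithinAt.fun_sum fun k _ => (hck k t ht).mul_const _
    have h2 : A (J (u (c (max 0 (min T t))))) w =
        ∑ k, A (J (u (c (max 0 (min T t))))) (b k) * inner ℝ (J (b k)) (J w) := by
      conv_lhs => rw [hbw w hw]
      simp [mul_comm]
    change HasDerivWithinAt (fun s => inner ℝ (J (u (c (max 0 (min T s))))) (J w)) _ _ _
    simp only [hJin]
    exact h2 ▸ h1
  · have h1 : HasDerivWithinAt (fun s => ∑ k, c (max 0 (min T s)) k ^ 2)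
        (∑ k, 2 * c (max 0 (min T t)) k * A (J (u (c (max 0 (min T t))))) (b k)) (Icc 0 T) t :=
      HasDerivWithinAt.fun_sum fun k _ => by
        simpa using (hck k t ht).fun_pow 2
    change HasDerivWithinAt (fun s => ‖J (u (c (max 0 (min T s))))‖ ^ 2)
      (2 * A (J (u (c (max 0 (min T t))))) (u (c (max 0 (min T t))))) _ _
    simp only [hnorm]
    refine h1.congr_deriv ?_
    conv_rhs => enter [2, 2]; simp only [u]
    simp [Finset.mul_sum, mul_assoc]

/-! ### Vector calculus and integration by parts. -/

section Calculus

variable {F G W : Type*} [NormedAddCommGroup F] [NormedSpace ℝ F] [NormedAddCommGroup G]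
  [NormedSpace ℝ G] [NormedAddCommGroup W] [NormedSpace ℝ W]

theorem contDiff_pd (i : Fin 3) {f : E3 → F} (hf : ContDiff ℝ ∞ f) : ContDiff ℝ ∞ (pd i f) :=
  (hf.fderiv_right (m := ∞) (by simp)).clm_apply contDiff_const

theorem hasCompactSupport_pd (i : Fin 3) {f : E3 → F} (hf : HasCompactSupport f) :
    HasCompactSupport (pd i f) :=
  hf.fderiv_apply ℝ _

theorem pd_add (i : Fin 3) {f g : E3 → F} (hf : ContDiff ℝ ∞ f) (hg : ContDiff ℝ ∞ g) :
    pd i (f + g) = pd i f + pd i g := by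
  funext x
  simp only [pd, Pi.add_apply]
  rw [fderiv_add (hf.differentiable (by simp) x) (hg.differentiable (by simp) x)]
  rfl

theorem pd_smul (i : Fin 3) (c : ℝ) {f : E3 → F} (hf : ContDiff ℝ ∞ f) :
    pd i (c • f) = c • pd i f := by
  funext x
  simp only [pd, Pi.smul_apply]
  rw [fderiv_const_smul (hf.differentiable (by simp) x)]
  rfl

theorem pd_clm_comp (i : Fin 3) (L : F →L[ℝ] G) {f : E3 → F} (hf : ContDiff ℝ ∞ f) (x : E3) :
    pd i (fun y => L (f y)) x = L (pd i f x) := by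
  simp only [pd]
  rw [show (fun y => L (f y)) = L ∘ f from rfl,
    fderiv_comp x L.differentiableAt (hf.differentiable (by simp) x), L.fderiv]
  rfl

theorem pd_coord (i j : Fin 3) {f : E3 → E3} (hf : ContDiff ℝ ∞ f) (x : E3) :
    pd i (fun y => f y j) x = pd i f x j :=
  pd_clm_comp i (EuclideanSpace.proj j : E3 →L[ℝ] ℝ) hf x

theorem pd_comm (i j : Fin 3) {f : E3 → F} (hf : ContDiff ℝ ∞ f) :
    pd i (pd j f) = pd j (pd i f) := by
  funext x
  have h1 : ∀ i j, pd i (pd j f) x =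
      fderiv ℝ (fderiv ℝ f) x (EuclideanSpace.single i 1) (EuclideanSpace.single j 1) := by
    intro i j
    have h2 := pd_clm_comp i (ContinuousLinearMap.apply ℝ F (EuclideanSpace.single j (1 : ℝ)))
      (hf.fderiv_right (m := ∞) (by simp)) x
    exact h2
  rw [h1, h1]
  have h3 : IsSymmSndFDerivAt ℝ f x :=
    (hf.contDiffAt).isSymmSndFDerivAt (by
      simpa using ENat.LEInfty.out)
  exact h3 _ _

theorem laplacian_eq_sum_pd {f : E3 → F} (hf : ContDiff ℝ ∞ f) (x : E3) :
    Laplacian.laplacian f x = ∑ i, pd i (pd i f) x := by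
  rw [InnerProductSpace.laplacian_eq_iteratedFDeriv_orthonormalBasis f
    (EuclideanSpace.basisFun (Fin 3) ℝ)]
  refine Finset.sum_congr rfl fun i _ => ?_
  rw [iteratedFDeriv_two_apply]
  change fderiv ℝ (fderiv ℝ f) x _ _ = _
  have h2 := pd_clm_comp i (ContinuousLinearMap.apply ℝ F (EuclideanSpace.single i (1 : ℝ)))
      (hf.fderiv_right (m := ∞) (by simp)) x
  simp only [Matrix.cons_val_zero, Matrix.cons_val_one, EuclideanSpace.basisFun_apply]
  exact h2.symm

theorem fderiv_eq_sum_pd (f : E3 → F) (x v : E3) : fderiv ℝ f x v = ∑ i, v i • pd i f x := by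
  conv_lhs => rw [← (EuclideanSpace.basisFun (Fin 3) ℝ).sum_repr v]
  simp [pd]

theorem norm_fderiv_apply_sq_le (f : E3 → F) (x v : E3) :
    ‖fderiv ℝ f x v‖ ^ 2 ≤ ‖v‖ ^ 2 * ∑ i, ‖pd i f x‖ ^ 2 := by
  rw [fderiv_eq_sum_pd, EuclideanSpace.norm_sq_eq]
  have h1 : ‖∑ i, v i • pd i f x‖ ≤ ∑ i, ‖v i‖ * ‖pd i f x‖ :=
    (norm_sum_le _ _).trans_eq (by simp [norm_smul])
  refine (pow_le_pow_left₀ (norm_nonneg _) h1 2).trans ?_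
  exact Finset.sum_mul_sq_le_sq_mul_sq _ _ _

theorem norm_pd_le (i : Fin 3) (f : E3 → F) (x : E3) : ‖pd i f x‖ ≤ ‖fderiv ℝ f x‖ := by
  refine (ContinuousLinearMap.le_opNorm _ _).trans ?_
  simp

/-- Integration by parts when one of the factors has compact support. -/
theorem integral_bilin_pd (i : Fin 3) (B : F →L[ℝ] G →L[ℝ] W) {f : E3 → F} {g : E3 → G}
    (hf : ContDiff ℝ ∞ f) (hg : ContDiff ℝ ∞ g)
    (h : HasCompactSupport f ∨ HasCompactSupport g) :
    ∫ x, B (f x) (pd i g x) = - ∫ x, B (pd i f x) (g x) := by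
  have hint : ∀ {f : E3 → F} {g : E3 → G}, Continuous f → Continuous g →
      HasCompactSupport f ∨ HasCompactSupport g → Integrable fun x => B (f x) (g x) := by
    intro f g hf hg h
    refine Continuous.integrable_of_hasCompactSupport
      ((B.continuous.comp hf).clm_apply hg) ?_
    rcases h with h | h
    · exact h.mono fun x hx hfx => hx (by simp [hfx])
    · exact h.mono fun x hx hfx => hx (by simp [hfx])
  refine integral_bilinear_fderiv_right_eq_neg_left_of_integrable ?_ ?_ ?_
    (fun x _ => hf.differentiable (by simp) x) (fun x _ => hg.differentiable (by simp) x)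
  · exact hint (contDiff_pd i hf).continuous hg.continuous
      (h.imp_left (hasCompactSupport_pd i))
  · exact hint hf.continuous (contDiff_pd i hg).continuous
      (h.imp_right (hasCompactSupport_pd i))
  · exact hint hf.continuous hg.continuous h

theorem integral_mul_pd (i : Fin 3) {f g : E3 → ℝ} (hf : ContDiff ℝ ∞ f) (hg : ContDiff ℝ ∞ g)
    (h : HasCompactSupport f ∨ HasCompactSupport g) :
    ∫ x, f x * pd i g x = - ∫ x, pd i f x * g x :=
  integral_bilin_pd i (ContinuousLinearMap.mul ℝ ℝ) hf hg h

theorem integral_inner_pd {F : Type*} [NormedAddCommGroup F] [InnerProductSpace ℝ F]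
    (i : Fin 3) {f g : E3 → F} (hf : ContDiff ℝ ∞ f)
    (hg : ContDiff ℝ ∞ g) (h : HasCompactSupport f ∨ HasCompactSupport g) :
    ∫ x, inner ℝ (f x) (pd i g x) = - ∫ x, inner ℝ (pd i f x) (g x) :=
  integral_bilin_pd i (innerSL ℝ) hf hg h

theorem pd_fun_sub (i : Fin 3) {f g : E3 → F} (hf : ContDiff ℝ ∞ f) (hg : ContDiff ℝ ∞ g)
    (x : E3) : pd i (fun y => f y - g y) x = pd i f x - pd i g x := by
  simp only [pd]
  rw [fderiv_fun_sub (hf.differentiable (by simp) x) (hg.differentiable (by simp) x)]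
  rfl

theorem pd_fun_sum (i : Fin 3) {ι : Type*} (s : Finset ι) {f : ι → E3 → F}
    (hf : ∀ j ∈ s, ContDiff ℝ ∞ (f j)) (x : E3) :
    pd i (fun y => ∑ j ∈ s, f j y) x = ∑ j ∈ s, pd i (f j) x := by
  simp only [pd]
  rw [fderiv_fun_sum fun j hj => (hf j hj).differentiable (by simp) x]
  simp

theorem gradient_apply (ψ : E3 → ℝ) (x : E3) (i : Fin 3) :
    gradient ψ x i = pd i ψ x := by
  have h1 : inner ℝ (gradient ψ x) (EuclideanSpace.single i (1 : ℝ)) = pd i ψ x := by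
    rw [gradient, InnerProductSpace.toDual_symm_apply]
    rfl
  rw [← h1, EuclideanSpace.inner_single_right]
  simp

theorem contDiff_coord {f : E3 → E3} (hf : ContDiff ℝ ∞ f) (j : Fin 3) :
    ContDiff ℝ ∞ fun y => f y j :=
  (EuclideanSpace.proj j : E3 →L[ℝ] ℝ).contDiff.comp hf

theorem contDiff_gradient {ψ : E3 → ℝ} (hψ : ContDiff ℝ ∞ ψ) : ContDiff ℝ ∞ (gradient ψ) := by
  refine (contDiff_piLp 2).2 fun i => ?_
  simp only [gradient_apply]
  exact contDiff_pd i hψ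

theorem hasCompactSupport_gradient {ψ : E3 → ℝ} (hψ : HasCompactSupport ψ) :
    HasCompactSupport (gradient ψ) := by
  refine (hψ.fderiv ℝ).mono fun x hx hfx => hx ?_
  simp [gradient, hfx]

theorem pd_gradient_apply {ψ : E3 → ℝ} (hψ : ContDiff ℝ ∞ ψ) (i j : Fin 3) (x : E3) :
    pd i (gradient ψ) x j = pd i (pd j ψ) x := by
  rw [← pd_coord i j (contDiff_gradient hψ)]
  congr 1
  funext y
  exact gradient_apply ψ y j

theorem curl_gradient {ψ : E3 → ℝ} (hψ : ContDiff ℝ ∞ ψ) (x : E3) : curl (gradient ψ) x = 0 := by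
  ext j
  fin_cases j <;> simp [curl, pd_gradient_apply hψ, sub_eq_zero] <;>
    exact congrFun (pd_comm _ _ hψ) x

theorem curl_apply (f : E3 → E3) (x : E3) (i : Fin 3) :
    curl f x i = pd (i + 1) f x (i + 2) - pd (i + 2) f x (i + 1) := by
  fin_cases i <;> rfl

theorem contDiff_curl {f : E3 → E3} (hf : ContDiff ℝ ∞ f) : ContDiff ℝ ∞ (curl f) := by
  refine (contDiff_piLp 2).2 fun i => ?_
  simp only [curl_apply]
  exact (contDiff_coord (contDiff_pd _ hf) _).sub (contDiff_coord (contDiff_pd _ hf) _)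

theorem hasCompactSupport_curl {f : E3 → E3} (hf : HasCompactSupport f) :
    HasCompactSupport (curl f) := by
  refine (hf.fderiv ℝ).mono fun x hx hfx => hx ?_
  ext i
  simp [curl_apply, pd, hfx]

theorem pd_curl_apply {f : E3 → E3} (hf : ContDiff ℝ ∞ f) (i j : Fin 3) (x : E3) :
    pd i (curl f) x j =
      pd i (pd (j + 1) f) x (j + 2) - pd i (pd (j + 2) f) x (j + 1) := by
  rw [← pd_coord i j (contDiff_curl hf)]
  simp only [curl_apply]
  have h1 := fun k => contDiff_pd k hf
  rw [pd_fun_sub i (contDiff_coord (h1 _) _) (contDiff_coord (h1 _) _), pd_coord i _ (h1 _),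
    pd_coord i _ (h1 _)]

theorem divergence_curl {f : E3 → E3} (hf : ContDiff ℝ ∞ f) (x : E3) :
    divergence (curl f) x = 0 := by
  simp only [divergence, Fin.sum_univ_three, pd_curl_apply hf]
  have h1 := fun i j => congrFun (pd_comm i j hf) x
  simp only [Fin.isValue, zero_add, Fin.reduceAdd]
  rw [h1 1 0, h1 2 0, h1 2 1]
  ring

theorem contDiff_divergence {f : E3 → E3} (hf : ContDiff ℝ ∞ f) : ContDiff ℝ ∞ (divergence f) :=
  ContDiff.sum fun i _ => contDiff_coord (contDiff_pd i hf) i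

theorem hasCompactSupport_divergence {f : E3 → E3} (hf : HasCompactSupport f) :
    HasCompactSupport (divergence f) := by
  refine (hf.fderiv ℝ).mono fun x hx hfx => hx ?_
  simp [divergence, pd, hfx]

/-- `Δ = grad div - curl curl`. -/
theorem laplacian_eq_gradient_divergence_sub_curl_curl {f : E3 → E3} (hf : ContDiff ℝ ∞ f)
    (x : E3) : Laplacian.laplacian f x = gradient (divergence f) x - curl (curl f) x := by
  have h1 := fun i j => congrFun (pd_comm i j hf) x
  have h2 : ∀ j, pd j (divergence f) x = ∑ i, pd j (pd i f) x i := by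
    intro j
    exact (pd_fun_sum j _ (fun i _ => contDiff_coord (contDiff_pd i hf) i) x).trans
      (Finset.sum_congr rfl fun i _ => pd_coord j i (contDiff_pd i hf) x)
  rw [laplacian_eq_sum_pd hf]
  ext j
  simp only [PiLp.sub_apply, gradient_apply, h2, curl_apply,
    pd_curl_apply hf, Fin.sum_univ_three, PiLp.add_apply]
  fin_cases j <;> simp <;> simp only [h1 1 0, h1 2 0, h1 2 1] <;> ring

theorem integral_inner_laplacian_self {f : E3 → E3} (hf : ContDiff ℝ ∞ f)
    (hs : HasCompactSupport f) :
    ∫ x, inner ℝ (f x) (Laplacian.laplacian f x) = - ∑ i, ∫ x, ‖pd i f x‖ ^ 2 := by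
  simp only [laplacian_eq_sum_pd hf, inner_sum]
  rw [integral_finsetSum _ fun i _ => ?_, ← Finset.sum_neg_distrib]
  · refine Finset.sum_congr rfl fun i _ => ?_
    rw [integral_inner_pd i hf (contDiff_pd i hf) (Or.inl hs)]
    simp only [real_inner_self_eq_norm_sq]
  · refine Continuous.integrable_of_hasCompactSupport
      (hf.continuous.inner (contDiff_pd i (contDiff_pd i hf)).continuous) ?_
    exact hs.mono fun x hx hfx => hx (by simp [hfx])

/-- Convection does no work: `f · (f·∇)f = ½ f·∇|f|²`, and an integration by parts leaves `-½ |f|²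
div f`. -/
theorem integral_inner_fderiv_self {f : E3 → E3} (hf : ContDiff ℝ ∞ f)
    (hs : HasCompactSupport f) (hdiv : ∀ x, divergence f x = 0) :
    ∫ x, inner ℝ (f x) (fderiv ℝ f x (f x)) = 0 := by
  let q : E3 → ℝ := fun x => ‖f x‖ ^ 2
  have hq : ContDiff ℝ ∞ q := hf.norm_sq ℝ
  have hpq : ∀ i x, pd i q x = 2 * inner ℝ (f x) (pd i f x) := by
    intro i x
    have h1 := ((hf.differentiable (by simp) x).hasFDerivAt.norm_sq).fderiv
    simp only [pd, q]
    rw [h1]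
    simp
  have hqs : ∀ g : E3 → ℝ, Continuous g → Integrable fun x => q x * g x := fun g hg =>
    Continuous.integrable_of_hasCompactSupport (hq.continuous.mul hg)
      (hs.mono fun x hx hfx => hx (by simp [q, hfx]))
  have hc := fun i => contDiff_coord hf i
  have h2 : ∀ i, ∫ x, f x i * pd i q x = - ∫ x, q x * pd i f x i := by
    intro i
    rw [integral_mul_pd i (hc i) hq (Or.inl (hs.mono fun x hx hfx => hx (by simp [hfx])))]
    simp only [pd_coord i i hf, mul_comm]
  have h3 : ∀ i, Integrable fun x => f x i * pd i q x := fun i =>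
    Continuous.integrable_of_hasCompactSupport ((hc i).continuous.mul (contDiff_pd i hq).continuous)
      (hs.mono fun x hx hfx => hx (by simp [hfx]))
  have h4 : ∀ x, inner ℝ (f x) (fderiv ℝ f x (f x)) = (1 / 2) * ∑ i, f x i * pd i q x := by
    intro x
    rw [fderiv_eq_sum_pd, inner_sum, Finset.mul_sum]
    refine Finset.sum_congr rfl fun i _ => ?_
    rw [hpq, inner_smul_right]
    ring
  simp only [h4]
  rw [integral_const_mul, integral_finsetSum _ fun i _ => h3 i]
  simp only [h2]
  rw [Finset.sum_neg_distrib, ← integral_finsetSum _ fun i _ =>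
    hqs _ (contDiff_coord (contDiff_pd i hf) i).continuous]
  have h5 : ∀ x, ∑ i, q x * pd i f x i = 0 := by
    intro x
    rw [← Finset.mul_sum]
    have := hdiv x
    rw [divergence] at this
    rw [this, mul_zero]
  simp [h5]

/-- Symmetry of the curl, the reason why the exchange between `E` and `B` conserves energy. -/
theorem integral_inner_curl {f g : E3 → E3} (hf : ContDiff ℝ ∞ f) (hg : ContDiff ℝ ∞ g)
    (hs : HasCompactSupport f) :
    ∫ x, inner ℝ (f x) (curl g x) = ∫ x, inner ℝ (curl f x) (g x) := by
  have hcf := fun i => contDiff_coord hf i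
  have hcg := fun i => contDiff_coord hg i
  have hsf : ∀ i, HasCompactSupport fun x => f x i := fun i =>
    hs.mono fun x hx hfx => hx (by simp [hfx])
  have h1 : ∀ i j k, ∫ x, f x i * pd j g x k = - ∫ x, pd j f x i * g x k := by
    intro i j k
    have := integral_mul_pd j (hcf i) (hcg k) (Or.inl (hsf i))
    simpa only [pd_coord _ _ hf, pd_coord _ _ hg] using this
  have i1 : ∀ i j k, Integrable fun x => f x i * pd j g x k := fun i j k =>
    Continuous.integrable_of_hasCompactSupport
      ((hcf i).continuous.mul (contDiff_coord (contDiff_pd j hg) k).continuous)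
      ((hsf i).mono fun x hx hfx => hx (by simpa using Or.inl hfx))
  have i2 : ∀ i j k, Integrable fun x => pd j f x i * g x k := fun i j k =>
    Continuous.integrable_of_hasCompactSupport
      ((contDiff_coord (contDiff_pd j hf) i).continuous.mul (hcg k).continuous)
      ((hasCompactSupport_pd j hs).mono fun x hx hfx => hx (by simp [hfx]))
  have e1 : ∀ x, inner ℝ (f x) (curl g x) =
      ∑ i, (f x i * pd (i + 1) g x (i + 2) - f x i * pd (i + 2) g x (i + 1)) := by
    intro x
    rw [PiLp.inner_apply]
    refine Finset.sum_congr rfl fun i _ => ?_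
    rw [curl_apply]
    simp
    ring
  have e2 : ∀ x, inner ℝ (curl f x) (g x) =
      ∑ i, (pd (i + 1) f x (i + 2) * g x i - pd (i + 2) f x (i + 1) * g x i) := by
    intro x
    rw [PiLp.inner_apply]
    refine Finset.sum_congr rfl fun i _ => ?_
    rw [curl_apply]
    simp
    ring
  simp only [e1, e2]
  rw [integral_finsetSum _ fun i _ => by exact (i1 i (i + 1) (i + 2)).sub (i1 i (i + 2) (i + 1)),
    integral_finsetSum _ fun i _ => by exact (i2 (i + 2) (i + 1) i).sub (i2 (i + 1) (i + 2) i)]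
  simp only [fun i => integral_sub (i1 i (i + 1) (i + 2)) (i1 i (i + 2) (i + 1)),
    fun i => integral_sub (i2 (i + 2) (i + 1) i) (i2 (i + 1) (i + 2) i), h1,
    Fin.sum_univ_three]
  simp only [Fin.isValue, zero_add, Fin.reduceAdd]
  ring

end Calculus

/-! ### Test fields, their embedding in `L²`, and the multiplication operators they define. -/

section TestFields

/-- Smooth compactly supported vector fields on `ℝ³`. -/
def testFields : Submodule ℝ (E3 → E3) where
  carrier := {w | ContDiff ℝ ∞ w ∧ HasCompactSupport w}
  add_mem' h₁ h₂ := ⟨h₁.1.add h₂.1, h₁.2.add h₂.2⟩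
  zero_mem' := ⟨contDiff_const, HasCompactSupport.zero⟩
  smul_mem' c _ h := ⟨h.1.const_smul c, h.2.smul_left (f := fun _ => c)⟩

/-- The space `C_c^∞(ℝ³; ℝ³)`. -/
abbrev Test : Type := ↥testFields

instance : CoeFun Test fun _ => E3 → E3 := ⟨Subtype.val⟩

theorem Test.contDiff (w : Test) : ContDiff ℝ ∞ w := w.2.1

theorem Test.hasCompactSupport (w : Test) : HasCompactSupport w := w.2.2

theorem Test.continuous (w : Test) : Continuous w := w.contDiff.continuous

theorem Test.memLp (w : Test) (p : ℝ≥0∞) : MemLp w p (volume : Measure E3) :=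
  w.continuous.memLp_of_hasCompactSupport w.hasCompactSupport

/-- The embedding of test fields into `L²`. -/
def toL2 : Test →ₗ[ℝ] L2 where
  toFun w := (w.memLp 2).toLp w
  map_add' _ _ := rfl
  map_smul' _ _ := rfl

theorem coeFn_toL2 (w : Test) : toL2 w =ᵐ[volume] w := (w.memLp 2).coeFn_toLp

theorem inner_toL2 (u : L2) (w : Test) : inner ℝ u (toL2 w) = ∫ x, inner ℝ (u x) (w x) := by
  rw [L2.inner_def]
  refine integral_congr_ae ?_
  filter_upwards [coeFn_toL2 w] with x hx
  rw [hx]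

theorem inner_toL2_toL2 (v w : Test) :
    inner ℝ (toL2 v) (toL2 w) = ∫ x, inner ℝ (v x) (w x) := by
  rw [inner_toL2]
  refine integral_congr_ae ?_
  filter_upwards [coeFn_toL2 v] with x hx
  rw [hx]

theorem norm_toL2_sq (w : Test) : ‖toL2 w‖ ^ 2 = ∫ x, ‖w x‖ ^ 2 := by
  rw [← real_inner_self_eq_norm_sq, inner_toL2_toL2]
  simp only [real_inner_self_eq_norm_sq]

theorem toL2_injective : Function.Injective toL2 := by
  intro v w h
  have h1 : (v : E3 → E3) =ᵐ[volume] w :=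
    (coeFn_toL2 v).symm.trans (h ▸ coeFn_toL2 w)
  exact Subtype.ext ((v.continuous.ae_eq_iff_eq volume w.continuous).1 h1)

/-- A scalar test function times a fixed vector. -/
def Test.ofScalar (ψ : E3 → ℝ) (hψ : ContDiff ℝ ∞ ψ) (hs : HasCompactSupport ψ) (a : E3) : Test :=
  ⟨fun x => ψ x • a, hψ.smul contDiff_const, hs.smul_right⟩

theorem dense_range_toL2 : Dense (range toL2) := by
  have h1 : (LinearMap.range toL2).topologicalClosure = ⊤ := by
    rw [Submodule.topologicalClosure_eq_top_iff, Submodule.eq_bot_iff]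
    intro u hu
    rw [Submodule.mem_orthogonal'] at hu
    have h2 : ∀ᵐ x ∂(volume : Measure E3), u x = 0 := by
      refine ae_eq_zero_of_integral_contDiff_smul_eq_zero
        ((Lp.memLp u).locallyIntegrable (by norm_num)) fun g hg hgs => ?_
      refine ext_inner_right ℝ fun a => ?_
      have h3 := hu _ ⟨Test.ofScalar g hg hgs a, rfl⟩
      have h4 : Integrable fun x => g x • u x :=
        ((Lp.memLp u).locallyIntegrable (by norm_num)).integrable_smul_left_of_hasCompactSupport
          hg.continuous hgs
      rw [inner_toL2] at h3
      rw [inner_zero_left, ← h3, real_inner_comm, ← integral_inner h4]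
      refine integral_congr_ae (Eventually.of_forall fun x => ?_)
      simp [Test.ofScalar, inner_smul_right, real_inner_comm]
    exact (Lp.eq_zero_iff_ae_eq_zero).2 h2
  have h5 := Submodule.dense_iff_topologicalClosure_eq_top.2 h1
  rwa [LinearMap.coe_range] at h5

/-- Partial derivatives of test fields. -/
def pdT (i : Fin 3) : Test →ₗ[ℝ] Test where
  toFun w := ⟨pd i w, contDiff_pd i w.contDiff, hasCompactSupport_pd i w.hasCompactSupport⟩
  map_add' v w := Subtype.ext (pd_add i v.contDiff w.contDiff)
  map_smul' c w := Subtype.ext (pd_smul i c w.contDiff)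

@[simp] theorem pdT_apply (i : Fin 3) (w : Test) (x : E3) : pdT i w x = pd i w x := rfl

/-- The Laplacian of test fields. -/
def lapT : Test →ₗ[ℝ] Test := ∑ i, pdT i ∘ₗ pdT i

theorem lapT_apply (w : Test) (x : E3) : lapT w x = Laplacian.laplacian (w : E3 → E3) x := by
  rw [laplacian_eq_sum_pd w.contDiff]
  simp only [lapT, Fin.sum_univ_three]
  rfl

/-- The curl of test fields. -/
def curlT : Test →ₗ[ℝ] Test where
  toFun w := ⟨curl w, contDiff_curl w.contDiff, hasCompactSupport_curl w.hasCompactSupport⟩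
  map_add' v w := by
    refine Subtype.ext (funext fun x => ?_)
    ext i
    change curl (v.1 + w.1) x i = (curl v x + curl w x) i
    rw [PiLp.add_apply]
    simp only [curl_apply, pd_add _ v.contDiff w.contDiff, Pi.add_apply, PiLp.add_apply]
    ring
  map_smul' c w := by
    refine Subtype.ext (funext fun x => ?_)
    ext i
    change curl (c • w.1) x i = (c • curl w x) i
    rw [PiLp.smul_apply]
    simp only [curl_apply, pd_smul _ c w.contDiff, Pi.smul_apply, PiLp.smul_apply, smul_eq_mul]
    ring

@[simp] theorem curlT_apply (w : Test) (x : E3) : curlT w x = curl w x := rfl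

/-- The cross product as a continuous bilinear map. -/
def crossL : E3 →L[ℝ] E3 →L[ℝ] E3 :=
  (LinearMap.mk₂ ℝ cross
    (fun a b c => by simp [cross, map_add])
    (fun r a b => by simp [cross, map_smul])
    (fun a b c => by simp [cross, map_add])
    (fun r a b => by simp [cross, map_smul])).toContinuousBilinearMap

@[simp] theorem crossL_apply (a b : E3) : crossL a b = cross a b := rfl

/-- Cyclic symmetry of the triple product. It turns the magnetic force into a pairing of `B` with a
bounded matrix field applied to the velocity, the shape required by `tendsto_integral_actL`. -/
theorem inner_cross_comm (v B w : E3) : inner ℝ (cross v B) w = inner ℝ (cross w v) B := by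
  simp [cross, PiLp.inner_apply, Fin.sum_univ_three, cross_apply]
  ring

theorem inner_cross_self (v B : E3) : inner ℝ (cross v B) v = 0 := by
  simp [cross, PiLp.inner_apply, Fin.sum_univ_three, cross_apply]
  ring

/-- Bounded matrix fields. -/
abbrev LTop : Type := Lp (E3 →L[ℝ] E3) ∞ (volume : Measure E3)

/-- The action of bounded matrix fields on `L²`. -/
def actL : LTop →L[ℝ] L2 →L[ℝ] L2 :=
  (ContinuousLinearMap.id ℝ (E3 →L[ℝ] E3)).holderL (volume : Measure E3) ∞ 2 2

theorem coeFn_actL (σ : LTop) (u : L2) : actL σ u =ᵐ[volume] fun x => σ x (u x) :=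
  (ContinuousLinearMap.id ℝ (E3 →L[ℝ] E3)).coeFn_holder σ u

theorem continuous_fderiv_test (w : Test) : Continuous (fderiv ℝ w) :=
  w.contDiff.continuous_fderiv (by simp)

theorem memLp_fderiv_test (w : Test) (p : ℝ≥0∞) : MemLp (fderiv ℝ w) p (volume : Measure E3) :=
  (continuous_fderiv_test w).memLp_of_hasCompactSupport (w.hasCompactSupport.fderiv ℝ)

/-- The Jacobian matrix of a test field, as a bounded matrix field. -/
def jacobian : Test →ₗ[ℝ] LTop where
  toFun w := (memLp_fderiv_test w ∞).toLp _
  map_add' v w := by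
    rw [← MemLp.toLp_add]
    refine MemLp.toLp_congr _ _ (Eventually.of_forall fun x => ?_)
    exact fderiv_add (v.contDiff.differentiable (by simp) x) (w.contDiff.differentiable (by simp) x)
  map_smul' c w := by
    rw [RingHom.id_apply, ← MemLp.toLp_const_smul]
    refine MemLp.toLp_congr _ _ (Eventually.of_forall fun x => ?_)
    exact fderiv_const_smul (w.contDiff.differentiable (by simp) x) c

theorem memLp_crossL (w : Test) (p : ℝ≥0∞) :
    MemLp (fun x => crossL (w x)) p (volume : Measure E3) :=
  (crossL.continuous.comp w.continuous).memLp_of_hasCompactSupport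
    (w.hasCompactSupport.comp_left (map_zero crossL))

/-- The matrix field `w × ·` of a test field `w`. -/
def crossMatrix : Test →ₗ[ℝ] LTop where
  toFun w := (memLp_crossL w ∞).toLp _
  map_add' v w := by
    rw [← MemLp.toLp_add]
    refine MemLp.toLp_congr _ _ (Eventually.of_forall fun x => ?_)
    exact map_add crossL _ _
  map_smul' c w := by
    rw [RingHom.id_apply, ← MemLp.toLp_const_smul]
    refine MemLp.toLp_congr _ _ (Eventually.of_forall fun x => ?_)
    exact map_smul crossL _ _

theorem coeFn_actL_jacobian (w : Test) (u : L2) :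
    actL (jacobian w) u =ᵐ[volume] fun x => fderiv ℝ w x (u x) := by
  filter_upwards [coeFn_actL (jacobian w) u, (memLp_fderiv_test w ∞).coeFn_toLp] with x h1 h2
  rw [h1, ← h2]
  rfl

theorem coeFn_actL_crossMatrix (w : Test) (u : L2) :
    actL (crossMatrix w) u =ᵐ[volume] fun x => cross (w x) (u x) := by
  filter_upwards [coeFn_actL (crossMatrix w) u, (memLp_crossL w ∞).coeFn_toLp] with x h1 h2
  rw [h1, ← crossL_apply, ← h2]
  rfl

theorem norm_toLp_top_le {G : Type*} [NormedAddCommGroup G] {f : E3 → G}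
    (hf : MemLp f ∞ (volume : Measure E3)) {K : ℝ} (hK : 0 ≤ K) (h : ∀ x, ‖f x‖ ≤ K) :
    ‖hf.toLp f‖ ≤ K := by
  rw [Lp.norm_toLp]
  refine ENNReal.toReal_le_of_le_ofReal hK ?_
  rw [eLpNorm_exponent_top]
  exact eLpNormEssSup_le_of_ae_bound (Eventually.of_forall h)

theorem norm_toL2_le_of_bound {w : Test} {R K : ℝ} (hK : 0 ≤ K)
    (hs : Function.support w ⊆ Metric.closedBall 0 R) (h : ∀ x, ‖w x‖ ≤ K) :
    ‖toL2 w‖ ≤ √(volume.real (Metric.closedBall (0 : E3) R)) * K := by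
  have h1 : ‖toL2 w‖ ^ 2 ≤ volume.real (Metric.closedBall (0 : E3) R) * K ^ 2 := by
    rw [norm_toL2_sq]
    have h2 : ∀ x, ‖w x‖ ^ 2 ≤ (Metric.closedBall (0 : E3) R).indicator (fun _ => K ^ 2) x := by
      intro x
      by_cases hx : x ∈ Metric.closedBall (0 : E3) R
      · rw [indicator_of_mem hx]
        exact pow_le_pow_left₀ (norm_nonneg _) (h x) 2
      · rw [indicator_of_notMem hx]
        have : w x = 0 := by
          by_contra h3
          exact hx (hs h3)
        simp [this]
    refine (integral_mono_of_nonneg (Eventually.of_forall fun x => sq_nonneg _) ?_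
      (Eventually.of_forall h2)).trans_eq ?_
    · exact (integrable_indicator_iff Metric.isClosed_closedBall.measurableSet).2
        (integrableOn_const (by exact (isCompact_closedBall (0 : E3) R).measure_ne_top))
    · rw [integral_indicator_const _ Metric.isClosed_closedBall.measurableSet, smul_eq_mul]
  refine le_of_sq_le_sq ?_ (by positivity)
  rw [mul_pow, Real.sq_sqrt measureReal_nonneg]
  exact h1

/-- The size of a test field, as a test field of the two-fluid system. -/
def jetNorm (w : Test) : ℝ :=
  ‖toL2 w‖ + ‖toL2 (lapT w)‖ + ‖toL2 (curlT w)‖ + ‖jacobian w‖ + ‖crossMatrix w‖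

theorem jetNorm_nonneg (w : Test) : 0 ≤ jetNorm w := by
  unfold jetNorm
  positivity

theorem norm_curl_le (f : E3 → E3) (x : E3) : ‖curl f x‖ ≤ 6 * ‖fderiv ℝ f x‖ := by
  have h1 : ∀ i j, |pd i f x j| ≤ ‖fderiv ℝ f x‖ := fun i j =>
    (PiLp.norm_apply_le (pd i f x) j).trans (norm_pd_le i f x)
  have h2 : ∀ i, |curl f x i| ≤ 2 * ‖fderiv ℝ f x‖ := by
    intro i
    rw [curl_apply]
    have := abs_sub (pd (i + 1) f x (i + 2)) (pd (i + 2) f x (i + 1))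
    linarith [h1 (i + 1) (i + 2), h1 (i + 2) (i + 1)]
  have h3 : ‖curl f x‖ ^ 2 ≤ (6 * ‖fderiv ℝ f x‖) ^ 2 := by
    rw [EuclideanSpace.norm_sq_eq, Fin.sum_univ_three]
    have h4 : ∀ i, ‖curl f x i‖ ^ 2 ≤ (2 * ‖fderiv ℝ f x‖) ^ 2 := fun i =>
      pow_le_pow_left₀ (norm_nonneg _) (h2 i) 2
    nlinarith [h4 0, h4 1, h4 2, sq_nonneg ‖fderiv ℝ f x‖]
  exact le_of_sq_le_sq h3 (by positivity)

/-- For supports in a fixed ball, the size of a test field in the weak form is controlled by uniform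
bounds. Both the density of countably many test states and the regularity in time of test fields are
checked through these bounds. -/
theorem jetNorm_le (R : ℝ) : ∃ C, 0 ≤ C ∧ ∀ w : Test,
    Function.support w ⊆ Metric.closedBall 0 R → ∀ K, 0 ≤ K →
    (∀ x, ‖w x‖ ≤ K) → (∀ x, ‖fderiv ℝ w x‖ ≤ K) → (∀ x, ‖Laplacian.laplacian (w : E3 → E3) x‖ ≤ K) →
    jetNorm w ≤ C * K := by
  let c := √(volume.real (Metric.closedBall (0 : E3) R))
  refine ⟨c + c + c * 6 + 1 + ‖crossL‖, by positivity, fun w hw K hK h0 h1 h2 => ?_⟩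
  have hts : tsupport w ⊆ Metric.closedBall 0 R :=
    closure_minimal hw Metric.isClosed_closedBall
  have e1 : ‖toL2 w‖ ≤ c * K := norm_toL2_le_of_bound hK hw h0
  have e2 : ‖toL2 (lapT w)‖ ≤ c * K := by
    refine norm_toL2_le_of_bound hK ?_ fun x => by rw [lapT_apply]; exact h2 x
    intro x hx
    by_contra hxR
    refine hx ?_
    have : (w : E3 → E3) =ᶠ[𝓝 x] 0 := notMem_tsupport_iff_eventuallyEq.1 fun h => hxR (hts h)
    rw [lapT_apply, (InnerProductSpace.laplacian_congr_nhds this).eq_of_nhds]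
    exact congrFun InnerProductSpace.laplacian_const x
  have e3 : ‖toL2 (curlT w)‖ ≤ c * (6 * K) := by
    refine norm_toL2_le_of_bound (by positivity) ?_ fun x =>
      (norm_curl_le w x).trans (by gcongr; exact h1 x)
    intro x hx
    by_contra hxR
    refine hx ?_
    have h3 : fderiv ℝ w x = 0 := by
      by_contra h4
      exact hxR (hts (support_fderiv_subset ℝ h4))
    have := norm_curl_le w x
    rw [h3, norm_zero, mul_zero] at this
    exact norm_le_zero_iff.1 this
  have e4 : ‖jacobian w‖ ≤ K := norm_toLp_top_le (memLp_fderiv_test w ∞) hK h1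
  have e5 : ‖crossMatrix w‖ ≤ ‖crossL‖ * K :=
    norm_toLp_top_le (memLp_crossL w ∞) (by positivity) fun x => (crossL.le_opNorm _).trans (by gcongr; exact h0 x)
  unfold jetNorm
  linarith

end TestFields

/-! ### Mollification estimates. -/

/-- Minkowski's inequality for `L²` averages. -/
theorem lintegral_lintegral_sq_le {X Y : Type*} [MeasurableSpace X] [MeasurableSpace Y]
    (μ : Measure X) (ν : Measure Y) [SFinite μ] [SFinite ν] {k : X → Y → ℝ≥0∞}
    (hk : Measurable (Function.uncurry k)) {M : ℝ≥0∞}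
    (hM : ∀ᵐ y ∂ν, ∫⁻ x, k x y ^ 2 ∂μ ≤ M) :
    ∫⁻ x, (∫⁻ y, k x y ∂ν) ^ 2 ∂μ ≤ ν univ ^ 2 * M := by
  have hkx : ∀ x, Measurable (k x) := fun x => hk.comp measurable_prodMk_left
  have h1 : ∀ x, (∫⁻ y, k x y ∂ν) ^ 2 ≤ ν univ * ∫⁻ y, k x y ^ 2 ∂ν := by
    intro x
    have h2 := ENNReal.lintegral_mul_le_Lp_mul_Lq ν Real.HolderConjugate.two_two
      (measurable_const (a := (1 : ℝ≥0∞))).aemeasurable (hkx x).aemeasurable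
    simp only [Pi.mul_apply, one_mul, ENNReal.one_rpow, lintegral_one] at h2
    refine (pow_le_pow_left₀ zero_le h2 2).trans_eq ?_
    rw [mul_pow, ← ENNReal.rpow_natCast, ← ENNReal.rpow_natCast, ← ENNReal.rpow_mul,
      ← ENNReal.rpow_mul]
    norm_num
  calc ∫⁻ x, (∫⁻ y, k x y ∂ν) ^ 2 ∂μ ≤ ∫⁻ x, ν univ * ∫⁻ y, k x y ^ 2 ∂ν ∂μ := lintegral_mono h1
    _ = ν univ * ∫⁻ x, ∫⁻ y, k x y ^ 2 ∂ν ∂μ := by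
        rw [lintegral_const_mul]
        exact (hk.pow_const 2).lintegral_prod_right'
    _ = ν univ * ∫⁻ y, ∫⁻ x, k x y ^ 2 ∂μ ∂ν := by
        rw [lintegral_lintegral_swap (hk.pow_const 2).aemeasurable]
    _ ≤ ν univ * ∫⁻ _, M ∂ν := mul_le_mul_right (lintegral_mono_ae hM) _
    _ = ν univ ^ 2 * M := by rw [lintegral_const]; ring


section Averages

/-- The average `∫ ρ(y) u(x - y) dy`. -/
def average (ρ : E3 → ℝ) (u : E3 → E3) (x : E3) : E3 := ∫ y, ρ y • u (x - y)

theorem average_eq_convolution (ρ : E3 → ℝ) (u : E3 → E3) :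
    average ρ u = convolution ρ u (ContinuousLinearMap.lsmul ℝ ℝ) volume := rfl

theorem average_eq_swap (ρ : E3 → ℝ) (u : E3 → E3) (x : E3) :
    average ρ u x = ∫ y, ρ (x - y) • u y := by
  rw [average_eq_convolution, convolution_eq_swap]
  rfl

/-- Young's inequality for `L¹ * L²`: Minkowski's inequality for the measure `|ρ(y)| dy`, with
translation invariance. -/
theorem lintegral_average_sq_le {ρ : E3 → ℝ} (hρ : Measurable ρ) {u : E3 → E3}
    (hu : Measurable u) :
    ∫⁻ x, ‖average ρ u x‖ₑ ^ 2 ≤ (∫⁻ y, ‖ρ y‖ₑ) ^ 2 * ∫⁻ x, ‖u x‖ₑ ^ 2 := by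
  let ν : Measure E3 := volume.withDensity fun y => ‖ρ y‖ₑ
  have h1 : ∀ x, ‖average ρ u x‖ₑ ≤ ∫⁻ y, ‖u (x - y)‖ₑ ∂ν := by
    intro x
    refine (enorm_integral_le_lintegral_enorm _).trans_eq ?_
    have hm : Measurable fun y => ‖u (x - y)‖ₑ :=
      (hu.comp (measurable_const.sub measurable_id)).enorm
    rw [lintegral_withDensity_eq_lintegral_mul _ hρ.enorm hm]
    simp [enorm_smul]
  have h2 : ν univ = ∫⁻ y, ‖ρ y‖ₑ := by
    rw [withDensity_apply _ MeasurableSet.univ, Measure.restrict_univ]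
  refine (lintegral_mono fun x => pow_le_pow_left₀ zero_le (h1 x) 2).trans ?_
  rw [← h2]
  refine lintegral_lintegral_sq_le volume ν (k := fun x y => ‖u (x - y)‖ₑ)
    (hu.comp (measurable_fst.sub measurable_snd)).enorm
    (Eventually.of_forall fun y => ?_)
  rw [lintegral_sub_right_eq_self fun x => ‖u x‖ₑ ^ 2]

/-- The increment is the integral of the derivative along the segment from `x - y` to `x`;
Minkowski's inequality in the parameter of the segment and translation invariance conclude. -/
theorem lintegral_sub_translate_sq_le (u : Test) (y : E3) :
    ∫⁻ x, ‖u x - u (x - y)‖ₑ ^ 2 ≤ ENNReal.ofReal (‖y‖ ^ 2 * ∑ i, ‖toL2 (pdT i u)‖ ^ 2) := by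
  let ν : Measure ℝ := volume.restrict (Ioc 0 1)
  have hc : Continuous fun p : E3 × ℝ => fderiv ℝ u (p.1 - p.2 • y) y :=
    ((continuous_fderiv_test u).comp (by fun_prop)).clm_apply continuous_const
  have h1 : ∀ x, ‖u x - u (x - y)‖ₑ ≤ ∫⁻ s, ‖fderiv ℝ u (x - s • y) y‖ₑ ∂ν := by
    intro x
    have hd : ∀ s ∈ uIcc (0 : ℝ) 1, HasDerivAt (fun s : ℝ => u (x - s • y))
        (-(fderiv ℝ u (x - s • y) y)) s := by
      intro s _
      have h2 : HasDerivAt (fun s : ℝ => x - s • y) (-y) s := by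
        simpa using ((hasDerivAt_id s).smul_const y).const_sub x
      have h3 := (u.contDiff.differentiable (by simp) (x - s • y)).hasFDerivAt.comp_hasDerivAt s h2
      rw [map_neg] at h3
      exact h3
    have hcx : Continuous fun s : ℝ => fderiv ℝ u (x - s • y) y :=
      hc.comp (Continuous.prodMk_right x)
    have h4 := intervalIntegral.integral_eq_sub_of_hasDerivAt hd
      (hcx.neg.intervalIntegrable 0 1)
    have h5 : u x - u (x - y) = ∫ s, fderiv ℝ u (x - s • y) y ∂ν := by
      rw [intervalIntegral.integral_neg, intervalIntegral.integral_of_le zero_le_one] at h4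
      simp only [one_smul, zero_smul, sub_zero] at h4
      rw [← neg_sub, ← h4, neg_neg]
    rw [h5]
    exact enorm_integral_le_lintegral_enorm _
  refine (lintegral_mono fun x => pow_le_pow_left₀ zero_le (h1 x) 2).trans ?_
  have h6 : ∀ᵐ s ∂ν, ∫⁻ x, ‖fderiv ℝ u (x - s • y) y‖ₑ ^ 2 ≤
      ENNReal.ofReal (‖y‖ ^ 2 * ∑ i, ‖toL2 (pdT i u)‖ ^ 2) := by
    refine Eventually.of_forall fun s => ?_
    rw [lintegral_sub_right_eq_self fun x => ‖fderiv ℝ u x y‖ₑ ^ 2]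
    have hint : ∀ i, Integrable fun x => ‖pd i u x‖ ^ 2 := fun i =>
      ((pdT i u).memLp 2).integrable_norm_pow (by norm_num)
    have h7 : ‖y‖ ^ 2 * ∑ i, ‖toL2 (pdT i u)‖ ^ 2 =
        ∫ x, ‖y‖ ^ 2 * ∑ i, ‖pd i u x‖ ^ 2 := by
      rw [integral_const_mul, integral_finsetSum _ fun i _ => hint i]
      simp only [norm_toL2_sq, pdT_apply]
    rw [h7, ofReal_integral_eq_lintegral_ofReal
      ((integrable_finsetSum _ fun i _ => hint i).const_mul _)
      (Eventually.of_forall fun x => by positivity)]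
    refine lintegral_mono fun x => ?_
    rw [← ofReal_norm, ← ENNReal.ofReal_pow (norm_nonneg _)]
    exact ENNReal.ofReal_le_ofReal (norm_fderiv_apply_sq_le u x y)
  refine (lintegral_lintegral_sq_le volume ν (k := fun x s => ‖fderiv ℝ u (x - s • y) y‖ₑ)
    hc.measurable.enorm h6).trans_eq ?_
  simp [ν]

/-- The average differs from `u` by a mean of increments over the support of a probability density.
The rate `δ‖∇u‖` is what makes the gradient bound a compactness statement. -/
theorem lintegral_sub_average_sq_le {δ : ℝ} (φ : ContDiffBump (0 : E3)) (hφ : φ.rOut ≤ δ)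
    (u : Test) :
    ∫⁻ x, ‖u x - average (φ.normed volume) u x‖ₑ ^ 2 ≤
      ENNReal.ofReal (δ ^ 2 * ∑ i, ‖toL2 (pdT i u)‖ ^ 2) := by
  let ρ := φ.normed (volume : Measure E3)
  have hρ : Continuous ρ := φ.continuous_normed
  let ν : Measure E3 := volume.withDensity fun y => ‖ρ y‖ₑ
  have hint : ∀ f : E3 → E3, Continuous f → Integrable fun y => ρ y • f y := fun f hf =>
    (hρ.smul hf).integrable_of_hasCompactSupport φ.hasCompactSupport_normed.smul_right
  have h1 : ∀ x, ‖u x - average ρ u x‖ₑ ≤ ∫⁻ y, ‖u x - u (x - y)‖ₑ ∂ν := by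
    intro x
    have h2 : u x - average ρ u x = ∫ y, ρ y • (u x - u (x - y)) := by
      have h6 : Integrable fun y => ρ y • u (x - y) :=
        hint _ (u.continuous.comp (continuous_const.sub continuous_id))
      simp only [smul_sub]
      rw [integral_sub (hint _ continuous_const) h6, integral_smul_const, φ.integral_normed, one_smul]
      rfl
    rw [h2]
    refine (enorm_integral_le_lintegral_enorm _).trans_eq ?_
    have hm : Measurable fun y => ‖u x - u (x - y)‖ₑ :=
      (continuous_const.sub (u.continuous.comp
        (continuous_const.sub continuous_id))).measurable.enorm
    rw [lintegral_withDensity_eq_lintegral_mul _ hρ.measurable.enorm hm]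
    simp [enorm_smul]
  have h3 : ν univ = 1 := by
    rw [withDensity_apply _ MeasurableSet.univ, Measure.restrict_univ]
    have h4 : ∀ y, ‖ρ y‖ₑ = ENNReal.ofReal (ρ y) := fun y => by
      rw [Real.enorm_eq_ofReal (φ.nonneg_normed y)]
    simp only [h4]
    rw [← ofReal_integral_eq_lintegral_ofReal
      (hρ.integrable_of_hasCompactSupport φ.hasCompactSupport_normed)
      (Eventually.of_forall φ.nonneg_normed), φ.integral_normed, ENNReal.ofReal_one]
  refine (lintegral_mono fun x => pow_le_pow_left₀ zero_le (h1 x) 2).trans ?_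
  have hc : Continuous fun p : E3 × E3 => u p.1 - u (p.1 - p.2) :=
    (u.continuous.comp continuous_fst).sub (u.continuous.comp (continuous_fst.sub continuous_snd))
  refine (lintegral_lintegral_sq_le volume ν (k := fun x y => ‖u x - u (x - y)‖ₑ)
    hc.measurable.enorm (M := ENNReal.ofReal (δ ^ 2 * ∑ i, ‖toL2 (pdT i u)‖ ^ 2)) ?_).trans_eq ?_
  -- Only shifts in the support of the density count, and these have length at most `δ`.
  · rw [ae_withDensity_iff hρ.measurable.enorm]
    refine Eventually.of_forall fun y hy => (lintegral_sub_translate_sq_le u y).trans ?_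
    have h5 : y ∈ Metric.ball 0 φ.rOut := by
      rw [← φ.support_normed_eq (μ := volume)]
      intro h6
      exact hy (by simp [ρ, h6])
    refine ENNReal.ofReal_le_ofReal ?_
    gcongr
    exact (mem_ball_zero_iff.1 h5).le.trans hφ
  · rw [h3]
    simp

theorem pd_average (i : Fin 3) {ρ : E3 → ℝ} (hρ : ContDiff ℝ ∞ ρ) (hs : HasCompactSupport ρ)
    {u : E3 → E3} (hu : LocallyIntegrable u) : pd i (average ρ u) = average (pd i ρ) u := by
  funext x
  have h1 := hs.hasFDerivAt_convolution_left (ContinuousLinearMap.lsmul ℝ ℝ) (hρ.of_le (by simp))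
    hu x
  rw [average_eq_convolution, pd, h1.fderiv]
  have h2 : ConvolutionExistsAt (fderiv ℝ ρ) u x
      ((ContinuousLinearMap.lsmul ℝ ℝ : ℝ →L[ℝ] E3 →L[ℝ] E3).precompL E3) volume :=
    (hs.fderiv ℝ).convolutionExists_left _ (hρ.continuous_fderiv (by simp)) hu x
  rw [convolution_def, ContinuousLinearMap.integral_apply h2.integrable]
  rfl

theorem contDiff_average {ρ : E3 → ℝ} (hρ : ContDiff ℝ ∞ ρ) (hs : HasCompactSupport ρ)
    {u : E3 → E3} (hu : LocallyIntegrable u) : ContDiff ℝ ∞ (average ρ u) :=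
  hs.contDiff_convolution_left (ContinuousLinearMap.lsmul ℝ ℝ) hρ hu

end Averages

/-! ### A Liouville theorem for harmonic fields in `L²`. -/

section Liouville

theorem pd_norm_sq (i : Fin 3) {f : E3 → E3} (hf : ContDiff ℝ ∞ f) (x : E3) :
    pd i (fun y => ‖f y‖ ^ 2) x = 2 * inner ℝ (f x) (pd i f x) := by
  have h1 := ((hf.differentiable (by simp) x).hasFDerivAt.norm_sq).fderiv
  simp only [pd]
  rw [h1]
  simp

theorem pd_fun_smul (i : Fin 3) {η : E3 → ℝ} {f : E3 → E3} (hη : ContDiff ℝ ∞ η)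
    (hf : ContDiff ℝ ∞ f) (x : E3) :
    pd i (fun y => η y • f y) x = η x • pd i f x + pd i η x • f x := by
  simp only [pd]
  rw [fderiv_fun_smul (hη.differentiable (by simp) x) (hf.differentiable (by simp) x)]
  simp

/-- Local energy identity for harmonic vector fields. -/
theorem integral_cutoff_mul_gradient_sq {h : E3 → E3} (hh : ContDiff ℝ ∞ h)
    (hharm : ∀ x, ∑ i, pd i (pd i h) x = 0) {η : E3 → ℝ} (hη : ContDiff ℝ ∞ η)
    (hs : HasCompactSupport η) :
    ∫ x, η x * ∑ i, ‖pd i h x‖ ^ 2 = 1 / 2 * ∫ x, (∑ i, pd i (pd i η) x) * ‖h x‖ ^ 2 := by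
  let q : E3 → ℝ := fun y => ‖h y‖ ^ 2
  have hq : ContDiff ℝ ∞ q := hh.norm_sq ℝ
  have hp := fun i => contDiff_pd i hh
  have hpη := fun i => contDiff_pd i hη
  have hsη : ∀ i, HasCompactSupport (pd i η) := fun i => hasCompactSupport_pd i hs
  have int1 : ∀ {f g : E3 → ℝ}, Continuous f → Continuous g → HasCompactSupport f →
      Integrable fun x => f x * g x := fun hf hg hfs =>
    (hf.mul hg).integrable_of_hasCompactSupport hfs.mul_right
  have e1 : ∀ i, ∫ x, η x * ‖pd i h x‖ ^ 2 =
      -(∫ x, η x * inner ℝ (pd i (pd i h) x) (h x)) + 1 / 2 * ∫ x, pd i (pd i η) x * q x := by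
    intro i
    have h1 := integral_inner_pd i (f := fun y => η y • pd i h y) (hη.smul (hp i)) hh
      (Or.inl hs.smul_right)
    have h2 : ∀ x, inner ℝ (η x • pd i h x) (pd i h x) = η x * ‖pd i h x‖ ^ 2 := fun x => by
      rw [inner_smul_left, real_inner_self_eq_norm_sq]
      rfl
    have h3 : ∀ x, inner ℝ (pd i (fun y => η y • pd i h y) x) (h x) =
        η x * inner ℝ (pd i (pd i h) x) (h x) + 1 / 2 * (pd i η x * pd i q x) := by
      intro x
      rw [pd_fun_smul i hη (hp i), pd_norm_sq i hh, inner_add_left, inner_smul_left,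
        inner_smul_left, real_inner_comm (h x) (pd i h x)]
      simp only [conj_trivial]
      ring
    simp only [h2, h3] at h1
    have h4 := integral_mul_pd i (hpη i) hq (Or.inl (hsη i))
    rw [h1, integral_add, integral_const_mul, h4]
    · ring
    · exact int1 hη.continuous ((contDiff_pd i (hp i)).continuous.inner hh.continuous) hs
    · exact (int1 (hpη i).continuous (contDiff_pd i hq).continuous (hsη i)).const_mul _
  have e2 : ∫ x, η x * ∑ i, ‖pd i h x‖ ^ 2 = ∑ i, ∫ x, η x * ‖pd i h x‖ ^ 2 := by
    simp only [Finset.mul_sum]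
    exact integral_finsetSum _ fun i _ =>
      int1 hη.continuous ((hp i).continuous.norm.pow 2) hs
  have e3 : ∫ x, (∑ i, pd i (pd i η) x) * ‖h x‖ ^ 2 = ∑ i, ∫ x, pd i (pd i η) x * q x := by
    simp only [Finset.sum_mul]
    exact integral_finsetSum _ fun i _ =>
      int1 (contDiff_pd i (hpη i)).continuous hq.continuous (hasCompactSupport_pd i (hsη i))
  have e4 : ∑ i, ∫ x, η x * inner ℝ (pd i (pd i h) x) (h x) = 0 := by
    rw [← integral_finsetSum _ fun i _ => by
      exact int1 hη.continuous ((contDiff_pd i (hp i)).continuous.inner hh.continuous) hs]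
    have : ∀ x, ∑ i, η x * inner ℝ (pd i (pd i h) x) (h x) = 0 := by
      intro x
      rw [← Finset.mul_sum, ← sum_inner, hharm, inner_zero_left, mul_zero]
    simp [this]
  rw [e2, e3]
  simp only [e1]
  rw [Finset.sum_add_distrib, Finset.sum_neg_distrib, e4, Finset.mul_sum]
  ring

theorem pd_comp_smul {F : Type*} [NormedAddCommGroup F] [NormedSpace ℝ F] (i : Fin 3) (r : ℝ)
    {f : E3 → F} (hf : ContDiff ℝ ∞ f) (x : E3) :
    pd i (fun y => f (r • y)) x = r • pd i f (r • x) := by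
  have h1 : HasFDerivAt (fun y : E3 => r • y) (r • ContinuousLinearMap.id ℝ E3) x :=
    (hasFDerivAt_id x).const_smul r
  have h2 := ((hf.differentiable (by simp) (r • x)).hasFDerivAt.comp x h1).fderiv
  simp only [pd]
  rw [show (fun y => f (r • y)) = f ∘ fun y => r • y from rfl, h2]
  simp

/-- A harmonic vector field in `L²` vanishes. -/
theorem eq_zero_of_harmonic_of_memLp {h : E3 → E3} (hh : ContDiff ℝ ∞ h)
    (hharm : ∀ x, ∑ i, pd i (pd i h) x = 0) (hL : MemLp h 2 volume) : h = 0 := by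
  let χ : ContDiffBump (0 : E3) := ⟨1, 2, zero_lt_one, one_lt_two⟩
  let S : E3 → ℝ := fun x => ∑ i, ‖pd i h x‖ ^ 2
  have hS : Continuous S := continuous_finsetSum _ fun i _ => (contDiff_pd i hh).continuous.norm.pow 2
  have hS0 : ∀ x, 0 ≤ S x := fun x => by positivity
  have hχ : ContDiff ℝ ∞ χ := χ.contDiff
  have hlap : Continuous fun x => ∑ i, pd i (pd i χ) x :=
    continuous_finsetSum _ fun i _ => (contDiff_pd i (contDiff_pd i hχ)).continuous
  have hlaps : HasCompactSupport fun x => ∑ i, pd i (pd i χ) x := by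
    refine (χ.hasCompactSupport.fderiv ℝ |>.fderiv ℝ).mono fun x hx hfx => hx ?_
    refine Finset.sum_eq_zero fun i _ => ?_
    exact (pd_clm_comp i (ContinuousLinearMap.apply ℝ ℝ (EuclideanSpace.single i (1 : ℝ)))
      (hχ.fderiv_right (m := ∞) (by simp)) x).trans (by simp [pd, hfx])
  obtain ⟨M, hM⟩ := hlap.bounded_above_of_compact_support hlaps
  have hq : Integrable fun x => ‖h x‖ ^ 2 := hL.integrable_norm_pow (by norm_num)
  let Q := ∫ x, ‖h x‖ ^ 2
  let η : ℝ → E3 → ℝ := fun R x => χ (R⁻¹ • x)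
  have hη : ∀ R, ContDiff ℝ ∞ (η R) := fun R => hχ.comp (contDiff_const_smul _)
  have hηs : ∀ R > 0, HasCompactSupport (η R) := fun R hR =>
    χ.hasCompactSupport.comp_smul (inv_ne_zero hR.ne')
  have hint : ∀ R > 0, Integrable fun x => η R x * S x := fun R hR =>
    ((hη R).continuous.mul hS).integrable_of_hasCompactSupport (hηs R hR).mul_right
  -- Rescaling the cut-off to radius `R` gains two powers of `R⁻¹` on its Laplacian, while `h`
  -- contributes only its finite `L²` norm.
  have hb : ∀ R > 0, ∫ x, η R x * S x ≤ R⁻¹ ^ 2 * (M * Q) := by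
    intro R hR
    have h1 : ∀ x, ∑ i, pd i (pd i (η R)) x = R⁻¹ ^ 2 * ∑ i, pd i (pd i χ) (R⁻¹ • x) := by
      intro x
      rw [Finset.mul_sum]
      refine Finset.sum_congr rfl fun i _ => ?_
      have h2 : pd i (η R) = R⁻¹ • fun y => pd i χ (R⁻¹ • y) :=
        funext fun y => pd_comp_smul i _ hχ y
      have h3 : ContDiff ℝ ∞ fun y => pd i χ (R⁻¹ • y) :=
        (contDiff_pd i hχ).comp (contDiff_const_smul _)
      rw [h2, pd_smul i _ h3, Pi.smul_apply, pd_comp_smul i _ (contDiff_pd i hχ)]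
      simp only [smul_eq_mul]
      ring
    rw [integral_cutoff_mul_gradient_sq hh hharm (hη R) (hηs R hR)]
    have h4 : ∫ x, (∑ i, pd i (pd i (η R)) x) * ‖h x‖ ^ 2 ≤ ∫ x, R⁻¹ ^ 2 * M * ‖h x‖ ^ 2 := by
      refine integral_mono ?_ (hq.const_mul _) fun x => ?_
      · refine hq.bdd_mul (c := R⁻¹ ^ 2 * M) ?_ (Eventually.of_forall fun x => ?_)
        · simp only [h1]
          exact ((hlap.comp (continuous_const_smul _)).const_mul _).aestronglyMeasurable
        · rw [h1, norm_mul, Real.norm_of_nonneg (by positivity)]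
          gcongr
          exact hM _
      · simp only [h1]
        gcongr
        exact (le_abs_self _).trans (hM _)
    rw [integral_const_mul] at h4
    have h5 : 0 ≤ R⁻¹ ^ 2 * (M * Q) := by
      have : 0 ≤ M := (norm_nonneg _).trans (hM 0)
      have : 0 ≤ Q := integral_nonneg fun x => by positivity
      positivity
    change _ ≤ R⁻¹ ^ 2 * M * Q at h4
    linarith
  -- The bump equals `1` up to radius `1` and vanishes beyond `2`, so the cut-off at scale `R' ≥ 2R`
  -- is `1` wherever that at scale `R` is nonzero. Hence the integral at a fixed scale is bounded by
  -- a quantity that tends to zero.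
  have hmono : ∀ R > 0, ∀ R' ≥ 2 * R, ∫ x, η R x * S x ≤ ∫ x, η R' x * S x := by
    intro R hR R' hR'
    refine integral_mono (hint R hR) (hint R' (by linarith)) fun x => ?_
    refine mul_le_mul_of_nonneg_right ?_ (hS0 x)
    have hR'0 : 0 < R' := by linarith
    by_cases hx : ‖x‖ < 2 * R
    · have h1 : η R' x = 1 := by
        refine χ.one_of_mem_closedBall ?_
        rw [mem_closedBall_zero_iff, norm_smul, norm_inv, Real.norm_of_nonneg hR'0.le]
        change R'⁻¹ * ‖x‖ ≤ 1
        rw [inv_mul_le_iff₀ hR'0]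
        linarith
      rw [h1]
      exact χ.le_one
    · have h1 : η R x = 0 := by
        refine χ.zero_of_le_dist ?_
        rw [dist_zero_right, norm_smul, norm_inv, Real.norm_of_nonneg hR.le]
        change 2 ≤ R⁻¹ * ‖x‖
        rw [le_inv_mul_iff₀ hR]
        linarith
      rw [h1]
      exact χ.nonneg
  have hzero : ∀ R > 0, ∫ x, η R x * S x = 0 := by
    intro R hR
    refine le_antisymm ?_ (integral_nonneg fun x => mul_nonneg χ.nonneg (hS0 x))
    have h1 : Tendsto (fun R' : ℝ => R'⁻¹ ^ 2 * (M * Q)) atTop (𝓝 0) := by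
      simpa using (tendsto_inv_atTop_zero.pow 2).mul_const (M * Q)
    refine ge_of_tendsto h1 ?_
    filter_upwards [eventually_ge_atTop (2 * R)] with R' hR'
    exact (hmono R hR R' hR').trans (hb R' (by linarith))
  have hS1 : ∀ x, S x = 0 := by
    intro x
    have hR : 0 < ‖x‖ + 1 := by positivity
    by_contra hne
    have h1 : η (‖x‖ + 1) x = 1 := by
      refine χ.one_of_mem_closedBall ?_
      rw [mem_closedBall_zero_iff, norm_smul, norm_inv, Real.norm_of_nonneg hR.le]
      change (‖x‖ + 1)⁻¹ * ‖x‖ ≤ 1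
      rw [inv_mul_le_iff₀ hR]
      linarith
    have h2 := Continuous.integral_pos_of_hasCompactSupport_nonneg_nonzero
      (f := fun x' => η (‖x‖ + 1) x' * S x') ((hη (‖x‖ + 1)).continuous.mul hS)
      (hηs _ hR).mul_right (fun x => mul_nonneg χ.nonneg (hS0 x)) (x := x) (μ := volume)
      (by rwa [h1, one_mul])
    exact h2.ne' (hzero _ hR)
  have hfd : ∀ x, fderiv ℝ h x = 0 := by
    intro x
    ext1 v
    have h1 := norm_fderiv_apply_sq_le h x v
    have h2 : ∑ i, ‖pd i h x‖ ^ 2 = 0 := hS1 x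
    rw [h2, mul_zero] at h1
    simpa using le_antisymm h1 (by positivity)
  have hconst : ∀ x, h x = h 0 := fun x =>
    is_const_of_fderiv_eq_zero (hh.differentiable (by simp)) hfd x 0
  -- The gradient vanishes, and the only constant that is square integrable over a space of infinite
  -- volume is zero.
  have h6 : MemLp (fun _ : E3 => h 0) 2 volume := by
    convert hL using 1
    exact funext fun x => (hconst x).symm
  rw [memLp_const_iff (by norm_num) (by norm_num)] at h6
  rcases h6 with h6 | h6
  · exact funext fun x => (hconst x).trans h6
  · exact absurd h6 (by simp)

theorem enorm_lp_two_sq {G : Type*} [NormedAddCommGroup G] (u : Lp G 2 (volume : Measure E3)) :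
    ∫⁻ x, ‖u x‖ₑ ^ 2 = ‖u‖ₑ ^ 2 := by
  rw [Lp.enorm_def, eLpNorm_eq_lintegral_rpow_enorm_toReal (by norm_num) (by norm_num)]
  rw [← ENNReal.rpow_natCast _ 2, ← ENNReal.rpow_mul]
  norm_num

theorem memLp_average {ρ : E3 → ℝ} (hρ : ContDiff ℝ ∞ ρ) (hs : HasCompactSupport ρ) (u : L2) :
    MemLp (average ρ u) 2 volume := by
  have hu : LocallyIntegrable u := (Lp.memLp u).locallyIntegrable (by norm_num)
  refine ⟨(contDiff_average hρ hs hu).continuous.aestronglyMeasurable, ?_⟩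
  rw [eLpNorm_lt_top_iff_lintegral_rpow_enorm_lt_top (by norm_num) (by norm_num)]
  have h1 := lintegral_average_sq_le hρ.continuous.measurable (Lp.stronglyMeasurable u).measurable
  rw [enorm_lp_two_sq] at h1
  simp only [ENNReal.toReal_ofNat, ENNReal.rpow_ofNat]
  refine h1.trans_lt (ENNReal.mul_lt_top (ENNReal.pow_lt_top ?_) (by simp))
  exact (hρ.continuous.integrable_of_hasCompactSupport hs).hasFiniteIntegral

/-- Weyl's lemma is avoided by mollifying: the average of `u` is smooth, harmonic and in `L²`, hence
zero. With the reflected kernel `g(-y)`, its value at the origin is `∫ g u`, and `g` is arbitrary.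
-/
theorem eq_zero_of_inner_lapT_eq_zero {u : L2} (hu : ∀ w, inner ℝ u (toL2 (lapT w)) = 0) :
    u = 0 := by
  have hloc : LocallyIntegrable u := (Lp.memLp u).locallyIntegrable (by norm_num)
  refine Lp.eq_zero_iff_ae_eq_zero.2
    (ae_eq_zero_of_integral_contDiff_smul_eq_zero hloc fun g hg hgs => ?_)
  let ρ : E3 → ℝ := fun y => g (-y)
  have hρ : ContDiff ℝ ∞ ρ := hg.comp contDiff_neg
  have hρs : HasCompactSupport ρ := hgs.comp_homeomorph (Homeomorph.neg E3)
  have h1 : ∀ x, ∑ i, pd i (pd i (average ρ u)) x = 0 := by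
    intro x
    have h2 : ∀ i, pd i (pd i (average ρ u)) = average (pd i (pd i ρ)) u := fun i => by
      rw [pd_average i hρ hρs hloc,
        pd_average i (contDiff_pd i hρ) (hasCompactSupport_pd i hρs) hloc]
    simp only [h2, average_eq_swap]
    have hint : ∀ i, Integrable fun y => pd i (pd i ρ) (x - y) • u y := fun i =>
      hloc.integrable_smul_left_of_hasCompactSupport
        ((contDiff_pd i (contDiff_pd i hρ)).continuous.comp (continuous_const.sub continuous_id))
        ((hasCompactSupport_pd i (hasCompactSupport_pd i hρs)).comp_homeomorph
          (Homeomorph.subLeft x))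
    rw [← integral_finsetSum _ fun i _ => hint i]
    refine ext_inner_right ℝ fun a => ?_
    -- Since `ρ (x - y) = g (y - x)`, the Laplacian of the average at `x` is the pairing of `u` with
    -- the Laplacian of `k`.
    let k : E3 → ℝ := fun y => g (y - x)
    have hk : ContDiff ℝ ∞ k := hg.comp (contDiff_id.sub contDiff_const)
    have hks : HasCompactSupport k := hgs.comp_homeomorph (Homeomorph.subRight x)
    have h3 := hu (Test.ofScalar k hk hks a)
    have hshift : ∀ (i : Fin 3) {f : E3 → ℝ}, ContDiff ℝ ∞ f → ∀ y,
        pd i (fun y => f (y - x)) y = pd i f (y - x) := by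
      intro i f hf y
      have h4 := ((hf.differentiable (by simp) (y - x)).hasFDerivAt.comp y
        ((hasFDerivAt_id y).sub_const x)).fderiv
      simp only [pd]
      rw [show (fun y => f (y - x)) = f ∘ fun y => id y - x from rfl, h4]
      rfl
    have hneg : ∀ (i : Fin 3) {f : E3 → ℝ}, ContDiff ℝ ∞ f → ∀ y,
        pd i (fun y => f (-y)) y = - pd i f (-y) := by
      intro i f hf y
      simpa using pd_comp_smul i (-1) hf y
    have h4 : ∀ i y, pd i (pd i k) y = pd i (pd i g) (y - x) := by
      intro i y
      have : pd i k = fun y => pd i g (y - x) := funext fun y => hshift i hg y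
      rw [this, hshift i (contDiff_pd i hg)]
    have h5 : ∀ i y, pd i (pd i ρ) y = pd i (pd i g) (-y) := by
      intro i y
      have h6 : pd i ρ = (-1 : ℝ) • fun y => pd i g (-y) := funext fun y => by
        rw [hneg i hg y]
        simp
      have h7 : ContDiff ℝ ∞ fun y => pd i g (-y) := (contDiff_pd i hg).comp contDiff_neg
      rw [h6, pd_smul i _ h7, Pi.smul_apply, hneg i (contDiff_pd i hg)]
      simp
    rw [inner_toL2] at h3
    rw [inner_zero_left, ← h3, real_inner_comm, ← integral_inner (integrable_finsetSum _ fun i _ => hint i)]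
    refine integral_congr_ae (Eventually.of_forall fun y => ?_)
    have h6 : lapT (Test.ofScalar k hk hks a) y = (∑ i, pd i (pd i ρ) (x - y)) • a := by
      rw [lapT_apply, laplacian_eq_sum_pd (Test.contDiff _), Finset.sum_smul]
      refine Finset.sum_congr rfl fun i _ => ?_
      let L : ℝ →L[ℝ] E3 := (ContinuousLinearMap.id ℝ ℝ).smulRight a
      have h7 : ∀ (f : E3 → ℝ), ContDiff ℝ ∞ f → pd i (fun y => f y • a) = fun y => pd i f y • a :=
        fun f hf => funext fun y => pd_clm_comp i L hf y
      change pd i (pd i fun y => k y • a) y = _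
      rw [h7 k hk, h7 _ (contDiff_pd i hk)]
      beta_reduce
      rw [h4, h5, neg_sub]
    change inner ℝ a (∑ i, pd i (pd i ρ) (x - y) • u y) = inner ℝ (u y) _
    rw [h6, ← Finset.sum_smul, inner_smul_right, inner_smul_right, real_inner_comm]
  have h8 := eq_zero_of_harmonic_of_memLp (contDiff_average hρ hρs hloc) h1
    (memLp_average hρ hρs u)
  have h9 := congrFun h8 0
  rw [average_eq_swap] at h9
  simpa [ρ] using h9

end Liouville

/-! ### Density of solenoidal test fields. -/

section Solenoidal

/-- The gradient of a scalar test function. -/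
def gradT (ψ : E3 → ℝ) (hψ : ContDiff ℝ ∞ ψ) (hs : HasCompactSupport ψ) : Test :=
  ⟨gradient ψ, contDiff_gradient hψ, hasCompactSupport_gradient hs⟩

theorem isDivFree_iff (u : L2) :
    IsDivFree u ↔ ∀ ψ hψ hs, inner ℝ u (toL2 (gradT ψ hψ hs)) = 0 := by
  simp only [inner_toL2]
  rfl

/-- Divergence free test fields. -/
def solenoidal : Submodule ℝ Test where
  carrier := {w | ∀ x, divergence w x = 0}
  add_mem' {v w} hv hw x := by
    change divergence (v.1 + w.1) x = 0
    simp only [divergence, pd_add _ v.contDiff w.contDiff, Pi.add_apply, PiLp.add_apply,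
      Finset.sum_add_distrib]
    exact (congrArg₂ _ (hv x) (hw x)).trans (add_zero _)
  zero_mem' x := by
    change divergence 0 x = 0
    simp [divergence, pd]
  smul_mem' c w hw x := by
    change divergence (c • w.1) x = 0
    simp only [divergence, pd_smul _ c w.contDiff, Pi.smul_apply, PiLp.smul_apply, smul_eq_mul,
      ← Finset.mul_sum]
    exact (congrArg _ (hw x)).trans (mul_zero _)

theorem inner_gradT_of_mem_solenoidal {w : Test} (hw : w ∈ solenoidal) (ψ hψ hs) :
    inner ℝ (toL2 w) (toL2 (gradT ψ hψ hs)) = 0 := by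
  have h1 : ∀ x, inner ℝ (w x) (gradT ψ hψ hs x) = ∑ i, w x i * pd i ψ x := by
    intro x
    rw [PiLp.inner_apply]
    refine Finset.sum_congr rfl fun i _ => ?_
    change inner ℝ (w x i) (gradient ψ x i) = _
    rw [gradient_apply]
    simp [mul_comm]
  have hws : ∀ i, HasCompactSupport fun x => w x i := fun i =>
    w.hasCompactSupport.mono fun x hx hfx => hx (by simp [hfx])
  have hwc := fun i => contDiff_coord w.contDiff i
  rw [inner_toL2_toL2]
  simp only [h1]
  have hi1 : ∀ i, Integrable fun x => w x i * pd i ψ x := fun i => ((hwc i).continuous.mul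
    (contDiff_pd i hψ).continuous).integrable_of_hasCompactSupport (hws i).mul_right
  have hi2 : ∀ i, Integrable fun x => pd i w x i * ψ x := fun i =>
    ((contDiff_coord (contDiff_pd i w.contDiff) i).continuous.mul
      hψ.continuous).integrable_of_hasCompactSupport hs.mul_left
  rw [integral_finsetSum _ fun i _ => hi1 i]
  simp only [integral_mul_pd _ (hwc _) hψ (Or.inr hs), pd_coord _ _ w.contDiff,
    Finset.sum_neg_distrib]
  rw [← integral_finsetSum _ fun i _ => hi2 i]
  have h2 : ∀ x, ∑ i, pd i w x i * ψ x = 0 := by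
    intro x
    rw [← Finset.sum_mul]
    exact (congrArg (· * ψ x) (hw x)).trans (zero_mul _)
  simp [h2]

theorem curlT_mem_solenoidal (w : Test) : curlT w ∈ solenoidal := fun x =>
  divergence_curl w.contDiff x

/-- Divergence free `L²` fields are limits of divergence free test fields. -/
theorem mem_closure_solenoidal {u : L2} (hu : IsDivFree u) :
    u ∈ (solenoidal.map toL2).topologicalClosure := by
  let K := (solenoidal.map toL2).topologicalClosure
  have : CompleteSpace K := (solenoidal.map toL2).isClosed_topologicalClosure.completeSpace_coe
  -- The part of `u` orthogonal to all solenoidal test fields. It is orthogonal to gradients,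
  -- because `u` and `K` both are, and to curls, because these lie in `K`; by `Δ = grad div - curl
  -- curl` it is orthogonal to every Laplacian.
  let v := u - K.starProjection u
  have hvK : ∀ y ∈ K, inner ℝ v y = 0 := fun y hy =>
    Submodule.inner_left_of_mem_orthogonal hy (K.sub_starProjection_mem_orthogonal u)
  have hvd : ∀ ψ hψ hs, inner ℝ v (toL2 (gradT ψ hψ hs)) = 0 := by
    intro ψ hψ hs
    have h1 : ∀ y ∈ K, inner ℝ y (toL2 (gradT ψ hψ hs)) = 0 := by
      intro y hy
      have h2 : IsClosed {y : L2 | inner ℝ y (toL2 (gradT ψ hψ hs)) = 0} :=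
        isClosed_eq (by fun_prop) continuous_const
      refine h2.closure_subset_iff.2 ?_ hy
      rintro _ ⟨w, hw, rfl⟩
      exact inner_gradT_of_mem_solenoidal hw ψ hψ hs
    rw [inner_sub_left, (isDivFree_iff u).1 hu, h1 _ (K.starProjection_apply_mem u), sub_zero]
  have hv0 : v = 0 := by
    refine eq_zero_of_inner_lapT_eq_zero fun w => ?_
    have h3 : lapT w = gradT (divergence w) (contDiff_divergence w.contDiff)
        (hasCompactSupport_divergence w.hasCompactSupport) - curlT (curlT w) := by
      refine Subtype.ext (funext fun x => ?_)
      rw [lapT_apply, laplacian_eq_gradient_divergence_sub_curl_curl w.contDiff]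
      rfl
    rw [h3, map_sub, inner_sub_right, hvd, hvK, sub_zero]
    exact Submodule.le_topologicalClosure _ ⟨_, curlT_mem_solenoidal _, rfl⟩
  rw [sub_eq_zero.1 hv0]
  exact K.starProjection_apply_mem u

end Solenoidal

/-- Separability of `L²`, on which the extraction of weak limits from bounded sequences and the
measurability of weak limits rest. -/
instance secondCountableTopology_L2 : SecondCountableTopology L2 :=
  have : Fact ((2 : ℝ≥0∞) ≠ ⊤) := ⟨by norm_num⟩
  Lp.SecondCountableTopology

/-! ### Approximation of multiplication operators by compact ones. -/

section Smoothing

theorem lp_two_norm_sq (u : L2) : ‖u‖ ^ 2 = ∫ x, ‖u x‖ ^ 2 := by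
  rw [← real_inner_self_eq_norm_sq, L2.inner_def]
  simp only [real_inner_self_eq_norm_sq]

/-- A component of the mollified field at a point is a pairing with a fixed `L²` vector. Weak
convergence therefore gives pointwise convergence of the mollifications. -/
theorem inner_average {ρ : E3 → ℝ} (hρ : ContDiff ℝ ∞ ρ) (hs : HasCompactSupport ρ) (u : L2)
    (x a : E3) : inner ℝ (average ρ u x) a = inner ℝ u (toL2 (Test.ofScalar (fun y => ρ (x - y))
      (hρ.comp (contDiff_const.sub contDiff_id)) (hs.comp_homeomorph (Homeomorph.subLeft x)) a)) := by
  have hint : Integrable fun y => ρ (x - y) • u y :=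
    ((Lp.memLp u).locallyIntegrable (by norm_num)).integrable_smul_left_of_hasCompactSupport
      (hρ.continuous.comp (continuous_const.sub continuous_id))
      (hs.comp_homeomorph (Homeomorph.subLeft x))
  rw [average_eq_swap, inner_toL2, real_inner_comm, ← integral_inner hint]
  refine integral_congr_ae (Eventually.of_forall fun y => ?_)
  simp [Test.ofScalar, inner_smul_right, real_inner_comm]

theorem norm_average_le {ρ : E3 → ℝ} (hρ : ContDiff ℝ ∞ ρ) (hs : HasCompactSupport ρ) (u : L2)
    (x : E3) : ‖average ρ u x‖ ≤ √(∫ y, ρ y ^ 2) * ‖u‖ := by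
  set a := average ρ u x with ha
  let w := Test.ofScalar (fun y => ρ (x - y))
      (hρ.comp (contDiff_const.sub contDiff_id)) (hs.comp_homeomorph (Homeomorph.subLeft x)) a
  have h1 : ‖toL2 w‖ = √(∫ y, ρ y ^ 2) * ‖a‖ := by
    have h2 : ‖toL2 w‖ ^ 2 = (∫ y, ρ y ^ 2) * ‖a‖ ^ 2 := by
      rw [norm_toL2_sq, ← integral_mul_const,
        ← integral_sub_left_eq_self (fun y => ρ y ^ 2 * ‖a‖ ^ 2) volume x]
      refine integral_congr_ae (Eventually.of_forall fun y => ?_)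
      simp [w, Test.ofScalar, norm_smul, mul_pow]
    rw [← Real.sqrt_sq (norm_nonneg (toL2 w)), h2, Real.sqrt_mul (integral_nonneg fun y => sq_nonneg _),
      Real.sqrt_sq (norm_nonneg a)]
  have h3 : ‖a‖ ^ 2 ≤ ‖u‖ * (√(∫ y, ρ y ^ 2) * ‖a‖) := by
    rw [← h1, ← real_inner_self_eq_norm_sq, ha, inner_average hρ hs]
    exact real_inner_le_norm _ _
  rcases (norm_nonneg a).eq_or_lt with h4 | h4
  · rw [← h4]
    positivity
  · nlinarith

/-- The multiplication operators by continuous compactly supported matrix fields are approximated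
by compact operators, with an error controlled by the gradient. -/
theorem exists_smoothing {σ : E3 → E3 →L[ℝ] E3} (hσ : Continuous σ) (hσs : HasCompactSupport σ)
    (hσL : MemLp σ ∞ (volume : Measure E3)) {δ : ℝ} (hδ : 0 < δ) :
    ∃ S : L2 → L2, Continuous S ∧ (∃ C, 0 ≤ C ∧ ∀ u, ‖S u‖ ≤ C * ‖u‖) ∧
      (∀ (x : ℕ → L2) (x₀ : L2) (C : ℝ), (∀ N, ‖x N‖ ≤ C) →
        (∀ y, Tendsto (fun N => inner ℝ (x N) y) atTop (𝓝 (inner ℝ x₀ y))) →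
        Tendsto (fun N => S (x N)) atTop (𝓝 (S x₀))) ∧
      ∀ u : Test, ‖actL (hσL.toLp σ) (toL2 u) - S (toL2 u)‖ ≤
        δ * √(∑ i, ‖toL2 (pdT i u)‖ ^ 2) := by
  obtain ⟨K, hK⟩ := hσ.bounded_above_of_compact_support hσs
  have hK0 : 0 ≤ K := (norm_nonneg _).trans (hK 0)
  have hr : 0 < δ / (K + 1) := by positivity
  -- Radius `δ / (K + 1)`: multiplication by `σ` enlarges the mollification error by at most `K`.
  let φ : ContDiffBump (0 : E3) := ⟨δ / (K + 1) / 2, δ / (K + 1), by positivity, by linarith⟩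
  let ρ := φ.normed (volume : Measure E3)
  have hρ : ContDiff ℝ ∞ ρ := φ.contDiff_normed
  have hρs : HasCompactSupport ρ := φ.hasCompactSupport_normed
  let c := √(∫ y, ρ y ^ 2)
  have hcont : ∀ u : L2, Continuous fun x => σ x (average ρ u x) := fun u =>
    hσ.clm_apply (contDiff_average hρ hρs
      ((Lp.memLp u).locallyIntegrable (by norm_num))).continuous
  have hmem : ∀ u : L2, MemLp (fun x => σ x (average ρ u x)) 2 volume := fun u =>
    (hcont u).memLp_of_hasCompactSupport
      (hσs.mono fun x hx hfx => hx (by simp [hfx]))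
  have hσ2 : Integrable fun x => ‖σ x‖ ^ 2 :=
    (hσ.memLp_of_hasCompactSupport hσs).integrable_norm_pow (by norm_num)
  -- Mollify, then multiply by `σ`. The mollified fields converge pointwise and are uniformly
  -- bounded at every point, so the compact support of `σ` allows dominated convergence in `L²`.
  let S : L2 → L2 := fun u => (hmem u).toLp _
  have hS : ∀ u, S u =ᵐ[volume] fun x => σ x (average ρ u x) := fun u => (hmem u).coeFn_toLp
  have hweak : ∀ (x : ℕ → L2) (x₀ : L2) (C : ℝ), (∀ N, ‖x N‖ ≤ C) →
      (∀ y, Tendsto (fun N => inner ℝ (x N) y) atTop (𝓝 (inner ℝ x₀ y))) →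
      Tendsto (fun N => S (x N)) atTop (𝓝 (S x₀)) := by
    intro x x₀ C hC hx
    have hx₀ := norm_le_of_weak hC hx
    have hC0 := (norm_nonneg _).trans hx₀
    have hpt : ∀ z, Tendsto (fun N => average ρ (x N) z) atTop (𝓝 (average ρ x₀ z)) := by
      intro z
      rw [(PiLp.homeomorph 2 fun _ : Fin 3 => ℝ).isInducing.tendsto_nhds_iff, tendsto_pi_nhds]
      intro i
      have h1 : ∀ u : L2, average ρ u z i =
          inner ℝ (average ρ u z) (EuclideanSpace.single i (1 : ℝ)) := fun u => by
        simp [EuclideanSpace.inner_single_right]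
      change Tendsto (fun N => average ρ (x N) z i) atTop (𝓝 (average ρ x₀ z i))
      simp only [h1, inner_average hρ hρs]
      exact hx _
    have h2 : Tendsto (fun N => ‖S (x N) - S x₀‖ ^ 2) atTop (𝓝 0) := by
      have h3 : ∀ N, ‖S (x N) - S x₀‖ ^ 2 =
          ∫ z, ‖σ z (average ρ (x N) z) - σ z (average ρ x₀ z)‖ ^ 2 := by
        intro N
        rw [lp_two_norm_sq]
        refine integral_congr_ae ?_
        filter_upwards [Lp.coeFn_sub (S (x N)) (S x₀), hS (x N), hS x₀] with z h4 h5 h6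
        rw [h4, Pi.sub_apply, h5, h6]
      simp only [h3]
      rw [← integral_zero E3 ℝ (μ := volume)]
      refine tendsto_integral_of_dominated_convergence
        (fun z => (2 * (c * C)) ^ 2 * ‖σ z‖ ^ 2)
        (fun N => (((hcont _).sub (hcont _)).norm.pow 2).aestronglyMeasurable)
        (hσ2.const_mul _) (fun N => Eventually.of_forall fun z => ?_)
        (Eventually.of_forall fun z => ?_)
      · have h4 : ∀ u : L2, ‖u‖ ≤ C → ‖average ρ u z‖ ≤ c * C := fun u hu =>
          (norm_average_le hρ hρs u z).trans (mul_le_mul_of_nonneg_left hu (Real.sqrt_nonneg _))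
        rw [Real.norm_of_nonneg (sq_nonneg _), ← mul_pow, ← map_sub]
        refine pow_le_pow_left₀ (norm_nonneg _) ((σ z).le_opNorm _ |>.trans ?_) 2
        rw [mul_comm]
        refine mul_le_mul_of_nonneg_right ?_ (norm_nonneg _)
        refine (norm_sub_le _ _).trans ?_
        linarith [h4 _ (hC N), h4 _ hx₀]
      · have h5 := ((σ z).continuous.tendsto _).comp (hpt z)
        have h6 := (h5.sub_const (σ z (average ρ x₀ z))).norm.pow 2
        simpa using h6
    rw [tendsto_iff_norm_sub_tendsto_zero]
    have h7 := h2.sqrt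
    simpa using h7
  refine ⟨S, ?_, ⟨√(∫ x, ‖σ x‖ ^ 2) * c, by positivity, fun u => ?_⟩, hweak, fun u => ?_⟩
  -- Norm convergence implies bounded weak convergence, so continuity is a special case of `hweak`.
  · refine continuous_iff_seqContinuous.2 fun x x₀ hx => ?_
    obtain ⟨C, hC⟩ := (Metric.isBounded_range_of_tendsto x hx).exists_norm_le
    exact hweak x x₀ C (fun N => hC _ ⟨N, rfl⟩) fun y => hx.inner tendsto_const_nhds
  · refine le_of_sq_le_sq ?_ (by positivity)
    rw [lp_two_norm_sq, mul_pow, mul_pow, Real.sq_sqrt (integral_nonneg fun x => by positivity),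
      mul_assoc, ← mul_pow, ← integral_mul_const]
    refine integral_mono_of_nonneg (Eventually.of_forall fun x => by positivity)
      (hσ2.mul_const _) ?_
    filter_upwards [hS u] with x hx
    rw [hx, ← mul_pow]
    exact pow_le_pow_left₀ (norm_nonneg _) (((σ x).le_opNorm _).trans
      (mul_le_mul_of_nonneg_left (norm_average_le hρ hρs u x) (norm_nonneg _))) 2
  · have h1 : ∀ x, average ρ (toL2 u) x = average ρ u x := by
      intro x
      rw [average_eq_swap, average_eq_swap]
      refine integral_congr_ae ?_
      filter_upwards [coeFn_toL2 u] with y hy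
      rw [hy]
    have h2 : ‖actL (hσL.toLp σ) (toL2 u) - S (toL2 u)‖ₑ ^ 2 ≤
        ENNReal.ofReal (δ * √(∑ i, ‖toL2 (pdT i u)‖ ^ 2)) ^ 2 := by
      rw [← enorm_lp_two_sq]
      calc ∫⁻ x, ‖(actL (hσL.toLp σ) (toL2 u) - S (toL2 u) : L2) x‖ₑ ^ 2
          ≤ ∫⁻ x, ENNReal.ofReal K ^ 2 * ‖u x - average ρ u x‖ₑ ^ 2 := by
            refine lintegral_mono_ae ?_
            filter_upwards [Lp.coeFn_sub (actL (hσL.toLp σ) (toL2 u)) (S (toL2 u)),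
              hS (toL2 u), coeFn_actL (hσL.toLp σ) (toL2 u), coeFn_toL2 u, hσL.coeFn_toLp]
              with x h3 h4 h5 h6 h7
            rw [h3, Pi.sub_apply, h4, h5, h6, h7, h1, ← map_sub, ← mul_pow]
            refine pow_le_pow_left₀ zero_le ?_ 2
            rw [← ofReal_norm, ← ofReal_norm, ← ENNReal.ofReal_mul hK0]
            exact ENNReal.ofReal_le_ofReal (((σ x).le_opNorm _).trans
              (mul_le_mul_of_nonneg_right (hK x) (norm_nonneg _)))
        _ ≤ ENNReal.ofReal K ^ 2 *
            ENNReal.ofReal ((δ / (K + 1)) ^ 2 * ∑ i, ‖toL2 (pdT i u)‖ ^ 2) := by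
            rw [lintegral_const_mul']
            · gcongr
              exact lintegral_sub_average_sq_le φ le_rfl u
            · simp
        _ ≤ _ := by
            rw [← ENNReal.ofReal_pow hK0, ← ENNReal.ofReal_mul (by positivity),
              ← ENNReal.ofReal_pow (by positivity)]
            refine ENNReal.ofReal_le_ofReal ?_
            rw [mul_pow, Real.sq_sqrt (by positivity), ← mul_assoc, ← mul_pow]
            gcongr
            rw [mul_div_assoc', div_le_iff₀ (by positivity)]
            nlinarith
    have h3 := (ENNReal.pow_le_pow_left_iff two_ne_zero).1 h2
    rwa [← ofReal_norm, ENNReal.ofReal_le_ofReal_iff (by positivity)] at h3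

end Smoothing

/-! ### Passage to the limit in quadratic terms. -/

section QuadraticLimit

/-- Convergence of the quadratic terms: weak convergence of both factors at every time suffices,
provided that one of them has a gradient bounded in `L²(0,T; L²)`. -/
theorem tendsto_integral_actL {σ : E3 → E3 →L[ℝ] E3} (hσ : Continuous σ)
    (hσs : HasCompactSupport σ) (hσL : MemLp σ ∞ (volume : Measure E3)) {u : ℕ → ℝ → Test}
    {Y : ℕ → ℝ → L2} {v₀ Y₀ : ℝ → L2} {C T : ℝ} (hT : 0 ≤ T)
    (huC : ∀ N t, ‖toL2 (u N t)‖ ≤ C) (hYC : ∀ N t, ‖Y N t‖ ≤ C)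
    (hu : ∀ N, Continuous fun t => toL2 (u N t)) (hY : ∀ N, Continuous (Y N))
    (hg : ∀ N i, Continuous fun t => toL2 (pdT i (u N t)))
    (hgC : ∀ᶠ N in atTop, ∫ t in 0..T, ∑ i, ‖toL2 (pdT i (u N t))‖ ^ 2 ≤ C)
    (huw : ∀ t y, Tendsto (fun N => inner ℝ (toL2 (u N t)) y) atTop (𝓝 (inner ℝ (v₀ t) y)))
    (hYw : ∀ t y, Tendsto (fun N => inner ℝ (Y N t) y) atTop (𝓝 (inner ℝ (Y₀ t) y))) :
    Tendsto (fun N => ∫ t in 0..T, inner ℝ (actL (hσL.toLp σ) (toL2 (u N t))) (Y N t)) atTop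
      (𝓝 (∫ t in 0..T, inner ℝ (actL (hσL.toLp σ) (v₀ t)) (Y₀ t))) := by
  set M := actL (hσL.toLp σ) with hM
  have hC0 : 0 ≤ C := (norm_nonneg _).trans (huC 0 0)
  have hmeas : ∀ {x : ℕ → ℝ → L2} {x₀ : ℝ → L2}, (∀ N, Continuous (x N)) →
      (∀ t y, Tendsto (fun N => inner ℝ (x N t) y) atTop (𝓝 (inner ℝ (x₀ t) y))) →
      StronglyMeasurable x₀ := by
    intro x x₀ hx hw
    refine stronglyMeasurable_of_inner dense_univ fun y _ => ?_
    refine measurable_of_tendsto_metrizable (f := fun N t => inner ℝ (x N t) y)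
      (fun N => ((hx N).inner continuous_const).measurable) ?_
    rw [tendsto_pi_nhds]
    exact fun t => hw t y
  have hvm : StronglyMeasurable v₀ := hmeas hu huw
  have hYm : StronglyMeasurable Y₀ := hmeas hY hYw
  have hv₀C : ∀ t, ‖v₀ t‖ ≤ C := fun t => norm_le_of_weak (fun N => huC N t) (huw t)
  have hY₀C : ∀ t, ‖Y₀ t‖ ≤ C := fun t => norm_le_of_weak (fun N => hYC N t) (hYw t)
  have hbdd : ∀ {f : ℝ → L2} {g : ℝ → L2} (a b : ℝ), StronglyMeasurable f → StronglyMeasurable g →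
      (∀ t, ‖f t‖ ≤ a) → (∀ t, ‖g t‖ ≤ b) → 0 ≤ a →
      IntervalIntegrable (fun t => inner ℝ (f t) (g t)) volume 0 T := by
    intro f g a b hf hg' ha hb ha0
    refine (intervalIntegrable_const (c := a * b)).mono_fun
      (hf.inner hg').aestronglyMeasurable (Eventually.of_forall fun t => ?_)
    refine (norm_inner_le_norm _ _).trans (le_trans ?_ (le_abs_self _))
    exact mul_le_mul (ha t) (hb t) (norm_nonneg _) ha0
  have hMb : ∀ {x : L2}, ‖x‖ ≤ C → ‖M x‖ ≤ ‖M‖ * C := fun hx =>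
    (M.le_opNorm _).trans (by gcongr)
  rw [Metric.tendsto_nhds]
  intro ε hε
  -- The smoothing error, integrated over `[0, T]`, is at most `δ C (T + C)`; with `δ = ε / (4 D)`
  -- this is below `ε / 4`, and the `1` keeps `D` positive.
  let D := C * (T + C) + 1
  have hD : 0 < D := by positivity
  obtain ⟨S, hSc, ⟨B, hB0, hB⟩, hSw, hSδ⟩ := exists_smoothing hσ hσs hσL
    (δ := ε / (4 * D)) (by positivity)
  have hSb : ∀ {x : L2}, ‖x‖ ≤ C → ‖S x‖ ≤ B * C := fun hx =>
    (hB _).trans (by gcongr)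
  have hSvm : StronglyMeasurable fun t => S (v₀ t) := hSc.comp_stronglyMeasurable hvm
  have hMvm : StronglyMeasurable fun t => M (v₀ t) := M.continuous.comp_stronglyMeasurable hvm
  have hSu : ∀ N, Continuous fun t => S (toL2 (u N t)) := fun N => hSc.comp (hu N)
  have hMu : ∀ N, Continuous fun t => M (toL2 (u N t)) := fun N => M.continuous.comp (hu N)
  -- the error on the approximations
  have herr : ∀ᶠ N in atTop, ∀ Z : ℝ → L2, StronglyMeasurable Z → (∀ t, ‖Z t‖ ≤ C) →
      |∫ t in 0..T, inner ℝ (M (toL2 (u N t)) - S (toL2 (u N t))) (Z t)| ≤ ε / 4 := by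
    filter_upwards [hgC] with N hN Z hZ hZC
    have hgi : IntervalIntegrable (fun t => 1 + ∑ i, ‖toL2 (pdT i (u N t))‖ ^ 2) volume 0 T :=
      Continuous.intervalIntegrable
        (continuous_const.add (continuous_finsetSum _ fun i _ => (hg N i).norm.pow 2)) 0 T
    have h1 : ‖∫ t in 0..T, inner ℝ (M (toL2 (u N t)) - S (toL2 (u N t))) (Z t)‖ ≤
        ∫ t in 0..T, ε / (4 * D) * C * (1 + ∑ i, ‖toL2 (pdT i (u N t))‖ ^ 2) := by
      refine intervalIntegral.norm_integral_le_of_norm_le hT (ae_of_all _ fun t _ => ?_)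
        (hgi.const_mul _)
      -- The smoothing error is linear in the gradient norm, the energy bound quadratic; `√s ≤ 1 +
      -- s` reconciles them without Cauchy–Schwarz in time.
      have h2 : √(∑ i, ‖toL2 (pdT i (u N t))‖ ^ 2) ≤ 1 + ∑ i, ‖toL2 (pdT i (u N t))‖ ^ 2 := by
        have h3 : 0 ≤ ∑ i, ‖toL2 (pdT i (u N t))‖ ^ 2 := by positivity
        rw [Real.sqrt_le_left (by positivity)]
        nlinarith
      calc ‖inner ℝ (M (toL2 (u N t)) - S (toL2 (u N t))) (Z t)‖
          ≤ (ε / (4 * D) * √(∑ i, ‖toL2 (pdT i (u N t))‖ ^ 2)) * C :=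
            (norm_inner_le_norm _ _).trans
              (mul_le_mul (hSδ _) (hZC t) (norm_nonneg _) (by positivity))
        _ ≤ _ := by
            rw [mul_right_comm]
            gcongr
    have hgi' : IntervalIntegrable (fun t => ∑ i, ‖toL2 (pdT i (u N t))‖ ^ 2) volume 0 T :=
      Continuous.intervalIntegrable
        (continuous_finsetSum _ fun i _ => (hg N i).norm.pow 2) 0 T
    rw [intervalIntegral.integral_const_mul, intervalIntegral.integral_add
      intervalIntegrable_const hgi'] at h1
    simp only [intervalIntegral.integral_const, smul_eq_mul, mul_one, sub_zero] at h1
    refine h1.trans ?_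
    calc ε / (4 * D) * C * (T + ∫ t in 0..T, ∑ i, ‖toL2 (pdT i (u N t))‖ ^ 2)
        ≤ ε / (4 * D) * C * (T + C) := by gcongr
      _ ≤ ε / (4 * D) * D := by
          rw [mul_assoc]
          gcongr
          simp [D]
      _ = ε / 4 := by field_simp
  -- the compact part
  have hcomp : Tendsto (fun N => ∫ t in 0..T, inner ℝ (S (toL2 (u N t))) (Y N t)) atTop
      (𝓝 (∫ t in 0..T, inner ℝ (S (v₀ t)) (Y₀ t))) := by
    refine intervalIntegral.tendsto_integral_filter_of_dominated_convergence
      (fun _ => B * C * C) (Eventually.of_forall fun N =>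
        ((hSu N).inner (hY N)).aestronglyMeasurable)
      (Eventually.of_forall fun N => ae_of_all _ fun t _ => ?_) intervalIntegrable_const
      (ae_of_all _ fun t _ => ?_)
    · exact (norm_inner_le_norm _ _).trans
        (mul_le_mul (hSb (huC N t)) (hYC N t) (norm_nonneg _) (by positivity))
    · have h1 := tendsto_inner_of_weak_of_strong (fun N => hYC N t) (hYw t)
        (hSw _ _ C (fun N => huC N t) (huw t))
      simpa only [real_inner_comm] using h1
  -- the error on the limit
  have hlim : |∫ t in 0..T, inner ℝ (M (v₀ t) - S (v₀ t)) (Y₀ t)| ≤ ε / 4 := by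
    -- With the fixed second factor `Y₀`, weak convergence of `u N` suffices, and the uniform bound
    -- `herr` survives in the limit. No gradient of `v₀` is needed.
    have h1 : Tendsto (fun N => ∫ t in 0..T, inner ℝ (M (toL2 (u N t)) - S (toL2 (u N t))) (Y₀ t))
        atTop (𝓝 (∫ t in 0..T, inner ℝ (M (v₀ t) - S (v₀ t)) (Y₀ t))) := by
      refine intervalIntegral.tendsto_integral_filter_of_dominated_convergence
        (fun _ => (‖M‖ * C + B * C) * C) (Eventually.of_forall fun N =>
          (((hMu N).sub (hSu N)).stronglyMeasurable.inner hYm).aestronglyMeasurable)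
        (Eventually.of_forall fun N => ae_of_all _ fun t _ => ?_) intervalIntegrable_const
        (ae_of_all _ fun t _ => ?_)
      · exact (norm_inner_le_norm _ _).trans (mul_le_mul ((norm_sub_le _ _).trans
          (add_le_add (hMb (huC N t)) (hSb (huC N t)))) (hY₀C t) (norm_nonneg _) (by positivity))
      · simp only [inner_sub_left]
        refine Tendsto.sub ?_ ((hSw _ _ C (fun N => huC N t) (huw t)).inner tendsto_const_nhds)
        simp only [← ContinuousLinearMap.adjoint_inner_right]
        exact huw t _
    exact le_of_tendsto h1.abs (herr.mono fun N hN => hN Y₀ hYm hY₀C)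
  filter_upwards [herr, Metric.tendsto_nhds.1 hcomp (ε / 4) (by positivity)] with N h1 h2
  have h3 := h1 (Y N) (hY N).stronglyMeasurable (hYC N)
  have i1 : ∀ N, IntervalIntegrable (fun t => inner ℝ (M (toL2 (u N t))) (Y N t)) volume 0 T :=
    fun N => ((hMu N).inner (hY N)).intervalIntegrable _ _
  have i2 : ∀ N, IntervalIntegrable (fun t => inner ℝ (S (toL2 (u N t))) (Y N t)) volume 0 T :=
    fun N => ((hSu N).inner (hY N)).intervalIntegrable _ _
  have i3 := hbdd (‖M‖ * C) C hMvm hYm (fun t => hMb (hv₀C t)) hY₀C (by positivity)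
  have i4 := hbdd (B * C) C hSvm hYm (fun t => hSb (hv₀C t)) hY₀C (by positivity)
  simp only [inner_sub_left] at h3 hlim
  rw [intervalIntegral.integral_sub (i1 N) (i2 N)] at h3
  rw [intervalIntegral.integral_sub i3 i4] at hlim
  rw [Real.dist_eq] at h2 ⊢
  rw [abs_le] at h3 hlim
  rw [abs_lt] at h2 ⊢
  constructor <;> linarith [h2.1, h2.2, h3.1, h3.2, hlim.1, hlim.2]

end QuadraticLimit

/-! ### A dense sequence of test states. -/

section States

/-- Test states: quadruples `(w₋, w₊, w_E, w_B)` of test fields, the first two divergence free. -/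
def states : Submodule ℝ (Fin 4 → Test) where
  carrier := {Φ | Φ 0 ∈ solenoidal ∧ Φ 1 ∈ solenoidal}
  add_mem' h₁ h₂ := ⟨add_mem h₁.1 h₂.1, add_mem h₁.2 h₂.2⟩
  zero_mem' := ⟨zero_mem _, zero_mem _⟩
  smul_mem' c _ h := ⟨Submodule.smul_mem _ c h.1, Submodule.smul_mem _ c h.2⟩

/-- The space of test states. -/
abbrev State : Type := ↥states

/-- The `i`-th component of a test state. -/
def State.comp (i : Fin 4) : State →ₗ[ℝ] Test := LinearMap.proj i ∘ₗ states.subtype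

theorem State.ext {Φ Ψ : State} (h : ∀ i, State.comp i Φ = State.comp i Ψ) : Φ = Ψ :=
  Subtype.ext (funext h)

/-- The values of a test field and of the derivatives that determine its size. -/
def jetMap (w : Test) : C(E3, E3 × (E3 →L[ℝ] E3) × E3) :=
  ⟨fun x => (w x, fderiv ℝ w x, lapT w x),
    w.continuous.prodMk ((continuous_fderiv_test w).prodMk (lapT w).continuous)⟩

/-- There is a sequence of test states that is dense for `jetNorm`. -/
theorem exists_dense_seq_states :
    ∃ Φ : ℕ → State, ∀ Ψ : State, ∀ ε > 0, ∃ k, ∀ i,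
      jetNorm (State.comp i (Ψ - Φ k)) < ε := by
  -- Test states supported in a fixed ball embed, through their values, Jacobians and Laplacians, in
  -- a separable space of continuous functions on that ball. The states are exhausted by countably
  -- many balls.
  let D : ℕ → Set State := fun R =>
    {Ψ | ∀ i, Function.support (State.comp i Ψ : E3 → E3) ⊆ Metric.closedBall 0 R}
  let F := Fin 4 → E3 × (E3 →L[ℝ] E3) × E3
  let K : ℕ → Set E3 := fun R => Metric.closedBall 0 R
  have hKc : ∀ R, CompactSpace (K R) := fun R =>
    isCompact_iff_compactSpace.1 (isCompact_closedBall _ _)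
  let J : ∀ R, State → C(K R, F) := fun R Ψ =>
    ⟨fun x i => jetMap (State.comp i Ψ) x, continuous_pi fun i =>
      (jetMap (State.comp i Ψ)).continuous.comp continuous_subtype_val⟩
  -- A subset of a separable metric space has a countable dense part of its own, so the approximants
  -- are again test states supported in the same ball.
  have hsep : ∀ R, ∃ t : Set State, t ⊆ D R ∧ t.Countable ∧ J R '' D R ⊆ closure (J R '' t) := by
    intro R
    obtain ⟨s, hs1, hs2, hs3⟩ := (TopologicalSpace.IsSeparable.of_separableSpace
      (J R '' D R)).exists_countable_dense_subset
    have hs1' : ∀ z ∈ s, ∃ Ψ ∈ D R, J R Ψ = z := hs1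
    choose! g hg1 hg2 using hs1'
    refine ⟨g '' s, ?_, hs2.image g, ?_⟩
    · rintro _ ⟨z, hz, rfl⟩
      exact hg1 z hz
    · rw [image_image]
      rwa [show (fun z => J R (g z)) '' s = s from by
        refine (image_congr fun z hz => hg2 z hz).trans (image_id' s)]
  choose t htD htc ht using hsep
  obtain ⟨Φ, hΦ⟩ := ((countable_iUnion htc).insert 0).exists_eq_range
    ⟨0, mem_insert _ _⟩
  refine ⟨Φ, fun Ψ ε hε => ?_⟩
  have hR : ∃ R : ℕ, Ψ ∈ D R := by
    have h1 : ∀ i, ∃ r : ℝ, Function.support (State.comp i Ψ : E3 → E3) ⊆ Metric.closedBall 0 r :=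
      fun i => by
        obtain ⟨r, hr⟩ := (State.comp i Ψ).hasCompactSupport.isCompact.isBounded.subset_closedBall 0
        exact ⟨r, (subset_tsupport _).trans hr⟩
    choose r hr using h1
    obtain ⟨R, hR⟩ := exists_nat_ge (∑ i, |r i|)
    refine ⟨R, fun i => (hr i).trans (Metric.closedBall_subset_closedBall ?_)⟩
    exact (le_abs_self _).trans ((Finset.single_le_sum (f := fun i => |r i|)
      (fun j _ => abs_nonneg _) (Finset.mem_univ i)).trans hR)
  obtain ⟨R, hR⟩ := hR
  obtain ⟨C, hC0, hC⟩ := jetNorm_le R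
  obtain ⟨_, ⟨Ψ', hΨ', rfl⟩, hd⟩ := (Metric.mem_closure_iff (α := C(K R, F))).1
    (ht R (mem_image_of_mem _ hR))
    (ε / (2 * (C + 1))) (by positivity)
  obtain ⟨k, hk⟩ : Ψ' ∈ range Φ := hΦ ▸ mem_insert_of_mem _ (mem_iUnion.2 ⟨R, hΨ'⟩)
  refine ⟨k, fun i => ?_⟩
  rw [hk, show State.comp i (Ψ - Ψ') = State.comp i Ψ - State.comp i Ψ' from rfl]
  set v := State.comp i Ψ
  set w := State.comp i Ψ'
  have hsupp : Function.support (v - w : Test) ⊆ Metric.closedBall 0 (R : ℝ) := by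
    intro x hx
    by_contra hxR
    refine hx ?_
    have h1 : v x = 0 := by
      by_contra h
      exact hxR (hR i h)
    have h2 : w x = 0 := by
      by_contra h
      exact hxR (htD R hΨ' i h)
    change v x - w x = 0
    rw [h1, h2, sub_zero]
  have hfd : ∀ x, fderiv ℝ (v - w : Test) x = fderiv ℝ v x - fderiv ℝ w x := fun x =>
    fderiv_sub (v.contDiff.differentiable (by simp) x) (w.contDiff.differentiable (by simp) x)
  have hin : ∀ x ∈ K R, ‖jetMap v x - jetMap w x‖ ≤ ε / (2 * (C + 1)) := by
    intro x hx
    rw [← dist_eq_norm]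
    exact ((dist_le_pi_dist (J R Ψ ⟨x, hx⟩) (J R Ψ' ⟨x, hx⟩) i).trans
      (ContinuousMap.dist_apply_le_dist _)).trans hd.le
  have hout : ∀ x ∉ K R, ((v - w : Test) : E3 → E3) =ᶠ[𝓝 x] 0 := by
    intro x hx
    exact notMem_tsupport_iff_eventuallyEq.1 fun h =>
      hx (closure_minimal hsupp Metric.isClosed_closedBall h)
  have hη : 0 ≤ ε / (2 * (C + 1)) := by positivity
  have key := hC (v - w) hsupp (ε / (2 * (C + 1))) hη (fun x => ?_) (fun x => ?_) (fun x => ?_)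
  · refine key.trans_lt ?_
    calc C * (ε / (2 * (C + 1))) ≤ (C + 1) * (ε / (2 * (C + 1))) := by gcongr; linarith
      _ = ε / 2 := by field_simp
      _ < ε := by linarith
  · by_cases hx : x ∈ K R
    · exact (norm_fst_le (jetMap v x - jetMap w x)).trans (hin x hx)
    · rw [(hout x hx).eq_of_nhds]
      simpa using hη
  · by_cases hx : x ∈ K R
    · rw [hfd]
      exact ((norm_fst_le _).trans (norm_snd_le (jetMap v x - jetMap w x))).trans (hin x hx)
    · rw [(hout x hx).fderiv_eq]
      simpa using hη
  · by_cases hx : x ∈ K R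
    · rw [← lapT_apply, map_sub]
      exact ((norm_snd_le _).trans (norm_snd_le (jetMap v x - jetMap w x))).trans (hin x hx)
    · rw [(InnerProductSpace.laplacian_congr_nhds (hout x hx)).eq_of_nhds]
      have h0 : Laplacian.laplacian (0 : E3 → E3) x = 0 :=
        congrFun InnerProductSpace.laplacian_const x
      rw [h0, norm_zero]
      exact hη

end States

/-! ### The weak forms as linear functionals of the test field. -/

section Functionals

theorem norm_toL2_le_jetNorm (w : Test) : ‖toL2 w‖ ≤ jetNorm w := by
  unfold jetNorm
  linarith [norm_nonneg (toL2 (lapT w)), norm_nonneg (toL2 (curlT w)), norm_nonneg (jacobian w),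
    norm_nonneg (crossMatrix w)]

theorem norm_lapT_le_jetNorm (w : Test) : ‖toL2 (lapT w)‖ ≤ jetNorm w := by
  unfold jetNorm
  linarith [norm_nonneg (toL2 w), norm_nonneg (toL2 (curlT w)), norm_nonneg (jacobian w),
    norm_nonneg (crossMatrix w)]

theorem norm_curlT_le_jetNorm (w : Test) : ‖toL2 (curlT w)‖ ≤ jetNorm w := by
  unfold jetNorm
  linarith [norm_nonneg (toL2 w), norm_nonneg (toL2 (lapT w)), norm_nonneg (jacobian w),
    norm_nonneg (crossMatrix w)]

theorem norm_jacobian_le_jetNorm (w : Test) : ‖jacobian w‖ ≤ jetNorm w := by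
  unfold jetNorm
  linarith [norm_nonneg (toL2 w), norm_nonneg (toL2 (lapT w)), norm_nonneg (toL2 (curlT w)),
    norm_nonneg (crossMatrix w)]

theorem norm_crossMatrix_le_jetNorm (w : Test) : ‖crossMatrix w‖ ≤ jetNorm w := by
  unfold jetNorm
  linarith [norm_nonneg (toL2 w), norm_nonneg (toL2 (lapT w)), norm_nonneg (toL2 (curlT w)),
    norm_nonneg (jacobian w)]

/-- The right-hand side of the weak momentum equation, at a fixed time. -/
def momentumForm (n m ν q : ℝ) (v E B F : L2) : Test →ₗ[ℝ] ℝ :=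
  ν • ((innerSL ℝ v).toLinearMap ∘ₗ toL2 ∘ₗ lapT)
    + (n * m) • (((innerSL ℝ v).comp (actL.flip v)).toLinearMap ∘ₗ jacobian)
    + (q * n) • ((innerSL ℝ E).toLinearMap ∘ₗ toL2
      + ((innerSL ℝ B).comp (actL.flip v)).toLinearMap ∘ₗ crossMatrix)
    + (innerSL ℝ F).toLinearMap ∘ₗ toL2

/-- The right-hand side of a weak Maxwell equation, at a fixed time. -/
def maxwellForm (k : ℝ) (W J : L2) : Test →ₗ[ℝ] ℝ :=
  k • ((innerSL ℝ W).toLinearMap ∘ₗ toL2 ∘ₗ curlT) + (innerSL ℝ J).toLinearMap ∘ₗ toL2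

theorem momentumForm_apply (n m ν q : ℝ) (v E B F : L2) (w : Test) :
    momentumForm n m ν q v E B F w = ν * inner ℝ v (toL2 (lapT w))
      + n * m * inner ℝ v (actL (jacobian w) v)
      + q * n * (inner ℝ E (toL2 w) + inner ℝ B (actL (crossMatrix w) v))
      + inner ℝ F (toL2 w) := rfl

theorem maxwellForm_apply (k : ℝ) (W J : L2) (w : Test) :
    maxwellForm k W J w = k * inner ℝ W (toL2 (curlT w)) + inner ℝ J (toL2 w) := rfl

theorem integrable_inner_test (u : L2) (w : Test) : Integrable fun x => inner ℝ (u x) (w x) := by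
  refine (L2.integrable_inner (𝕜 := ℝ) u (toL2 w)).congr ?_
  filter_upwards [coeFn_toL2 w] with x hx
  rw [hx]

/-- Identifies the operator expression, in which estimates and limits are carried out, with the
integrand of `WeakMomentum`. -/
theorem momentumForm_eq_integral (n m ν q : ℝ) (v E B F : L2) (w : Test) :
    momentumForm n m ν q v E B F w = ∫ x,
      (ν * inner ℝ (v x) (Laplacian.laplacian (w : E3 → E3) x)
        + n * m * inner ℝ (v x) (fderiv ℝ w x (v x))
        + q * n * inner ℝ (E x + cross (v x) (B x)) (w x)
        + inner ℝ (F x) (w x)) := by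
  have h1 : Integrable fun x => inner ℝ (v x) (Laplacian.laplacian (w : E3 → E3) x) := by
    simpa only [lapT_apply] using integrable_inner_test v (lapT w)
  have c2 : (fun x => inner ℝ (v x) (actL (jacobian w) v x)) =ᵐ[volume]
      fun x => inner ℝ (v x) (fderiv ℝ w x (v x)) := by
    filter_upwards [coeFn_actL_jacobian w v] with x hx
    rw [hx]
  have h2 : Integrable fun x => inner ℝ (v x) (fderiv ℝ w x (v x)) :=
    (L2.integrable_inner (𝕜 := ℝ) v (actL (jacobian w) v)).congr c2
  have h3 := integrable_inner_test E w
  have c4 : (fun x => inner ℝ (B x) (actL (crossMatrix w) v x)) =ᵐ[volume]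
      fun x => inner ℝ (cross (v x) (B x)) (w x) := by
    filter_upwards [coeFn_actL_crossMatrix w v] with x hx
    rw [hx, inner_cross_comm, real_inner_comm]
  have h4 : Integrable fun x => inner ℝ (cross (v x) (B x)) (w x) :=
    (L2.integrable_inner (𝕜 := ℝ) B (actL (crossMatrix w) v)).congr c4
  have h5 := integrable_inner_test F w
  have e1 := integral_add (((h1.const_mul ν).add (h2.const_mul (n * m))).add
    ((h3.add h4).const_mul (q * n))) h5
  have e2 := integral_add ((h1.const_mul ν).add (h2.const_mul (n * m)))
    ((h3.add h4).const_mul (q * n))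
  have e3 := integral_add (h1.const_mul ν) (h2.const_mul (n * m))
  have e4 := integral_add h3 h4
  simp only [Pi.add_apply] at e1 e2 e3 e4
  simp only [inner_add_left]
  rw [e1, e2, e3, integral_const_mul, integral_const_mul, integral_const_mul, e4,
    momentumForm_apply, inner_toL2, inner_toL2, inner_toL2, L2.inner_def, L2.inner_def,
    integral_congr_ae c2, integral_congr_ae c4]
  simp only [lapT_apply]

theorem maxwellForm_eq_integral (k : ℝ) (W J : L2) (w : Test) :
    maxwellForm k W J w =
      ∫ x, (k * inner ℝ (W x) (curl w x) + inner ℝ (J x) (w x)) := by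
  have h1 : Integrable fun x => inner ℝ (W x) (curl w x) := integrable_inner_test W (curlT w)
  rw [integral_add (h1.const_mul k) (integrable_inner_test J w), integral_const_mul,
    maxwellForm_apply, inner_toL2, inner_toL2]
  rfl

theorem abs_inner_le_jet {u y : L2} {C j : ℝ} (hu : ‖u‖ ≤ C) (hy : ‖y‖ ≤ j) :
    |inner ℝ u y| ≤ C * j :=
  (abs_real_inner_le_norm _ _).trans
    (mul_le_mul hu hy (norm_nonneg _) ((norm_nonneg _).trans hu))

/-- All derivatives fall on `w`, so bounded `L²` fields suffice, even for the quadratic terms.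
Uniformity in the fields gives the equi-Lipschitz bound in time and the extension by density to all
test states. -/
theorem exists_abs_momentumForm_le (n m ν q C : ℝ) : ∃ K, 0 ≤ K ∧ ∀ v E B F : L2,
    ‖v‖ ≤ C → ‖E‖ ≤ C → ‖B‖ ≤ C → ‖F‖ ≤ C → ∀ w,
      |momentumForm n m ν q v E B F w| ≤ K * jetNorm w := by
  refine ⟨|ν| * |C| + |n * m| * (|C| * (‖actL‖ * |C|)) +
    |q * n| * (|C| + |C| * (‖actL‖ * |C|)) + |C|, by positivity,
    fun v E B F hv hE hB hF w => ?_⟩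
  replace hv := hv.trans (le_abs_self C)
  replace hE := hE.trans (le_abs_self C)
  replace hB := hB.trans (le_abs_self C)
  replace hF := hF.trans (le_abs_self C)
  have j0 := jetNorm_nonneg w
  have j1 := norm_toL2_le_jetNorm w
  have j2 := norm_lapT_le_jetNorm w
  have j4 := norm_jacobian_le_jetNorm w
  have j5 := norm_crossMatrix_le_jetNorm w
  have act : ∀ σ : LTop, ‖σ‖ ≤ jetNorm w → ‖actL σ v‖ ≤ ‖actL‖ * |C| * jetNorm w := by
    intro σ hσ
    calc ‖actL σ v‖ ≤ ‖actL‖ * ‖σ‖ * ‖v‖ := actL.le_opNorm₂ σ v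
      _ ≤ ‖actL‖ * jetNorm w * |C| := by gcongr
      _ = _ := by ring
  have a1 := abs_inner_le_jet hv j2
  have a2 := abs_inner_le_jet hv (act _ j4)
  have a3 := abs_inner_le_jet hE j1
  have a4 := abs_inner_le_jet hB (act _ j5)
  have a5 := abs_inner_le_jet hF j1
  rw [momentumForm_apply]
  calc _ ≤ |ν| * |inner ℝ v (toL2 (lapT w))| + |n * m| * |inner ℝ v (actL (jacobian w) v)| +
        |q * n| * (|inner ℝ E (toL2 w)| + |inner ℝ B (actL (crossMatrix w) v)|) +
        |inner ℝ F (toL2 w)| := by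
        refine (abs_add_le _ _).trans (add_le_add_left ((abs_add_le _ _).trans (add_le_add
          ((abs_add_le _ _).trans (add_le_add (abs_mul _ _).le (abs_mul _ _).le)) ?_)) _)
        rw [abs_mul]
        gcongr
        exact abs_add_le _ _
    _ ≤ |ν| * (|C| * jetNorm w) + |n * m| * (|C| * (‖actL‖ * |C| * jetNorm w)) +
        |q * n| * (|C| * jetNorm w + |C| * (‖actL‖ * |C| * jetNorm w)) + |C| * jetNorm w := by
        gcongr
    _ = _ := by ring

theorem exists_abs_maxwellForm_le (k C : ℝ) : ∃ K, 0 ≤ K ∧ ∀ W J : L2,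
    ‖W‖ ≤ C → ‖J‖ ≤ C → ∀ w, |maxwellForm k W J w| ≤ K * jetNorm w := by
  refine ⟨|k| * |C| + |C|, by positivity, fun W J hW hJ w => ?_⟩
  replace hW := hW.trans (le_abs_self C)
  replace hJ := hJ.trans (le_abs_self C)
  have j1 := norm_toL2_le_jetNorm w
  have j3 := norm_curlT_le_jetNorm w
  have a1 := abs_inner_le_jet hW j3
  have a2 := abs_inner_le_jet hJ j1
  rw [maxwellForm_apply]
  calc _ ≤ |k| * |inner ℝ W (toL2 (curlT w))| + |inner ℝ J (toL2 w)| :=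
        (abs_add_le _ _).trans (add_le_add_left (abs_mul _ _).le _)
    _ ≤ |k| * (|C| * jetNorm w) + |C| * jetNorm w := by gcongr
    _ = _ := by ring

end Functionals

/-! ### The two-fluid system on scaled states and its energy structure. -/

section System

/-- Quadruples of `L²` fields. -/
abbrev L2x4 : Type := PiLp 2 fun _ : Fin 4 => L2

variable (c : Constants)

/-- The weights of the four fields in the energy. -/
def weight : Fin 4 → ℝ :=
  ![c.n * c.mMinus / c.ε₀, c.n * c.mPlus / c.ε₀, 1, 1 / (c.ε₀ * c.μ₀)]

theorem weight_pos (i : Fin 4) : 0 < weight c i := by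
  have := c.n_pos
  have := c.mMinus_pos
  have := c.mPlus_pos
  have := c.ε₀_pos
  have := c.μ₀_pos
  fin_cases i <;> simp [weight] <;> positivity

/-- The square roots of the weights. -/
def scale (i : Fin 4) : ℝ := √(weight c i)

theorem scale_pos (i : Fin 4) : 0 < scale c i := Real.sqrt_pos.2 (weight_pos c i)

theorem scale_sq (i : Fin 4) : scale c i ^ 2 = weight c i := Real.sq_sqrt (weight_pos c i).le

/-- The physical fields of a scaled state. -/
def phys (i : Fin 4) : L2x4 →L[ℝ] L2 := (scale c i)⁻¹ • PiLp.proj 2 (fun _ : Fin 4 => L2) i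

/-- The scaled state of a quadruple of physical fields. -/
def scaled (U : Fin 4 → L2) : L2x4 := WithLp.toLp 2 fun i => scale c i • U i

@[simp] theorem phys_scaled (U : Fin 4 → L2) (i : Fin 4) : phys c i (scaled c U) = U i := by
  change (scale c i)⁻¹ • scale c i • U i = U i
  rw [smul_smul, inv_mul_cancel₀ (scale_pos c i).ne', one_smul]

theorem inner_scaled (Y : L2x4) (U : Fin 4 → L2) :
    inner ℝ Y (scaled c U) = ∑ i, weight c i * inner ℝ (phys c i Y) (U i) := by
  rw [PiLp.inner_apply]
  refine Finset.sum_congr rfl fun i _ => ?_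
  change inner ℝ (Y i) (scale c i • U i) = weight c i * inner ℝ ((scale c i)⁻¹ • Y i) (U i)
  rw [inner_smul_right, inner_smul_left, ← scale_sq]
  have := (scale_pos c i).ne'
  simp only [conj_trivial]
  field_simp

theorem norm_sq_eq_sum_phys (Y : L2x4) : ‖Y‖ ^ 2 = ∑ i, weight c i * ‖phys c i Y‖ ^ 2 := by
  rw [PiLp.norm_sq_eq_of_L2]
  refine Finset.sum_congr rfl fun i _ => ?_
  change ‖Y i‖ ^ 2 = weight c i * ‖(scale c i)⁻¹ • Y i‖ ^ 2
  rw [norm_smul, mul_pow, ← scale_sq, norm_inv, Real.norm_of_nonneg (scale_pos c i).le]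
  have := (scale_pos c i).ne'
  field_simp

/-- The purpose of the scaling: monotonicity of the Hilbert norm is the physical energy law. -/
theorem energy_phys (Y : L2x4) :
    energy c (phys c 0 Y) (phys c 1 Y) (phys c 2 Y) (phys c 3 Y) = 1 / 2 * ‖Y‖ ^ 2 := by
  rw [norm_sq_eq_sum_phys c]
  simp only [energy, Fin.sum_univ_four, weight, Matrix.cons_val_zero, Matrix.cons_val_one,
    Matrix.cons_val]
  have := c.ε₀_pos.ne'
  have := c.μ₀_pos.ne'
  field_simp

/-- The scaled embedding of test states. -/
def embed : State →ₗ[ℝ] L2x4 where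
  toFun Φ := scaled c fun i => toL2 (State.comp i Φ)
  map_add' Φ Ψ := by
    ext1 i
    change scale c i • toL2 (State.comp i (Φ + Ψ)) =
      scale c i • toL2 (State.comp i Φ) + scale c i • toL2 (State.comp i Ψ)
    rw [map_add, map_add, smul_add]
  map_smul' r Φ := by
    ext1 i
    change scale c i • toL2 (State.comp i (r • Φ)) = r • scale c i • toL2 (State.comp i Φ)
    rw [map_smul, map_smul, smul_comm]

@[simp] theorem phys_embed (Φ : State) (i : Fin 4) :
    phys c i (embed c Φ) = toL2 (State.comp i Φ) := phys_scaled c _ i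

theorem inner_embed (Y : L2x4) (Φ : State) : inner ℝ Y (embed c Φ) =
    ∑ i, weight c i * inner ℝ (phys c i Y) (toL2 (State.comp i Φ)) := inner_scaled c Y _

theorem embed_injective : Function.Injective (embed c) := by
  intro Φ Ψ h
  refine State.ext fun i => toL2_injective ?_
  rw [← phys_embed c Φ, ← phys_embed c Ψ, h]

/-- The weak form of the two-fluid system, on scaled states. -/
def systemForm (Y : L2x4) : State →ₗ[ℝ] ℝ :=
  -- Each prefactor is the energy weight divided by the coefficient of the time derivative: `1/ε₀`
  -- for both momenta, `1` for Ampère, `1/(ε₀μ₀)` for Faraday.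
  (1 / c.ε₀) • (momentumForm c.n c.mMinus c.νMinus (-c.e) (phys c 0 Y) (phys c 2 Y) (phys c 3 Y)
      (-(-c.α • (phys c 1 Y - phys c 0 Y))) ∘ₗ State.comp 0)
    + (1 / c.ε₀) • (momentumForm c.n c.mPlus c.νPlus (c.e * c.Z) (phys c 1 Y) (phys c 2 Y)
      (phys c 3 Y) (-c.α • (phys c 1 Y - phys c 0 Y)) ∘ₗ State.comp 1)
    + maxwellForm (1 / (c.ε₀ * c.μ₀)) (phys c 3 Y)
      (-(c.n * c.e / c.ε₀) • (c.Z • phys c 1 Y - phys c 0 Y)) ∘ₗ State.comp 2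
    + (1 / (c.ε₀ * c.μ₀)) • (maxwellForm (-1) (phys c 2 Y) 0 ∘ₗ State.comp 3)

theorem systemForm_apply (Y : L2x4) (Φ : State) : systemForm c Y Φ =
    1 / c.ε₀ * momentumForm c.n c.mMinus c.νMinus (-c.e) (phys c 0 Y) (phys c 2 Y) (phys c 3 Y)
      (-(-c.α • (phys c 1 Y - phys c 0 Y))) (State.comp 0 Φ)
    + 1 / c.ε₀ * momentumForm c.n c.mPlus c.νPlus (c.e * c.Z) (phys c 1 Y) (phys c 2 Y)
      (phys c 3 Y) (-c.α • (phys c 1 Y - phys c 0 Y)) (State.comp 1 Φ)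
    + maxwellForm (1 / (c.ε₀ * c.μ₀)) (phys c 3 Y)
      (-(c.n * c.e / c.ε₀) • (c.Z • phys c 1 Y - phys c 0 Y)) (State.comp 2 Φ)
    + 1 / (c.ε₀ * c.μ₀) * maxwellForm (-1) (phys c 2 Y) 0 (State.comp 3 Φ) := rfl

theorem contDiff_systemForm (Φ : State) : ContDiff ℝ 1 fun Y => systemForm c Y Φ := by
  simp only [systemForm_apply, momentumForm_apply, maxwellForm_apply]
  have h := fun i => (phys c i).contDiff (n := 1)
  have ha : ∀ (σ : LTop) i, ContDiff ℝ 1 fun Y => actL σ (phys c i Y) := fun σ i =>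
    (actL σ).contDiff.comp (h i)
  have hF : ContDiff ℝ 1 fun Y => -c.α • (phys c 1 Y - phys c 0 Y) :=
    ((h 1).sub (h 0)).const_smul _
  have hJ : ContDiff ℝ 1 fun Y => -(c.n * c.e / c.ε₀) • (c.Z • phys c 1 Y - phys c 0 Y) :=
    (((h 1).const_smul _).sub (h 0)).const_smul _
  have hm : ∀ n m ν q i F (w : Test), ContDiff ℝ 1 F → ContDiff ℝ 1 fun Y =>
      ν * inner ℝ (phys c i Y) (toL2 (lapT w))
      + n * m * inner ℝ (phys c i Y) (actL (jacobian w) (phys c i Y))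
      + q * n * (inner ℝ (phys c 2 Y) (toL2 w)
        + inner ℝ (phys c 3 Y) (actL (crossMatrix w) (phys c i Y)))
      + inner ℝ (F Y) (toL2 w) := fun n m ν q i F w hF =>
    (((contDiff_const.mul ((h i).inner ℝ contDiff_const)).add
      (contDiff_const.mul ((h i).inner ℝ (ha _ i)))).add
      (contDiff_const.mul (((h 2).inner ℝ contDiff_const).add ((h 3).inner ℝ (ha _ i))))).add
      (hF.inner ℝ contDiff_const)
  refine (((contDiff_const.mul (hm _ _ _ _ 0 _ _ hF.neg)).add
    (contDiff_const.mul (hm _ _ _ _ 1 _ _ hF))).add ?_).add (contDiff_const.mul ?_)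
  · exact (contDiff_const.mul ((h 3).inner ℝ contDiff_const)).add (hJ.inner ℝ contDiff_const)
  · exact (contDiff_const.mul ((h 2).inner ℝ contDiff_const)).add contDiff_const

/-- The dissipation of a test state. -/
def dissipation (Φ : State) : ℝ :=
  c.νMinus / c.ε₀ * ∑ i, ‖toL2 (pdT i (State.comp 0 Φ))‖ ^ 2
    + c.νPlus / c.ε₀ * ∑ i, ‖toL2 (pdT i (State.comp 1 Φ))‖ ^ 2
    + c.α / c.ε₀ * ‖toL2 (State.comp 0 Φ) - toL2 (State.comp 1 Φ)‖ ^ 2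

theorem dissipation_nonneg (Φ : State) : 0 ≤ dissipation c Φ := by
  have := c.νMinus_pos
  have := c.νPlus_pos
  have := c.ε₀_pos
  have := c.α_pos
  unfold dissipation
  positivity

/-- With `w` as velocity and as test field, convection integrates to zero because `w` is solenoidal,
and `w × B` is orthogonal to `w` pointwise. -/
theorem momentumForm_self (n m ν q : ℝ) (E B F : L2) {w : Test} (hw : w ∈ solenoidal) :
    momentumForm n m ν q (toL2 w) E B F w =
      -ν * ∑ i, ‖toL2 (pdT i w)‖ ^ 2 + q * n * inner ℝ E (toL2 w) + inner ℝ F (toL2 w) := by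
  have h1 : inner ℝ (toL2 w) (toL2 (lapT w)) = - ∑ i, ‖toL2 (pdT i w)‖ ^ 2 := by
    simp only [inner_toL2_toL2, lapT_apply, norm_toL2_sq]
    exact integral_inner_laplacian_self w.contDiff w.hasCompactSupport
  have h2 : inner ℝ (toL2 w) (actL (jacobian w) (toL2 w)) = 0 := by
    rw [L2.inner_def, ← integral_inner_fderiv_self w.contDiff w.hasCompactSupport hw]
    refine integral_congr_ae ?_
    filter_upwards [coeFn_actL_jacobian w (toL2 w), coeFn_toL2 w] with x h3 h4
    rw [h3, h4]
  have h3 : inner ℝ B (actL (crossMatrix w) (toL2 w)) = 0 := by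
    rw [L2.inner_def, ← integral_zero E3 ℝ]
    refine integral_congr_ae ?_
    filter_upwards [coeFn_actL_crossMatrix w (toL2 w), coeFn_toL2 w] with x h4 h5
    rw [h4, h5, real_inner_comm, ← inner_cross_comm, inner_cross_self]
  rw [momentumForm_apply, h1, h2, h3]
  ring

/-- The energy law. The electric work in the two momentum equations is the opposite of the current
term in Ampère's law, the curl terms cancel by symmetry, and the two friction terms combine into a
square. -/
theorem systemForm_self (Φ : State) : systemForm c (embed c Φ) Φ = - dissipation c Φ := by
  have h1 : inner ℝ (toL2 (State.comp 3 Φ)) (toL2 (curlT (State.comp 2 Φ))) =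
      inner ℝ (toL2 (State.comp 2 Φ)) (toL2 (curlT (State.comp 3 Φ))) := by
    rw [inner_toL2_toL2, inner_toL2_toL2]
    simp only [curlT_apply]
    rw [integral_inner_curl (Test.contDiff _) (Test.contDiff _) (Test.hasCompactSupport _)]
    simp only [real_inner_comm]
  rw [systemForm_apply]
  simp only [phys_embed]
  rw [momentumForm_self _ _ _ _ _ _ _ (w := State.comp 0 Φ) Φ.2.1,
    momentumForm_self _ _ _ _ _ _ _ (w := State.comp 1 Φ) Φ.2.2,
    maxwellForm_apply, maxwellForm_apply, h1]
  set vm := toL2 (State.comp 0 Φ)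
  set vp := toL2 (State.comp 1 Φ)
  set E := toL2 (State.comp 2 Φ)
  have h2 : ‖vm - vp‖ ^ 2 = inner ℝ vp vp - 2 * inner ℝ vp vm + inner ℝ vm vm := by
    rw [norm_sub_sq_real, real_inner_self_eq_norm_sq, real_inner_self_eq_norm_sq,
      real_inner_comm vp vm]
    ring
  have h3 : dissipation c Φ = c.νMinus / c.ε₀ * ∑ i, ‖toL2 (pdT i (State.comp 0 Φ))‖ ^ 2
      + c.νPlus / c.ε₀ * ∑ i, ‖toL2 (pdT i (State.comp 1 Φ))‖ ^ 2
      + c.α / c.ε₀ * ‖vm - vp‖ ^ 2 := rfl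
  simp only [h3, h2, inner_neg_left, inner_smul_left, inner_sub_left, inner_zero_left,
    conj_trivial, real_inner_comm vm vp, real_inner_comm vm E, real_inner_comm vp E]
  ring

end System

/-! ### Galerkin approximations of the system. -/

section Finite

theorem exists_galerkin_solution_of_finite {H : Type*} [NormedAddCommGroup H]
    [InnerProductSpace ℝ H] {E : Type*} [AddCommGroup E] [Module ℝ E] {J : E →ₗ[ℝ] H}
    (hJ : Function.Injective J) {A : H → E →ₗ[ℝ] ℝ} (hA : ∀ w, ContDiff ℝ 1 fun Y => A Y w)
    (hdiss : ∀ w, A (J w) w ≤ 0) {S : Set E} (hS : S.Finite) {u₀ : E} (hu₀ : u₀ ∈ S) {T : ℝ}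
    (hT : 0 ≤ T) :
    ∃ (n : ℕ) (b : Fin n → E) (c : ℝ → Fin n → ℝ), Continuous c ∧ ∑ k, c 0 k • b k = u₀ ∧
      (∀ t, c t = c (max 0 (min T t))) ∧
      (∀ w ∈ S, ∀ t ∈ Icc 0 T,
        HasDerivWithinAt (fun s => inner ℝ (J (∑ k, c s k • b k)) (J w))
          (A (J (∑ k, c t k • b k)) w) (Icc 0 T) t) ∧
      ∀ t ∈ Icc 0 T, HasDerivWithinAt (fun s => ‖J (∑ k, c s k • b k)‖ ^ 2)
        (2 * A (J (∑ k, c t k • b k)) (∑ k, c t k • b k)) (Icc 0 T) t := by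
  have := FiniteDimensional.span_of_finite ℝ hS
  obtain ⟨n, b, c, h1, h2, -, h3, h4, h5⟩ :=
    exists_galerkin_solution hJ hA hdiss (Submodule.span ℝ S) (Submodule.subset_span hu₀) hT
  exact ⟨n, b, c, h1, h2, h3, fun w hw => h4 w (Submodule.subset_span hw), h5⟩

end Finite

section Galerkin

variable (c : Constants)

/-- The total jet norm of a test state. -/
def stateNorm (Φ : State) : ℝ := ∑ i, jetNorm (State.comp i Φ)

theorem jetNorm_le_stateNorm (i : Fin 4) (Φ : State) : jetNorm (State.comp i Φ) ≤ stateNorm Φ :=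
  Finset.single_le_sum (f := fun i => jetNorm (State.comp i Φ)) (fun _ _ => jetNorm_nonneg _)
    (Finset.mem_univ i)

theorem stateNorm_nonneg (Φ : State) : 0 ≤ stateNorm Φ :=
  Finset.sum_nonneg fun _ _ => jetNorm_nonneg _

theorem exists_abs_systemForm_le (C : ℝ) : ∃ K, 0 ≤ K ∧ ∀ Y : L2x4, ‖Y‖ ≤ C → ∀ Φ,
    |systemForm c Y Φ| ≤ K * stateNorm Φ := by
  let A : ℝ := ∑ i, ‖phys c i‖ * |C|
  have hA0 : 0 ≤ A := by positivity
  have hA : ∀ Y : L2x4, ‖Y‖ ≤ C → ∀ i, ‖phys c i Y‖ ≤ A := fun Y hY i =>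
    ((phys c i).le_opNorm Y).trans ((mul_le_mul_of_nonneg_left (hY.trans (le_abs_self C))
      (norm_nonneg _)).trans (Finset.single_le_sum (f := fun i => ‖phys c i‖ * |C|)
        (fun _ _ => by positivity) (Finset.mem_univ i)))
  -- A common bound for the fields, the friction and the current.
  let D : ℝ := A + c.α * (A + A) + c.n * c.e / c.ε₀ * (c.Z * A + A)
  have hα := c.α_pos
  have hn := c.n_pos
  have he := c.e_pos
  have hε := c.ε₀_pos
  have hμ := c.μ₀_pos
  have hZ := c.Z_pos
  have d2 : 0 ≤ c.α * (A + A) := by positivity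
  have d3 : 0 ≤ c.n * c.e / c.ε₀ * (c.Z * A + A) := by positivity
  have hAD : A ≤ D := by simp only [D]; linarith
  have hF : ∀ Y : L2x4, ‖Y‖ ≤ C → ‖-c.α • (phys c 1 Y - phys c 0 Y)‖ ≤ D := by
    intro Y hY
    rw [norm_smul, norm_neg, Real.norm_of_nonneg hα.le]
    calc _ ≤ c.α * (A + A) := by
          gcongr
          exact (norm_sub_le _ _).trans (add_le_add (hA Y hY 1) (hA Y hY 0))
      _ ≤ D := by simp only [D]; linarith
  have hJ : ∀ Y : L2x4, ‖Y‖ ≤ C →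
      ‖-(c.n * c.e / c.ε₀) • (c.Z • phys c 1 Y - phys c 0 Y)‖ ≤ D := by
    intro Y hY
    rw [norm_smul, norm_neg, Real.norm_of_nonneg (by positivity)]
    calc _ ≤ c.n * c.e / c.ε₀ * (c.Z * A + A) := by
          gcongr
          refine (norm_sub_le _ _).trans (add_le_add ?_ (hA Y hY 0))
          rw [norm_smul, Real.norm_of_nonneg hZ.le]
          exact mul_le_mul_of_nonneg_left (hA Y hY 1) hZ.le
      _ ≤ D := by simp only [D]; linarith
  obtain ⟨K₁, h1, b1⟩ := exists_abs_momentumForm_le c.n c.mMinus c.νMinus (-c.e) D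
  obtain ⟨K₂, h2, b2⟩ := exists_abs_momentumForm_le c.n c.mPlus c.νPlus (c.e * c.Z) D
  obtain ⟨K₃, h3, b3⟩ := exists_abs_maxwellForm_le (1 / (c.ε₀ * c.μ₀)) D
  obtain ⟨K₄, h4, b4⟩ := exists_abs_maxwellForm_le (-1) D
  refine ⟨1 / c.ε₀ * K₁ + 1 / c.ε₀ * K₂ + K₃ + 1 / (c.ε₀ * c.μ₀) * K₄, by positivity,
    fun Y hY Φ => ?_⟩
  have hp := fun i => (hA Y hY i).trans hAD
  have hle : ∀ {x K : ℝ} (i : Fin 4), 0 ≤ K → |x| ≤ K * jetNorm (State.comp i Φ) →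
      |x| ≤ K * stateNorm Φ := fun i hK hx =>
    hx.trans (mul_le_mul_of_nonneg_left (jetNorm_le_stateNorm i Φ) hK)
  have e1 := hle 0 h1 (b1 _ _ _ _ (hp 0) (hp 2) (hp 3)
    ((norm_neg (-c.α • (phys c 1 Y - phys c 0 Y))).trans_le (hF Y hY)) (State.comp 0 Φ))
  have e2 := hle 1 h2 (b2 _ _ _ _ (hp 1) (hp 2) (hp 3) (hF Y hY) (State.comp 1 Φ))
  have e3 := hle 2 h3 (b3 _ _ (hp 3) (hJ Y hY) (State.comp 2 Φ))
  have e4 := hle 3 h4 (b4 (phys c 2 Y) 0 (hp 2) (by rw [norm_zero]; linarith) (State.comp 3 Φ))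
  rw [systemForm_apply]
  refine (abs_add_le _ _).trans ((add_le_add ((abs_add_le _ _).trans (add_le_add
    ((abs_add_le _ _).trans (add_le_add (abs_mul _ _).le (abs_mul _ _).le)) e3))
    (abs_mul _ _).le).trans ?_)
  rw [abs_of_pos (show 0 < 1 / c.ε₀ by positivity),
    abs_of_pos (show 0 < 1 / (c.ε₀ * c.μ₀) by positivity)]
  calc _ ≤ 1 / c.ε₀ * (K₁ * stateNorm Φ) + 1 / c.ε₀ * (K₂ * stateNorm Φ) + K₃ * stateNorm Φ +
        1 / (c.ε₀ * c.μ₀) * (K₄ * stateNorm Φ) := by gcongr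
    _ = _ := by ring

theorem exists_norm_embed_le : ∃ K, 0 ≤ K ∧ ∀ Φ : State, ‖embed c Φ‖ ≤ K * stateNorm Φ := by
  -- The sum `W` of the weights satisfies `W ≤ (W + 1)²`, which spares a square root.
  refine ⟨∑ i, weight c i + 1,
    add_nonneg (Finset.sum_nonneg fun i _ => (weight_pos c i).le) zero_le_one, fun Φ => ?_⟩
  have hs := stateNorm_nonneg Φ
  have hw : 0 ≤ ∑ i, weight c i := Finset.sum_nonneg fun i _ => (weight_pos c i).le
  refine abs_le_of_sq_le_sq' ?_ (by positivity) |>.2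
  rw [norm_sq_eq_sum_phys c]
  calc _ ≤ ∑ i, weight c i * stateNorm Φ ^ 2 := by
        gcongr with i
        · exact (weight_pos c i).le
        · rw [phys_embed]
          exact (norm_toL2_le_jetNorm _).trans (jetNorm_le_stateNorm i Φ)
    _ = (∑ i, weight c i) * stateNorm Φ ^ 2 := by rw [Finset.sum_mul]
    _ ≤ (∑ i, weight c i + 1) ^ 2 * stateNorm Φ ^ 2 := by
        gcongr
        nlinarith
    _ = _ := by ring

/-- Galerkin approximations `u N` on `[0, N]`, with initial values that tend to `Y₀` and with
test states `Φ 0, …, Φ N`. -/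
structure IsGalerkin (Y₀ : L2x4) (Φ : ℕ → State) (u : ℕ → ℝ → State) : Prop where
  continuous_apply : ∀ N {G : Type} [NormedAddCommGroup G] [NormedSpace ℝ G] (L : State →ₗ[ℝ] G),
    Continuous fun t => L (u N t)
  norm_le : ∀ N t, ‖embed c (u N t)‖ ≤ ‖Y₀‖ + 1
  tendsto_initial : Tendsto (fun N => embed c (u N 0)) atTop (𝓝 Y₀)
  identity : ∀ N k : ℕ, k ≤ N → ∀ t ∈ Icc (0 : ℝ) N,
    inner ℝ (embed c (u N t)) (embed c (Φ k)) =
      inner ℝ (embed c (u N 0)) (embed c (Φ k))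
        + ∫ τ in 0..t, systemForm c (embed c (u N τ)) (Φ k)
  energy : ∀ (N : ℕ), ∀ t ∈ Icc (0 : ℝ) N,
    1 / 2 * ‖embed c (u N t)‖ ^ 2 + ∫ τ in 0..t, dissipation c (u N τ) =
      1 / 2 * ‖embed c (u N 0)‖ ^ 2
  -- The horizon is `T N ≥ N` rather than `N` itself, a form that is stable under passing to a
  -- subsequence.
  clamped : ∃ T : ℕ → ℝ, ∀ N : ℕ, (N : ℝ) ≤ T N ∧ ∀ t, u N t = u N (max 0 (min (T N) t))
  lipschitz : ∀ k, ∃ L : ℝ, ∀ N ≥ k, ∀ s t,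
      |inner ℝ (embed c (u N s)) (embed c (Φ k)) - inner ℝ (embed c (u N t)) (embed c (Φ k))| ≤
        L * |s - t|

theorem IsGalerkin.continuous_dissipation {Y₀ : L2x4} {Φ : ℕ → State} {u : ℕ → ℝ → State}
    (h : IsGalerkin c Y₀ Φ u) (N : ℕ) : Continuous fun t => dissipation c (u N t) := by
  have h0 := fun i => h.continuous_apply N (toL2 ∘ₗ State.comp i)
  have h1 := fun i j => h.continuous_apply N (toL2 ∘ₗ pdT i ∘ₗ State.comp j)
  exact ((continuous_const.mul (continuous_finsetSum _ fun i _ => (h1 i 0).norm.pow 2)).add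
    (continuous_const.mul (continuous_finsetSum _ fun i _ => (h1 i 1).norm.pow 2))).add
    (continuous_const.mul (((h0 0).sub (h0 1)).norm.pow 2))

/-- The `N`-th space is spanned by `Φ 0, …, Φ N` and by a state `d N` within `1/(N+1)` of `Y₀`.
Including `d N` makes it an exact initial value; `N` is also the time horizon, so every bounded time
interval is eventually covered. -/
theorem exists_isGalerkin {Y₀ : L2x4}
    (hY₀ : Y₀ ∈ (LinearMap.range (embed c)).topologicalClosure) (Φ : ℕ → State) :
    ∃ u, IsGalerkin c Y₀ Φ u := by
  have hd : ∀ N : ℕ, ∃ d : State, ‖embed c d - Y₀‖ < 1 / ((N : ℝ) + 1) := by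
    intro N
    obtain ⟨_, ⟨d, rfl⟩, hd⟩ := Metric.mem_closure_iff.1 hY₀ (1 / ((N : ℝ) + 1)) (by positivity)
    exact ⟨d, by rwa [dist_comm, dist_eq_norm] at hd⟩
  choose d hd using hd
  have hex := fun N : ℕ => exists_galerkin_solution_of_finite (embed_injective c)
    (contDiff_systemForm c)
    (fun w => (systemForm_self c w).trans_le (neg_nonpos.2 (dissipation_nonneg c w)))
    (((finite_Iic N).image Φ).insert (d N)) (mem_insert _ _) (Nat.cast_nonneg N)
  choose n b a hac ha0 hacl hader haen using hex
  let u : ℕ → ℝ → State := fun N t => ∑ k, a N t k • b N k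
  have hu0 : ∀ N, u N 0 = d N := ha0
  have hcont : ∀ N {G : Type} [NormedAddCommGroup G] [NormedSpace ℝ G] (L : State →ₗ[ℝ] G),
      Continuous fun t => L (u N t) := by
    intro N G _ _ L
    simp only [u, map_sum, map_smul]
    exact continuous_finsetSum _ fun k _ =>
      ((continuous_apply k).comp (hac N)).smul continuous_const
  have hsc : ∀ N Ψ, Continuous fun t => systemForm c (embed c (u N t)) Ψ := fun N Ψ =>
    (contDiff_systemForm c Ψ).continuous.comp (hcont N (embed c))
  have hdc : ∀ N, Continuous fun t => dissipation c (u N t) := by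
    intro N
    have h0 := fun i => hcont N (toL2 ∘ₗ State.comp i)
    have h1 := fun i j => hcont N (toL2 ∘ₗ pdT i ∘ₗ State.comp j)
    exact ((continuous_const.mul (continuous_finsetSum _ fun i _ => (h1 i 0).norm.pow 2)).add
      (continuous_const.mul (continuous_finsetSum _ fun i _ => (h1 i 1).norm.pow 2))).add
      (continuous_const.mul (((h0 0).sub (h0 1)).norm.pow 2))
  have hftc : ∀ {f f' : ℝ → ℝ} {T : ℝ}, Continuous f' →
      (∀ t ∈ Icc 0 T, HasDerivWithinAt f (f' t) (Icc 0 T) t) →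
      ∀ s ∈ Icc 0 T, ∀ t ∈ Icc 0 T, s ≤ t → f t - f s = ∫ τ in s..t, f' τ := by
    intro f f' T hf' hf s hs t ht hst
    refine (intervalIntegral.integral_eq_sub_of_hasDeriv_right_of_le hst ?_ ?_
      (hf'.intervalIntegrable _ _)).symm
    · exact fun x hx => ((hf x ⟨hs.1.trans hx.1, hx.2.trans ht.2⟩).continuousWithinAt).mono
        (Icc_subset_Icc hs.1 ht.2)
    · intro x hx
      refine ((hf x ⟨hs.1.trans hx.1.le, hx.2.le.trans ht.2⟩).hasDerivAt
        (Icc_mem_nhds (hs.1.trans_lt hx.1) (hx.2.trans_le ht.2))).hasDerivWithinAt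
  have hen : ∀ (N : ℕ), ∀ t ∈ Icc (0 : ℝ) N,
      1 / 2 * ‖embed c (u N t)‖ ^ 2 + ∫ τ in 0..t, dissipation c (u N τ) =
        1 / 2 * ‖embed c (u N 0)‖ ^ 2 := by
    intro N t ht
    have h1 := hftc ((hdc N).const_mul (-2)) (fun t ht => (haen N t ht).congr_deriv (by
      rw [systemForm_self]
      ring)) 0 ⟨le_rfl, Nat.cast_nonneg N⟩ t ht ht.1
    rw [intervalIntegral.integral_const_mul] at h1
    change ‖embed c (u N t)‖ ^ 2 - ‖embed c (u N 0)‖ ^ 2 =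
      -2 * ∫ τ in 0..t, dissipation c (u N τ) at h1
    linarith
  have hle0 : ∀ N : ℕ, ‖embed c (u N 0)‖ ≤ ‖Y₀‖ + 1 := by
    intro N
    rw [hu0]
    have h1 : 1 / ((N : ℝ) + 1) ≤ 1 := by
      rw [div_le_one (by positivity)]
      linarith [(Nat.cast_nonneg N : (0 : ℝ) ≤ N)]
    have h2 := norm_sub_norm_le (embed c (d N)) Y₀
    linarith [hd N]
  have hclm : ∀ (N : ℕ) (t : ℝ), max 0 (min (N : ℝ) t) ∈ Icc (0 : ℝ) N := fun N t =>
    ⟨le_max_left _ _, max_le (Nat.cast_nonneg N) (min_le_left _ _)⟩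
  have hclu : ∀ (N : ℕ) t, u N t = u N (max 0 (min (N : ℝ) t)) := by
    intro N t
    simp only [u]
    rw [hacl N t]
  have hle : ∀ N t, ‖embed c (u N t)‖ ≤ ‖Y₀‖ + 1 := by
    intro N t
    rw [hclu]
    refine le_trans ?_ (hle0 N)
    have h1 := hen N _ (hclm N t)
    have h2 : 0 ≤ ∫ τ in 0..max 0 (min (N : ℝ) t), dissipation c (u N τ) :=
      intervalIntegral.integral_nonneg (hclm N t).1 fun _ _ => dissipation_nonneg c _
    exact le_of_sq_le_sq (by linarith) (norm_nonneg _)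
  have hid : ∀ N k : ℕ, k ≤ N → ∀ s ∈ Icc (0 : ℝ) N, ∀ t ∈ Icc (0 : ℝ) N, s ≤ t →
      inner ℝ (embed c (u N t)) (embed c (Φ k)) - inner ℝ (embed c (u N s)) (embed c (Φ k)) =
        ∫ τ in s..t, systemForm c (embed c (u N τ)) (Φ k) := fun N k hk =>
    hftc (hsc N (Φ k)) (hader N (Φ k) (mem_insert_of_mem _ ⟨k, hk, rfl⟩))
  refine ⟨u, hcont, hle, ?_, ?_, hen, ⟨fun N => N, fun N => ⟨le_rfl, hclu N⟩⟩, ?_⟩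
  · rw [tendsto_iff_norm_sub_tendsto_zero]
    refine squeeze_zero (fun _ => norm_nonneg _) (fun N => ?_)
      tendsto_one_div_add_atTop_nhds_zero_nat
    rw [hu0]
    exact (hd N).le
  · intro N k hk t ht
    linarith [hid N k hk 0 ⟨le_rfl, Nat.cast_nonneg N⟩ t ht ht.1]
  · intro k
    obtain ⟨K, hK0, hK⟩ := exists_abs_systemForm_le c (‖Y₀‖ + 1)
    have key : ∀ N ≥ k, ∀ s ∈ Icc (0 : ℝ) N, ∀ t ∈ Icc (0 : ℝ) N, s ≤ t →
        |inner ℝ (embed c (u N t)) (embed c (Φ k)) - inner ℝ (embed c (u N s)) (embed c (Φ k))|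
          ≤ K * stateNorm (Φ k) * |t - s| := by
      intro N hN s hs t ht hst
      rw [hid N k hN s hs t ht hst, ← Real.norm_eq_abs]
      exact intervalIntegral.norm_integral_le_of_norm_le_const fun x _ => hK _ (hle N x) _
    refine ⟨K * stateNorm (Φ k), fun N hN s t => ?_⟩
    rw [hclu N s, hclu N t]
    -- Clamping to `[0, N]` is a contraction, so the Lipschitz bound on `[0, N]` holds for all real
    -- times.
    have hcl : |max 0 (min (N : ℝ) s) - max 0 (min (N : ℝ) t)| ≤ |s - t| := by
      rw [max_comm 0 (min (N : ℝ) s), max_comm 0 (min (N : ℝ) t), min_comm (N : ℝ) s,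
        min_comm (N : ℝ) t]
      refine (abs_max_sub_max_le_max _ _ _ _).trans (max_le ?_ (by simp))
      exact (abs_min_sub_min_le_max _ _ _ _).trans (max_le le_rfl (by simp))
    refine le_trans ?_ (mul_le_mul_of_nonneg_left hcl (mul_nonneg hK0 (stateNorm_nonneg _)))
    rcases le_total (max 0 (min (N : ℝ) s)) (max 0 (min (N : ℝ) t)) with h | h
    · rw [abs_sub_comm, abs_sub_comm (max 0 (min (N : ℝ) s))]
      exact key N hN _ (hclm N s) _ (hclm N t) h
    · exact key N hN _ (hclm N t) _ (hclm N s) h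

theorem IsGalerkin.subseq {Y₀ : L2x4} {Φ : ℕ → State} {u : ℕ → ℝ → State}
    (h : IsGalerkin c Y₀ Φ u) {φ : ℕ → ℕ} (hφ : StrictMono φ) :
    IsGalerkin c Y₀ Φ fun N => u (φ N) := by
  have hle := hφ.id_le
  have hI : ∀ {N : ℕ} {t : ℝ}, t ∈ Icc (0 : ℝ) N → t ∈ Icc (0 : ℝ) (φ N) := fun {N t} ht =>
    ⟨ht.1, ht.2.trans (Nat.cast_le.2 (hle N))⟩
  obtain ⟨T, hT⟩ := h.clamped
  refine ⟨fun N => h.continuous_apply (φ N), fun N => h.norm_le (φ N),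
    h.tendsto_initial.comp hφ.tendsto_atTop,
    fun N k hk t ht => h.identity (φ N) k (hk.trans (hle N)) t (hI ht),
    fun N t ht => h.energy (φ N) t (hI ht),
    ⟨T ∘ φ, fun N => ⟨(Nat.cast_le.2 (hle N)).trans (hT (φ N)).1, (hT (φ N)).2⟩⟩, fun k => ?_⟩
  obtain ⟨L, hL⟩ := h.lipschitz k
  exact ⟨L, fun N hN => hL _ (hN.trans (hle N))⟩

end Galerkin

/-! ### The limit of the approximations and its integrated equations. -/

section Limit

variable (c : Constants)

/-- Density of a sequence of test states for the jet norms. -/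
def IsDenseSeq (Φ : ℕ → State) : Prop :=
  ∀ Ψ : State, ∀ ε > 0, ∃ k, stateNorm (Ψ - Φ k) < ε

theorem exists_isDenseSeq : ∃ Φ, IsDenseSeq Φ := by
  obtain ⟨Φ, hΦ⟩ := exists_dense_seq_states
  refine ⟨Φ, fun Ψ ε hε => ?_⟩
  obtain ⟨k, hk⟩ := hΦ Ψ (ε / 4) (by positivity)
  refine ⟨k, ?_⟩
  have h0 := hk 0
  have h1 := hk 1
  have h2 := hk 2
  have h3 := hk 3
  rw [stateNorm, Fin.sum_univ_four]
  linarith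

/-- The extraction takes place in the closure of the embedded test states, where the `Φ k` are dense
because the embedding is bounded for `stateNorm`. -/
theorem exists_weak_limit {Y₀ : L2x4}
    (hY₀ : Y₀ ∈ (LinearMap.range (embed c)).topologicalClosure) {Φ : ℕ → State}
    (hΦ : IsDenseSeq Φ) :
    ∃ (u : ℕ → ℝ → State) (Y : ℝ → L2x4), IsGalerkin c Y₀ Φ u ∧
      ∀ t y, Tendsto (fun N => inner ℝ (embed c (u N t)) y) atTop (𝓝 (inner ℝ (Y t) y)) := by
  obtain ⟨u, hu⟩ := exists_isGalerkin c hY₀ Φ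
  obtain ⟨K, hK0, hK⟩ := exists_norm_embed_le c
  have hcl : IsClosed ((LinearMap.range (embed c)).topologicalClosure : Set L2x4) :=
    Submodule.isClosed_topologicalClosure _
  have : CompleteSpace (LinearMap.range (embed c)).topologicalClosure := hcl.completeSpace_coe
  obtain ⟨φ, hφ, Y, hY⟩ := exists_subseq_weak_limit
    (LinearMap.range (embed c)).topologicalClosure (d := fun k => embed c (Φ k))
    (u := fun N t => embed c (u N t)) (C := ‖Y₀‖ + 1) (by
      intro y hy ε hε
      obtain ⟨_, ⟨Ψ, rfl⟩, hΨ⟩ := Metric.mem_closure_iff.1 hy (ε / 2) (by positivity)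
      obtain ⟨k, hk⟩ := hΦ Ψ (ε / (2 * (K + 1))) (by positivity)
      refine ⟨k, ?_⟩
      have h1 : ‖embed c Ψ - embed c (Φ k)‖ < ε / 2 := by
        rw [← map_sub]
        calc _ ≤ K * stateNorm (Ψ - Φ k) := hK _
          _ ≤ (K + 1) * stateNorm (Ψ - Φ k) := by gcongr; exacts [stateNorm_nonneg _, by linarith]
          _ < (K + 1) * (ε / (2 * (K + 1))) := by gcongr
          _ = ε / 2 := by field_simp
      rw [dist_eq_norm] at hΨ
      calc ‖y - embed c (Φ k)‖ = ‖(y - embed c Ψ) + (embed c Ψ - embed c (Φ k))‖ := by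
            congr 1; abel
        _ ≤ _ := norm_add_le _ _
        _ < ε := by linarith)
    (fun N t => Submodule.le_topologicalClosure _ ⟨_, rfl⟩) hu.norm_le
    (fun k => (hu.lipschitz k).imp fun L hL => ⟨k, hL⟩)
  exact ⟨fun N => u (φ N), Y, hu.subseq c hφ, hY⟩

theorem tendsto_clm_of_weak {ι : Type*} {l : Filter ι} {H : Type*} [NormedAddCommGroup H]
    [InnerProductSpace ℝ H] [CompleteSpace H] {x : ι → H} {x₀ : H}
    (h : ∀ y, Tendsto (fun N => inner ℝ (x N) y) l (𝓝 (inner ℝ x₀ y))) (f : H →L[ℝ] ℝ) :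
    Tendsto (fun N => f (x N)) l (𝓝 (f x₀)) := by
  have := h ((InnerProductSpace.toDual ℝ H).symm f)
  have e : ∀ y, inner ℝ y ((InnerProductSpace.toDual ℝ H).symm f) = f y := fun y => by
    rw [real_inner_comm, InnerProductSpace.toDual_symm_apply]
  simpa only [e] using this

theorem phys_weak {ι : Type*} {l : Filter ι} {x : ι → L2x4} {x₀ : L2x4}
    (h : ∀ y, Tendsto (fun N => inner ℝ (x N) y) l (𝓝 (inner ℝ x₀ y))) (i : Fin 4) (y : L2) :
    Tendsto (fun N => inner ℝ (phys c i (x N)) y) l (𝓝 (inner ℝ (phys c i x₀) y)) := by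
  have := tendsto_clm_of_weak h ((innerSL ℝ y).comp (phys c i))
  simpa only [ContinuousLinearMap.comp_apply, innerSL_apply_apply, real_inner_comm] using this

variable {c} {Y₀ : L2x4} {Φ : ℕ → State} {u : ℕ → ℝ → State} {Y : ℝ → L2x4}

theorem IsGalerkin.norm_limit_le (h : IsGalerkin c Y₀ Φ u)
    (hY : ∀ t y, Tendsto (fun N => inner ℝ (embed c (u N t)) y) atTop (𝓝 (inner ℝ (Y t) y)))
    (t : ℝ) : ‖Y t‖ ≤ ‖Y₀‖ + 1 :=
  norm_le_of_weak (fun N => h.norm_le N t) (hY t)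

theorem IsGalerkin.stronglyMeasurable_limit (h : IsGalerkin c Y₀ Φ u)
    (hY : ∀ t y, Tendsto (fun N => inner ℝ (embed c (u N t)) y) atTop (𝓝 (inner ℝ (Y t) y))) :
    StronglyMeasurable Y :=
  stronglyMeasurable_of_inner dense_univ fun y _ => measurable_of_tendsto_metrizable
    (fun N => ((h.continuous_apply N (embed c)).inner continuous_const).measurable)
    (tendsto_pi_nhds.2 fun t => hY t y)

theorem IsGalerkin.limit_zero (h : IsGalerkin c Y₀ Φ u)
    (hY : ∀ t y, Tendsto (fun N => inner ℝ (embed c (u N t)) y) atTop (𝓝 (inner ℝ (Y t) y))) :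
    Y 0 = Y₀ :=
  ext_inner_right ℝ fun y => tendsto_nhds_unique (hY 0 y)
    (h.tendsto_initial.inner tendsto_const_nhds)

theorem intervalIntegrable_of_norm_le {G : Type*} [NormedAddCommGroup G] {f : ℝ → G}
    (hf : StronglyMeasurable f) {C : ℝ} (hC : ∀ t, ‖f t‖ ≤ C) (a b : ℝ) :
    IntervalIntegrable f volume a b :=
  (intervalIntegrable_const (c := C)).mono_fun hf.aestronglyMeasurable
    (Eventually.of_forall fun t => (hC t).trans (le_abs_self C))

theorem continuous_systemForm (Ψ : State) : Continuous fun Y => systemForm c Y Ψ :=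
  (contDiff_systemForm c Ψ).continuous

/-- The linear part and the quadratic part of the weak form. -/
theorem exists_systemForm_eq (Ψ : State) : ∃ (f : L2x4 →L[ℝ] ℝ), ∀ Y, systemForm c Y Ψ = f Y
    + (1 / c.ε₀ * (c.n * c.mMinus)) * inner ℝ (actL (jacobian (State.comp 0 Ψ)) (phys c 0 Y))
        (phys c 0 Y)
    + (1 / c.ε₀ * (-c.e * c.n)) * inner ℝ (actL (crossMatrix (State.comp 0 Ψ)) (phys c 0 Y))
        (phys c 3 Y)
    + (1 / c.ε₀ * (c.n * c.mPlus)) * inner ℝ (actL (jacobian (State.comp 1 Ψ)) (phys c 1 Y))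
        (phys c 1 Y)
    + (1 / c.ε₀ * (c.e * c.Z * c.n)) * inner ℝ (actL (crossMatrix (State.comp 1 Ψ)) (phys c 1 Y))
        (phys c 3 Y) := by
  let g : Fin 4 → L2 → L2x4 →L[ℝ] ℝ := fun i y => (innerSL ℝ y).comp (phys c i)
  have hg : ∀ i y Y, g i y Y = inner ℝ (phys c i Y) y := fun i y Y => by
    change inner ℝ y (phys c i Y) = _
    exact real_inner_comm _ _
  let a := fun i => toL2 (State.comp i Ψ)
  refine ⟨(1 / c.ε₀) • (c.νMinus • g 0 (toL2 (lapT (State.comp 0 Ψ))) + (-c.e * c.n) • g 2 (a 0)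
      + c.α • (g 1 (a 0) - g 0 (a 0)))
    + (1 / c.ε₀) • (c.νPlus • g 1 (toL2 (lapT (State.comp 1 Ψ))) + (c.e * c.Z * c.n) • g 2 (a 1)
      - c.α • (g 1 (a 1) - g 0 (a 1)))
    + ((1 / (c.ε₀ * c.μ₀)) • g 3 (toL2 (curlT (State.comp 2 Ψ)))
      - (c.n * c.e / c.ε₀) • (c.Z • g 1 (a 2) - g 0 (a 2)))
    + (1 / (c.ε₀ * c.μ₀)) • (-1 : ℝ) • g 2 (toL2 (curlT (State.comp 3 Ψ))), fun Y => ?_⟩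
  simp only [systemForm_apply, momentumForm_apply, maxwellForm_apply,
    add_apply, sub_apply, smul_apply,
    hg, smul_eq_mul, inner_neg_left, inner_smul_left, inner_sub_left, inner_zero_left,
    conj_trivial, a]
  rw [real_inner_comm (phys c 0 Y) (actL (jacobian _) _),
    real_inner_comm (phys c 1 Y) (actL (jacobian _) _),
    real_inner_comm (phys c 3 Y) (actL (crossMatrix (State.comp 0 Ψ)) _),
    real_inner_comm (phys c 3 Y) (actL (crossMatrix (State.comp 1 Ψ)) _)]
  ring

theorem IsGalerkin.integral_dissipation_le (h : IsGalerkin c Y₀ Φ u) {T : ℝ} (hT : 0 ≤ T) {N : ℕ}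
    (hN : T ≤ N) : ∫ t in 0..T, dissipation c (u N t) ≤ 1 / 2 * (‖Y₀‖ + 1) ^ 2 := by
  have h1 := h.energy N T ⟨hT, hN⟩
  have h2 : ‖embed c (u N 0)‖ ^ 2 ≤ (‖Y₀‖ + 1) ^ 2 := by gcongr; exact h.norm_le N 0
  nlinarith [sq_nonneg ‖embed c (u N T)‖]

/-- The energy balance bounds the total dissipation; the constant depends on neither `N` nor `T`.
This is the only source of compactness. -/
theorem IsGalerkin.integral_gradient_le (h : IsGalerkin c Y₀ Φ u) : ∃ C, ∀ T : ℝ, 0 ≤ T → ∀ N : ℕ,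
    T ≤ N → (∫ t in 0..T, ∑ i, ‖toL2 (pdT i (State.comp 0 (u N t)))‖ ^ 2 ≤ C) ∧
      ∫ t in 0..T, ∑ i, ‖toL2 (pdT i (State.comp 1 (u N t)))‖ ^ 2 ≤ C := by
  have hε := c.ε₀_pos
  have hm := c.νMinus_pos
  have hp := c.νPlus_pos
  have hα := c.α_pos
  let D := 1 / 2 * (‖Y₀‖ + 1) ^ 2
  have hD : 0 ≤ D := by positivity
  refine ⟨(c.ε₀ / c.νMinus + c.ε₀ / c.νPlus) * D, fun T hT N hN => ?_⟩
  have hle := h.integral_dissipation_le hT hN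
  have hint := (h.continuous_dissipation c N).intervalIntegrable (μ := volume) 0 T
  have hc := fun j => continuous_finsetSum (Finset.univ : Finset (Fin 3)) fun i _ =>
    ((h.continuous_apply N (toL2 ∘ₗ pdT i ∘ₗ State.comp j)).norm.pow 2)
  have key : ∀ (j : Fin 4) (ν : ℝ), 0 < ν →
      (∀ t, ν / c.ε₀ * ∑ i, ‖toL2 (pdT i (State.comp j (u N t)))‖ ^ 2 ≤ dissipation c (u N t)) →
      ∫ t in 0..T, ∑ i, ‖toL2 (pdT i (State.comp j (u N t)))‖ ^ 2 ≤ c.ε₀ / ν * D := by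
    intro j ν hν hj
    have h1 := (intervalIntegral.integral_mono_on hT
      (((hc j).const_mul (ν / c.ε₀)).intervalIntegrable _ _) hint fun t _ => hj t).trans hle
    have h2 : ∫ t in 0..T, ν / c.ε₀ * ∑ i, ‖toL2 (pdT i (State.comp j (u N t)))‖ ^ 2 ≤ D := h1
    rw [intervalIntegral.integral_const_mul] at h2
    calc _ = c.ε₀ / ν * (ν / c.ε₀ *
          ∫ t in 0..T, ∑ i, ‖toL2 (pdT i (State.comp j (u N t)))‖ ^ 2) := by field_simp
      _ ≤ _ := by gcongr
  have b0 := key 0 c.νMinus hm fun t => by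
    unfold dissipation
    rw [add_assoc]
    exact le_add_of_nonneg_right (by positivity)
  have b1 := key 1 c.νPlus hp fun t => by
    unfold dissipation
    rw [add_right_comm]
    exact le_add_of_nonneg_left (by positivity)
  have e0 : 0 ≤ c.ε₀ / c.νMinus * D := by positivity
  have e1 : 0 ≤ c.ε₀ / c.νPlus * D := by positivity
  rw [add_mul]
  exact ⟨by linarith, by linarith⟩

/-- The linear part converges by dominated convergence. In each of the four quadratic terms the
matrix field acts on a velocity, whose gradient is controlled, so the other factor, possibly `B`,
may converge weakly only. -/
theorem IsGalerkin.tendsto_integral_systemForm (h : IsGalerkin c Y₀ Φ u)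
    (hY : ∀ t y, Tendsto (fun N => inner ℝ (embed c (u N t)) y) atTop (𝓝 (inner ℝ (Y t) y)))
    (Ψ : State) {T : ℝ} (hT : 0 ≤ T) :
    Tendsto (fun N => ∫ t in 0..T, systemForm c (embed c (u N t)) Ψ) atTop
      (𝓝 (∫ t in 0..T, systemForm c (Y t) Ψ)) := by
  obtain ⟨f, hf⟩ := exists_systemForm_eq (c := c) Ψ
  obtain ⟨C₁, hC₁⟩ := h.integral_gradient_le
  let A := ‖Y₀‖ + 1
  have hA : 0 ≤ A := by positivity
  have hYm := h.stronglyMeasurable_limit hY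
  have hYn := h.norm_limit_le hY
  let P := ∑ i, ‖phys c i‖ * A
  have hP : ∀ i Z, ‖Z‖ ≤ A → ‖phys c i Z‖ ≤ P := fun i Z hZ => ((phys c i).le_opNorm Z).trans
    ((mul_le_mul_of_nonneg_left hZ (norm_nonneg _)).trans (Finset.single_le_sum
      (f := fun i => ‖phys c i‖ * A) (fun _ _ => by positivity) (Finset.mem_univ i)))
  have hP0 : 0 ≤ P := (norm_nonneg _).trans (hP 0 (Y 0) (hYn 0))
  -- `tendsto_integral_actL` takes one constant for the norms and for the gradient integrals; `C₁`
  -- has no known sign, and this sum dominates both `P` and `C₁`.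
  let C := P + C₁ + |C₁|
  have hPC : P ≤ C := by simp only [C]; linarith [neg_abs_le C₁]
  have hCC : C₁ ≤ C := by simp only [C]; linarith [abs_nonneg C₁]
  have huc := fun N => h.continuous_apply N (embed c)
  have hpw : ∀ i t y, Tendsto (fun N => inner ℝ (toL2 (State.comp i (u N t))) y) atTop
      (𝓝 (inner ℝ (phys c i (Y t)) y)) := by
    intro i t y
    simpa only [phys_embed] using phys_weak c (hY t) i y
  have hpn : ∀ i N t, ‖toL2 (State.comp i (u N t))‖ ≤ C := fun i N t => by
    rw [← phys_embed c]
    exact (hP i _ (h.norm_le N t)).trans hPC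
  have hpc := fun i N => h.continuous_apply N (toL2 ∘ₗ State.comp i)
  have hgc := fun j N i => h.continuous_apply N (toL2 ∘ₗ pdT i ∘ₗ State.comp j)
  have hev : ∀ᶠ N : ℕ in atTop, T ≤ N := by
    obtain ⟨N₀, hN₀⟩ := exists_nat_ge T
    filter_upwards [eventually_ge_atTop N₀] with N hN
    exact hN₀.trans (Nat.cast_le.2 hN)
  have hquad : ∀ (i j : Fin 4) {σ : E3 → E3 →L[ℝ] E3} (hσ : Continuous σ)
      (hσs : HasCompactSupport σ) (hσL : MemLp σ ⊤ (volume : Measure E3)),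
      (∀ᶠ N in atTop, ∫ t in 0..T, ∑ k, ‖toL2 (pdT k (State.comp i (u N t)))‖ ^ 2 ≤ C) →
      Tendsto (fun N => ∫ t in 0..T, inner ℝ (actL (hσL.toLp σ) (phys c i (embed c (u N t))))
        (phys c j (embed c (u N t)))) atTop
        (𝓝 (∫ t in 0..T, inner ℝ (actL (hσL.toLp σ) (phys c i (Y t))) (phys c j (Y t)))) := by
    intro i j σ hσ hσs hσL hg
    simp only [phys_embed]
    exact tendsto_integral_actL hσ hσs hσL hT (hpn i) (hpn j) (hpc i) (hpc j) (hgc i) hg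
      (hpw i) (hpw j)
  have hg0 : ∀ᶠ N in atTop, ∫ t in 0..T, ∑ k, ‖toL2 (pdT k (State.comp 0 (u N t)))‖ ^ 2 ≤ C :=
    hev.mono fun N hN => (hC₁ T hT N hN).1.trans hCC
  have hg1 : ∀ᶠ N in atTop, ∫ t in 0..T, ∑ k, ‖toL2 (pdT k (State.comp 1 (u N t)))‖ ^ 2 ≤ C :=
    hev.mono fun N hN => (hC₁ T hT N hN).2.trans hCC
  have hlin : Tendsto (fun N => ∫ t in 0..T, f (embed c (u N t))) atTop
      (𝓝 (∫ t in 0..T, f (Y t))) := by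
    refine intervalIntegral.tendsto_integral_filter_of_dominated_convergence
      (fun _ => ‖f‖ * A) ?_ ?_ intervalIntegrable_const ?_
    · exact Eventually.of_forall fun N =>
        (f.continuous.comp (huc N)).aestronglyMeasurable
    · exact Eventually.of_forall fun N => Eventually.of_forall fun t _ =>
        (f.le_opNorm _).trans (mul_le_mul_of_nonneg_left (h.norm_le N t) (norm_nonneg f))
    · exact Eventually.of_forall fun t _ => tendsto_clm_of_weak (hY t) f
  have hjac : ∀ i, (∀ᶠ N in atTop,
      ∫ t in 0..T, ∑ k, ‖toL2 (pdT k (State.comp i (u N t)))‖ ^ 2 ≤ C) → ∀ j,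
      Tendsto (fun N => ∫ t in 0..T, inner ℝ (actL (jacobian (State.comp i Ψ))
        (phys c i (embed c (u N t)))) (phys c j (embed c (u N t)))) atTop
        (𝓝 (∫ t in 0..T, inner ℝ (actL (jacobian (State.comp i Ψ)) (phys c i (Y t)))
          (phys c j (Y t)))) := fun i hi j =>
    hquad i j (continuous_fderiv_test _) ((State.comp i Ψ).hasCompactSupport.fderiv ℝ)
      (memLp_fderiv_test (State.comp i Ψ) _) hi
  have hcr : ∀ i, (∀ᶠ N in atTop,
      ∫ t in 0..T, ∑ k, ‖toL2 (pdT k (State.comp i (u N t)))‖ ^ 2 ≤ C) → ∀ j,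
      Tendsto (fun N => ∫ t in 0..T, inner ℝ (actL (crossMatrix (State.comp i Ψ))
        (phys c i (embed c (u N t)))) (phys c j (embed c (u N t)))) atTop
        (𝓝 (∫ t in 0..T, inner ℝ (actL (crossMatrix (State.comp i Ψ)) (phys c i (Y t)))
          (phys c j (Y t)))) := fun i hi j =>
    hquad i j (crossL.continuous.comp (State.comp i Ψ).continuous)
      ((State.comp i Ψ).hasCompactSupport.comp_left (map_zero crossL))
      (memLp_crossL (State.comp i Ψ) _) hi
  have hfun : ∀ Z : ℝ → L2x4, StronglyMeasurable Z → (∀ t, ‖Z t‖ ≤ A) →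
      ∫ t in 0..T, systemForm c (Z t) Ψ = (∫ t in 0..T, f (Z t))
      + (1 / c.ε₀ * (c.n * c.mMinus)) * (∫ t in 0..T,
          inner ℝ (actL (jacobian (State.comp 0 Ψ)) (phys c 0 (Z t))) (phys c 0 (Z t)))
      + (1 / c.ε₀ * (-c.e * c.n)) * (∫ t in 0..T,
          inner ℝ (actL (crossMatrix (State.comp 0 Ψ)) (phys c 0 (Z t))) (phys c 3 (Z t)))
      + (1 / c.ε₀ * (c.n * c.mPlus)) * (∫ t in 0..T,
          inner ℝ (actL (jacobian (State.comp 1 Ψ)) (phys c 1 (Z t))) (phys c 1 (Z t)))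
      + (1 / c.ε₀ * (c.e * c.Z * c.n)) * (∫ t in 0..T,
          inner ℝ (actL (crossMatrix (State.comp 1 Ψ)) (phys c 1 (Z t))) (phys c 3 (Z t))) := by
    intro Z hZ hZA
    have hfi : IntervalIntegrable (fun t => f (Z t)) volume 0 T :=
      intervalIntegrable_of_norm_le (f.continuous.comp_stronglyMeasurable hZ)
        (fun t => (f.le_opNorm _).trans (mul_le_mul_of_nonneg_left (hZA t) (norm_nonneg f))) _ _
    have hqi : ∀ (σ : LTop) (i j : Fin 4), IntervalIntegrable
        (fun t => inner ℝ (actL σ (phys c i (Z t))) (phys c j (Z t))) volume 0 T := by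
      intro σ i j
      refine intervalIntegrable_of_norm_le (C := ‖actL σ‖ * P * P)
        ((((actL σ).comp (phys c i)).continuous.comp_stronglyMeasurable hZ).inner
          ((phys c j).continuous.comp_stronglyMeasurable hZ)) (fun t => ?_) _ _
      refine (norm_inner_le_norm _ _).trans (mul_le_mul (((actL σ).le_opNorm _).trans
        (mul_le_mul_of_nonneg_left (hP i _ (hZA t)) (norm_nonneg _))) (hP j _ (hZA t))
        (norm_nonneg _) (by positivity))
    simp only [hf]
    rw [intervalIntegral.integral_add, intervalIntegral.integral_add,
      intervalIntegral.integral_add, intervalIntegral.integral_add,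
      intervalIntegral.integral_const_mul, intervalIntegral.integral_const_mul,
      intervalIntegral.integral_const_mul, intervalIntegral.integral_const_mul]
    all_goals
      repeat' first
        | exact hfi
        | exact (hqi _ _ _).const_mul _
        | apply IntervalIntegrable.add
  rw [hfun Y hYm hYn]
  refine Tendsto.congr (fun N => (hfun _ (huc N).stronglyMeasurable (h.norm_le N)).symm) ?_
  exact (((hlin.add ((hjac 0 hg0 0).const_mul _)).add ((hcr 0 hg0 3).const_mul _)).add
    ((hjac 1 hg1 1).const_mul _)).add ((hcr 1 hg1 3).const_mul _)

/-- For fixed `k` the Galerkin identity holds for all large `N` and passes to the limit. The defect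
is linear in the test state, bounded for `stateNorm` and zero on a dense sequence. -/
theorem IsGalerkin.limit_identity (h : IsGalerkin c Y₀ Φ u) (hΦ : IsDenseSeq Φ)
    (hY : ∀ t y, Tendsto (fun N => inner ℝ (embed c (u N t)) y) atTop (𝓝 (inner ℝ (Y t) y)))
    (Ψ : State) {t : ℝ} (ht : 0 ≤ t) :
    inner ℝ (Y t) (embed c Ψ) =
      inner ℝ Y₀ (embed c Ψ) + ∫ τ in 0..t, systemForm c (Y τ) Ψ := by
  have hk : ∀ k, inner ℝ (Y t) (embed c (Φ k)) =
      inner ℝ Y₀ (embed c (Φ k)) + ∫ τ in 0..t, systemForm c (Y τ) (Φ k) := by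
    intro k
    refine tendsto_nhds_unique (hY t _) (((h.tendsto_initial.inner tendsto_const_nhds).add
      (h.tendsto_integral_systemForm hY (Φ k) ht)).congr' ?_)
    obtain ⟨N₀, hN₀⟩ := exists_nat_ge t
    filter_upwards [eventually_ge_atTop N₀, eventually_ge_atTop k] with N h1 h2
    exact (h.identity N k h2 t ⟨ht, hN₀.trans (Nat.cast_le.2 h1)⟩).symm
  obtain ⟨K₁, hK₁, b₁⟩ := exists_norm_embed_le c
  obtain ⟨K₂, hK₂, b₂⟩ := exists_abs_systemForm_le c (‖Y₀‖ + 1)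
  have hYm := h.stronglyMeasurable_limit hY
  have hYn := h.norm_limit_le hY
  let D : State → ℝ := fun Ψ => inner ℝ (Y t) (embed c Ψ) - inner ℝ Y₀ (embed c Ψ)
    - ∫ τ in 0..t, systemForm c (Y τ) Ψ
  have hint : ∀ Ψ, IntervalIntegrable (fun τ => systemForm c (Y τ) Ψ) volume 0 t := fun Ψ =>
    intervalIntegrable_of_norm_le ((NSM.continuous_systemForm (c := c) Ψ).comp_stronglyMeasurable hYm)
      (fun τ => b₂ _ (hYn τ) Ψ) _ _
  have hD : ∀ k, D Ψ = D (Ψ - Φ k) := by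
    intro k
    have h0 := hk k
    have e1 : embed c (Ψ - Φ k) = embed c Ψ - embed c (Φ k) :=
      (embed c).map_sub Ψ (Φ k)
    have e2 : ∀ τ, systemForm c (Y τ) (Ψ - Φ k) =
        systemForm c (Y τ) Ψ - systemForm c (Y τ) (Φ k) := fun τ =>
      (systemForm c (Y τ)).map_sub Ψ (Φ k)
    simp only [D, e1, e2, inner_sub_right]
    rw [intervalIntegral.integral_sub (hint _) (hint _)]
    linarith
  let K := (‖Y₀‖ + 1) * K₁ + ‖Y₀‖ * K₁ + K₂ * t
  have hK : 0 ≤ K := by positivity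
  have hDle : ∀ Ψ, |D Ψ| ≤ K * stateNorm Ψ := by
    intro Ψ
    have e1 : |inner ℝ (Y t) (embed c Ψ)| ≤ (‖Y₀‖ + 1) * (K₁ * stateNorm Ψ) :=
      (abs_real_inner_le_norm _ _).trans
        (mul_le_mul (hYn t) (b₁ Ψ) (norm_nonneg _) (by positivity))
    have e2 : |inner ℝ Y₀ (embed c Ψ)| ≤ ‖Y₀‖ * (K₁ * stateNorm Ψ) :=
      (abs_real_inner_le_norm _ _).trans (mul_le_mul_of_nonneg_left (b₁ Ψ) (norm_nonneg _))
    have e3 : |∫ τ in 0..t, systemForm c (Y τ) Ψ| ≤ K₂ * stateNorm Ψ * |t - 0| := by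
      rw [← Real.norm_eq_abs]
      exact intervalIntegral.norm_integral_le_of_norm_le_const fun τ _ => b₂ _ (hYn τ) Ψ
    rw [sub_zero, abs_of_nonneg ht] at e3
    calc |D Ψ| ≤ |inner ℝ (Y t) (embed c Ψ)| + |inner ℝ Y₀ (embed c Ψ)| +
          |∫ τ in 0..t, systemForm c (Y τ) Ψ| :=
          (abs_sub _ _).trans (add_le_add_left (abs_sub _ _) _)
      _ ≤ (‖Y₀‖ + 1) * (K₁ * stateNorm Ψ) + ‖Y₀‖ * (K₁ * stateNorm Ψ)
          + K₂ * stateNorm Ψ * t := by gcongr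
      _ = _ := by ring
  have hzero : D Ψ = 0 := by
    refine abs_eq_zero.1 (le_antisymm (le_of_forall_pos_le_add fun ε hε => ?_) (abs_nonneg _))
    obtain ⟨k, hk⟩ := hΦ Ψ (ε / (K + 1)) (by positivity)
    rw [hD k, zero_add]
    calc _ ≤ K * stateNorm (Ψ - Φ k) := hDle _
      _ ≤ (K + 1) * stateNorm (Ψ - Φ k) := by gcongr; exacts [stateNorm_nonneg _, by linarith]
      _ ≤ (K + 1) * (ε / (K + 1)) := by gcongr
      _ = ε := by field_simp
  simp only [D] at hzero
  linarith

end Limit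

/-! ### The individual equations, weak continuity and divergence constraints. -/

section Components

/-- A test state with a single nonzero component. -/
def State.single (i : Fin 4) (w : Test) (hw : i = 0 ∨ i = 1 → w ∈ solenoidal) : State :=
  ⟨Pi.single i w, by
    constructor
    · by_cases h : i = 0
      · subst h
        rw [Pi.single_eq_same]
        exact hw (Or.inl rfl)
      · rw [Pi.single_eq_of_ne (Ne.symm h)]
        exact zero_mem _
    · by_cases h : i = 1
      · subst h
        rw [Pi.single_eq_same]
        exact hw (Or.inr rfl)
      · rw [Pi.single_eq_of_ne (Ne.symm h)]
        exact zero_mem _⟩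

theorem State.comp_single_same (i : Fin 4) (w : Test) (hw : i = 0 ∨ i = 1 → w ∈ solenoidal) :
    State.comp i (State.single i w hw) = w :=
  Pi.single_eq_same (M := fun _ : Fin 4 => Test) i w

theorem State.comp_single_of_ne {i j : Fin 4} (w : Test)
    (hw : i = 0 ∨ i = 1 → w ∈ solenoidal) (h : j ≠ i) :
    State.comp j (State.single i w hw) = 0 :=
  Pi.single_eq_of_ne (M := fun _ : Fin 4 => Test) h w

variable (c : Constants)

theorem inner_embed_single (Y : L2x4) (i : Fin 4) (w : Test)
    (hw : i = 0 ∨ i = 1 → w ∈ solenoidal) :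
    inner ℝ Y (embed c (State.single i w hw)) = weight c i * inner ℝ (phys c i Y) (toL2 w) := by
  rw [inner_embed, Finset.sum_eq_single i]
  · rw [State.comp_single_same]
  · intro j _ hj
    rw [State.comp_single_of_ne w hw hj, map_zero, inner_zero_right, mul_zero]
  · simp

/-- The fields of a scaled state satisfy the weak form of the system, integrated in time. -/
structure IsIntegrated (Y₀ : L2x4) (Y : ℝ → L2x4) : Prop where
  stronglyMeasurable : StronglyMeasurable Y
  norm_le : ∀ t, ‖Y t‖ ≤ ‖Y₀‖ + 1
  identity : ∀ (Ψ : State) (t : ℝ), 0 ≤ t → inner ℝ (Y t) (embed c Ψ) =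
    inner ℝ Y₀ (embed c Ψ) + ∫ τ in 0..t, systemForm c (Y τ) Ψ

variable {c} {Y₀ : L2x4} {Y : ℝ → L2x4}

theorem IsIntegrated.momentum_minus (h : IsIntegrated c Y₀ Y) {w : Test} (hw : w ∈ solenoidal)
    {t : ℝ} (ht : 0 ≤ t) :
    c.n * c.mMinus * inner ℝ (phys c 0 (Y t)) (toL2 w) =
      c.n * c.mMinus * inner ℝ (phys c 0 Y₀) (toL2 w)
      + ∫ τ in 0..t, momentumForm c.n c.mMinus c.νMinus (-c.e) (phys c 0 (Y τ)) (phys c 2 (Y τ))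
          (phys c 3 (Y τ)) (-(-c.α • (phys c 1 (Y τ) - phys c 0 (Y τ)))) w := by
  have h1 := h.identity (State.single 0 w fun _ => hw) t ht
  simp only [inner_embed_single, systemForm_apply, State.comp_single_same,
    State.comp_single_of_ne w (fun _ => hw) (show (1 : Fin 4) ≠ 0 by decide),
    State.comp_single_of_ne w (fun _ => hw) (show (2 : Fin 4) ≠ 0 by decide),
    State.comp_single_of_ne w (fun _ => hw) (show (3 : Fin 4) ≠ 0 by decide), map_zero,
    mul_zero, add_zero, intervalIntegral.integral_const_mul] at h1
  have hε := c.ε₀_pos.ne'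
  -- Multiplication by `ε₀` turns the energy weight `n m₋/ε₀` back into `n m₋` and removes the
  -- prefactor of the form.
  have h2 := congrArg (c.ε₀ * ·) h1
  simp only [weight, Matrix.cons_val_zero, mul_add] at h2
  field_simp at h2
  linarith

theorem IsIntegrated.momentum_plus (h : IsIntegrated c Y₀ Y) {w : Test} (hw : w ∈ solenoidal)
    {t : ℝ} (ht : 0 ≤ t) :
    c.n * c.mPlus * inner ℝ (phys c 1 (Y t)) (toL2 w) =
      c.n * c.mPlus * inner ℝ (phys c 1 Y₀) (toL2 w)
      + ∫ τ in 0..t, momentumForm c.n c.mPlus c.νPlus (c.e * c.Z) (phys c 1 (Y τ))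
          (phys c 2 (Y τ)) (phys c 3 (Y τ)) (-c.α • (phys c 1 (Y τ) - phys c 0 (Y τ))) w := by
  have h1 := h.identity (State.single 1 w fun _ => hw) t ht
  simp only [inner_embed_single, systemForm_apply, State.comp_single_same,
    State.comp_single_of_ne w (fun _ => hw) (show (0 : Fin 4) ≠ 1 by decide),
    State.comp_single_of_ne w (fun _ => hw) (show (2 : Fin 4) ≠ 1 by decide),
    State.comp_single_of_ne w (fun _ => hw) (show (3 : Fin 4) ≠ 1 by decide), map_zero,
    mul_zero, add_zero, zero_add, intervalIntegral.integral_const_mul] at h1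
  have hε := c.ε₀_pos.ne'
  have h2 := congrArg (c.ε₀ * ·) h1
  simp only [weight, Matrix.cons_val_one, Matrix.cons_val_zero, mul_add] at h2
  field_simp at h2
  linarith

theorem IsIntegrated.ampere (h : IsIntegrated c Y₀ Y) (w : Test) {t : ℝ} (ht : 0 ≤ t) :
    inner ℝ (phys c 2 (Y t)) (toL2 w) = inner ℝ (phys c 2 Y₀) (toL2 w)
      + ∫ τ in 0..t, maxwellForm (1 / (c.ε₀ * c.μ₀)) (phys c 3 (Y τ))
          (-(c.n * c.e / c.ε₀) • (c.Z • phys c 1 (Y τ) - phys c 0 (Y τ))) w := by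
  have hw : (2 : Fin 4) = 0 ∨ (2 : Fin 4) = 1 → w ∈ solenoidal := by
    rintro (h | h) <;> exact absurd h (by decide)
  have h1 := h.identity (State.single 2 w hw) t ht
  simp only [inner_embed_single, systemForm_apply, State.comp_single_same,
    State.comp_single_of_ne w hw (show (0 : Fin 4) ≠ 2 by decide),
    State.comp_single_of_ne w hw (show (1 : Fin 4) ≠ 2 by decide),
    State.comp_single_of_ne w hw (show (3 : Fin 4) ≠ 2 by decide), map_zero,
    mul_zero, add_zero, zero_add] at h1
  simpa [weight] using h1

theorem IsIntegrated.faraday (h : IsIntegrated c Y₀ Y) (w : Test) {t : ℝ} (ht : 0 ≤ t) :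
    inner ℝ (phys c 3 (Y t)) (toL2 w) = inner ℝ (phys c 3 Y₀) (toL2 w)
      + ∫ τ in 0..t, maxwellForm (-1) (phys c 2 (Y τ)) 0 w := by
  have hw : (3 : Fin 4) = 0 ∨ (3 : Fin 4) = 1 → w ∈ solenoidal := by
    rintro (h | h) <;> exact absurd h (by decide)
  have h1 := h.identity (State.single 3 w hw) t ht
  simp only [inner_embed_single, systemForm_apply, State.comp_single_same,
    State.comp_single_of_ne w hw (show (0 : Fin 4) ≠ 3 by decide),
    State.comp_single_of_ne w hw (show (1 : Fin 4) ≠ 3 by decide),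
    State.comp_single_of_ne w hw (show (2 : Fin 4) ≠ 3 by decide), map_zero,
    mul_zero, add_zero, zero_add, intervalIntegral.integral_const_mul] at h1
  have h3 : weight c 3 = 1 / (c.ε₀ * c.μ₀) := rfl
  rw [h3, ← mul_add] at h1
  have := c.ε₀_pos
  have := c.μ₀_pos
  exact mul_left_cancel₀ (by positivity) h1

/-- Against an embedded test state the pairing is a constant plus the primitive of a bounded
function. Since `Y` stays in the closure of these states, `y` may be replaced by its projection;
boundedness of `Y` makes the approximation by test states uniform in time. -/
theorem IsIntegrated.continuousOn_inner (h : IsIntegrated c Y₀ Y)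
    (hcl : ∀ t, Y t ∈ (LinearMap.range (embed c)).topologicalClosure) (y : L2x4) :
    ContinuousOn (fun t => inner ℝ (Y t) y) (Ici 0) := by
  obtain ⟨K, hK0, hK⟩ := exists_abs_systemForm_le c (‖Y₀‖ + 1)
  have h0 : ∀ Ψ, ContinuousOn (fun t => inner ℝ (Y t) (embed c Ψ)) (Ici 0) := by
    intro Ψ
    have hint : ∀ a b, IntervalIntegrable (fun τ => systemForm c (Y τ) Ψ) volume a b :=
      intervalIntegrable_of_norm_le
        ((continuous_systemForm (c := c) Ψ).comp_stronglyMeasurable h.stronglyMeasurable)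
        (fun τ => hK _ (h.norm_le τ) Ψ)
    refine ContinuousOn.congr (f := fun t => inner ℝ Y₀ (embed c Ψ) +
      ∫ τ in 0..t, systemForm c (Y τ) Ψ) ?_ fun t ht => h.identity Ψ t ht
    exact (continuous_const.add (intervalIntegral.continuous_primitive hint 0)).continuousOn
  have hKcl : IsClosed ((LinearMap.range (embed c)).topologicalClosure : Set L2x4) :=
    Submodule.isClosed_topologicalClosure _
  have : CompleteSpace (LinearMap.range (embed c)).topologicalClosure := hKcl.completeSpace_coe
  set K' := (LinearMap.range (embed c)).topologicalClosure with hK'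
  have hproj : ∀ t, inner ℝ (Y t) y = inner ℝ (Y t) (K'.starProjection y) := by
    intro t
    have h1 := K'.starProjection_inner_eq_zero y (Y t) (hcl t)
    rw [inner_sub_left, sub_eq_zero] at h1
    rw [real_inner_comm, h1, real_inner_comm]
  simp only [hproj]
  obtain ⟨s, hs, hs2⟩ := mem_closure_iff_seq_limit.1
    (show K'.starProjection y ∈ closure ((LinearMap.range (embed c)) : Set L2x4) from
      K'.starProjection_apply_mem y)
  refine TendstoUniformlyOn.continuousOn (F := fun n t => inner ℝ (Y t) (s n)) (p := atTop) ?_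
    (Frequently.of_forall fun n => ?_)
  · rw [Metric.tendstoUniformlyOn_iff]
    intro ε hε
    rw [tendsto_iff_norm_sub_tendsto_zero] at hs2
    have hpos : 0 < ‖Y₀‖ + 1 := by positivity
    filter_upwards [hs2.eventually_lt_const (show 0 < ε / (‖Y₀‖ + 1) by positivity)] with n hn t _
    rw [dist_comm, Real.dist_eq, ← inner_sub_right]
    calc _ ≤ ‖Y t‖ * ‖s n - K'.starProjection y‖ := abs_real_inner_le_norm _ _
      _ ≤ (‖Y₀‖ + 1) * ‖s n - K'.starProjection y‖ := by gcongr; exact h.norm_le t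
      _ < (‖Y₀‖ + 1) * (ε / (‖Y₀‖ + 1)) := by gcongr
      _ = ε := by field_simp
  · obtain ⟨Ψ, hΨ⟩ := hs n
    simpa only [← hΨ] using h0 Ψ

theorem IsIntegrated.isWeaklyContinuous (h : IsIntegrated c Y₀ Y)
    (hcl : ∀ t, Y t ∈ (LinearMap.range (embed c)).topologicalClosure) (i : Fin 4) :
    IsWeaklyContinuous fun t => phys c i (Y t) := by
  intro w
  have h1 := h.continuousOn_inner hcl ((ContinuousLinearMap.adjoint (phys c i)) w)
  simpa only [ContinuousLinearMap.adjoint_inner_right] using h1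

/-- Because `curl grad = 0`, gradients only see the source term: the mechanism behind both Gauss
laws. -/
theorem inner_maxwellForm_gradT (k : ℝ) (W J : L2) {ψ : E3 → ℝ} (hψ : ContDiff ℝ ∞ ψ)
    (hs : HasCompactSupport ψ) :
    maxwellForm k W J (gradT ψ hψ hs) = inner ℝ J (toL2 (gradT ψ hψ hs)) := by
  have h1 : curlT (gradT ψ hψ hs) = 0 := by
    refine Subtype.ext (funext fun x => ?_)
    exact curl_gradient hψ x
  rw [maxwellForm_apply, h1, map_zero, inner_zero_right, mul_zero, zero_add]

/-- The current is a combination of two divergence free velocities with constant coefficients, so no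
charge is created. -/
theorem IsIntegrated.gauss_electric (h : IsIntegrated c Y₀ Y)
    (h0 : ∀ t, IsDivFree (phys c 0 (Y t))) (h1 : ∀ t, IsDivFree (phys c 1 (Y t)))
    (hE : IsDivFree (phys c 2 Y₀)) {t : ℝ} (ht : 0 ≤ t) : IsDivFree (phys c 2 (Y t)) := by
  rw [isDivFree_iff] at hE ⊢
  intro ψ hψ hs
  rw [h.ampere _ ht, hE ψ hψ hs, zero_add]
  simp only [inner_maxwellForm_gradT, inner_smul_left, inner_sub_left,
    (isDivFree_iff _).1 (h0 _) ψ hψ hs, (isDivFree_iff _).1 (h1 _) ψ hψ hs, mul_zero, sub_zero,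
    intervalIntegral.integral_zero]

theorem IsIntegrated.gauss_magnetic (h : IsIntegrated c Y₀ Y) (hB : IsDivFree (phys c 3 Y₀))
    {t : ℝ} (ht : 0 ≤ t) : IsDivFree (phys c 3 (Y t)) := by
  rw [isDivFree_iff] at hB ⊢
  intro ψ hψ hs
  rw [h.faraday _ ht, hB ψ hψ hs, zero_add]
  simp only [inner_maxwellForm_gradT, inner_zero_left, intervalIntegral.integral_zero]

variable {Φ : ℕ → State} {u : ℕ → ℝ → State}

theorem IsGalerkin.isIntegrated (h : IsGalerkin c Y₀ Φ u) (hΦ : IsDenseSeq Φ)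
    (hY : ∀ t y, Tendsto (fun N => inner ℝ (embed c (u N t)) y) atTop (𝓝 (inner ℝ (Y t) y))) :
    IsIntegrated c Y₀ Y :=
  ⟨h.stronglyMeasurable_limit hY, h.norm_limit_le hY, fun Ψ _ ht => h.limit_identity hΦ hY Ψ ht⟩

/-- A closed subspace is weakly closed, being its own double orthogonal complement. -/
theorem mem_closure_range_embed_of_weak {x : ℕ → State} {y : L2x4}
    (hY : ∀ z, Tendsto (fun N => inner ℝ (embed c (x N)) z) atTop (𝓝 (inner ℝ y z))) :
    y ∈ (LinearMap.range (embed c)).topologicalClosure := by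
  rw [← Submodule.orthogonal_orthogonal_eq_closure, Submodule.mem_orthogonal']
  intro z hz
  refine tendsto_nhds_unique (hY z) ?_
  simp only [fun N => (Submodule.mem_orthogonal _ z).1 hz (embed c (x N)) ⟨_, rfl⟩]
  exact tendsto_const_nhds

theorem isDivFree_of_weak {x : ℕ → Test} {v : L2} (hx : ∀ N, x N ∈ solenoidal)
    (hv : ∀ z, Tendsto (fun N => inner ℝ (toL2 (x N)) z) atTop (𝓝 (inner ℝ v z))) :
    IsDivFree v := by
  rw [isDivFree_iff]
  intro ψ hψ hs
  refine tendsto_nhds_unique (hv _) ?_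
  simp only [fun N => inner_gradT_of_mem_solenoidal (hx N) ψ hψ hs]
  exact tendsto_const_nhds

/-- Makes the initial data accessible to the Galerkin scheme: velocities are approximated by
solenoidal test fields, `E` and `B` by arbitrary ones. -/
theorem scaled_mem_closure {U : Fin 4 → L2} (h0 : IsDivFree (U 0)) (h1 : IsDivFree (U 1)) :
    scaled c U ∈ (LinearMap.range (embed c)).topologicalClosure := by
  have hx : ∀ i, ∃ x : ℕ → Test, (∀ N, i = 0 ∨ i = 1 → x N ∈ solenoidal) ∧
      Tendsto (fun N => toL2 (x N)) atTop (𝓝 (U i)) := by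
    intro i
    by_cases hi : i = 0 ∨ i = 1
    · have hU : U i ∈ (solenoidal.map toL2).topologicalClosure := by
        rcases hi with rfl | rfl
        exacts [mem_closure_solenoidal h0, mem_closure_solenoidal h1]
      obtain ⟨s, hs, hs2⟩ := mem_closure_iff_seq_limit.1 (show U i ∈ closure
        ((solenoidal.map toL2 : Submodule ℝ L2) : Set L2) from hU)
      choose x hx1 hx2 using hs
      exact ⟨x, fun N _ => hx1 N, by simpa only [hx2] using hs2⟩
    · obtain ⟨s, hs, hs2⟩ := mem_closure_iff_seq_limit.1 (dense_range_toL2 (U i))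
      choose x hx using hs
      exact ⟨x, fun N h => absurd h hi, by simpa only [hx] using hs2⟩
  choose x hx1 hx2 using hx
  refine mem_closure_iff_seq_limit.2 ⟨fun N => embed c ⟨fun i => x i N,
    hx1 0 N (Or.inl rfl), hx1 1 N (Or.inr rfl)⟩, fun N => ⟨_, rfl⟩, ?_⟩
  change Tendsto (fun N => (WithLp.toLp 2 fun i => scale c i • toL2 (x i N) : L2x4)) atTop
    (𝓝 (WithLp.toLp 2 fun i => scale c i • U i))
  refine ((PiLp.continuous_toLp 2 fun _ : Fin 4 => L2).tendsto _).comp ?_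
  exact tendsto_pi_nhds.2 fun i => (hx2 i).const_smul _

end Components

/-! ### Gradients of the limit and the energy inequality. -/

section WeakGradient

theorem isWeakGradient_of_inner {u : L2} {G : GradL2}
    (h : ∀ i w, inner ℝ (G i) (toL2 w) = - inner ℝ u (toL2 (pdT i w))) :
    IsWeakGradient u G := by
  intro i ψ hψ hs
  have hint : ∀ {g : E3 → ℝ}, Continuous g → HasCompactSupport g → ∀ v : L2,
      Integrable fun x => g x • v x := fun hg hgs v =>
    ((Lp.memLp v).locallyIntegrable (by norm_num)).integrable_smul_left_of_hasCompactSupport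
      hg hgs
  refine ext_inner_left ℝ fun a => ?_
  have h1 := h i (Test.ofScalar ψ hψ hs a)
  have h2 : pdT i (Test.ofScalar ψ hψ hs a) =
      Test.ofScalar (pd i ψ) (contDiff_pd i hψ) (hasCompactSupport_pd i hs) a := by
    refine Subtype.ext (funext fun x => ?_)
    exact pd_clm_comp i (ContinuousLinearMap.toSpanSingleton ℝ a) hψ x
  rw [h2, inner_toL2, inner_toL2] at h1
  rw [inner_neg_right, ← integral_inner (hint hψ.continuous hs _),
    ← integral_inner (hint (contDiff_pd i hψ).continuous (hasCompactSupport_pd i hs) _)]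
  have h3 : ∀ (g : E3 → ℝ) hg hgs (v : L2) x,
      inner ℝ (v x) (Test.ofScalar g hg hgs a x) = inner ℝ a (g x • v x) := by
    intro g hg hgs v x
    change inner ℝ (v x) (g x • a) = _
    rw [inner_smul_right, inner_smul_right, real_inner_comm]
  simp only [h3] at h1
  linarith

theorem inner_toL2_pdT (i : Fin 3) (v w : Test) :
    inner ℝ (toL2 (pdT i v)) (toL2 w) = - inner ℝ (toL2 v) (toL2 (pdT i w)) := by
  rw [inner_toL2_toL2, inner_toL2_toL2]
  simp only [pdT_apply]
  rw [integral_inner_pd i v.contDiff w.contDiff (Or.inl v.hasCompactSupport), neg_neg]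

variable (c : Constants)

/-- The dissipation rate of a pair of velocities with given gradients. -/
def dissipationRate (Gm Gp : GradL2) (vm vp : L2) : ℝ :=
  c.νMinus / c.ε₀ * ‖Gm‖ ^ 2 + c.νPlus / c.ε₀ * ‖Gp‖ ^ 2 + c.α / c.ε₀ * ‖vm - vp‖ ^ 2

theorem dissipationRate_nonneg (Gm Gp : GradL2) (vm vp : L2) :
    0 ≤ dissipationRate c Gm Gp vm vp := by
  have := c.νMinus_pos
  have := c.νPlus_pos
  have := c.ε₀_pos
  have := c.α_pos
  unfold dissipationRate
  positivity

/-- The gradients and the relative velocity of a test state, scaled by the dissipation. -/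
def dissipationVector (Φ : State) : PiLp 2 fun _ : Fin 3 ⊕ Fin 3 ⊕ Unit => L2 :=
  WithLp.toLp 2 (Sum.elim (fun i => √(c.νMinus / c.ε₀) • toL2 (pdT i (State.comp 0 Φ)))
    (Sum.elim (fun i => √(c.νPlus / c.ε₀) • toL2 (pdT i (State.comp 1 Φ)))
      fun _ => √(c.α / c.ε₀) • (toL2 (State.comp 0 Φ) - toL2 (State.comp 1 Φ))))

theorem norm_sqrt_smul_sq {a : ℝ} (ha : 0 ≤ a) (v : L2) : ‖√a • v‖ ^ 2 = a * ‖v‖ ^ 2 := by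
  rw [norm_smul, mul_pow, Real.norm_eq_abs, sq_abs, Real.sq_sqrt ha]

theorem norm_dissipationVector_sq (Φ : State) :
    ‖dissipationVector c Φ‖ ^ 2 = dissipation c Φ := by
  have := c.νMinus_pos
  have := c.νPlus_pos
  have := c.ε₀_pos
  have := c.α_pos
  rw [PiLp.norm_sq_eq_of_L2, Fintype.sum_sum_type, Fintype.sum_sum_type]
  simp only [dissipationVector, Sum.elim_inl, Sum.elim_inr, dissipation]
  rw [Finset.sum_congr rfl fun i _ => norm_sqrt_smul_sq (a := c.νMinus / c.ε₀) (by positivity) _,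
    Finset.sum_congr rfl fun i _ => norm_sqrt_smul_sq (a := c.νPlus / c.ε₀) (by positivity) _,
    Finset.sum_congr rfl fun i _ => norm_sqrt_smul_sq (a := c.α / c.ε₀) (by positivity) _,
    ← Finset.mul_sum, ← Finset.mul_sum]
  simp [add_assoc]

theorem tendsto_inner_apply_of_weak {ι : Type*} [Fintype ι] {x : ℕ → PiLp 2 fun _ : ι => L2}
    {x₀ : PiLp 2 fun _ : ι => L2}
    (h : ∀ y, Tendsto (fun N => inner ℝ (x N) y) atTop (𝓝 (inner ℝ x₀ y))) (i : ι) (y : L2) :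
    Tendsto (fun N => inner ℝ (x N i) y) atTop (𝓝 (inner ℝ (x₀ i) y)) := by
  have := tendsto_clm_of_weak h ((innerSL ℝ y).comp (PiLp.proj 2 (fun _ : ι => L2) i))
  simpa only [ContinuousLinearMap.comp_apply, innerSL_apply_apply, PiLp.proj_apply,
    real_inner_comm] using this

/-- The dissipation is the squared norm of `dissipationVector`, which is linear in the state. Along
a subsequence realizing the liminf these vectors have a weak limit, and the norm is weakly lower
semicontinuous. The components of the limit are identified through `y`, so the subsequence may
differ from one time to another. -/
theorem exists_weakGradients {x : ℕ → State} {y : L2x4}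
    (hY : ∀ z, Tendsto (fun N => inner ℝ (embed c (x N)) z) atTop (𝓝 (inner ℝ y z)))
    (hD : liminf (fun N => ENNReal.ofReal (dissipation c (x N))) atTop ≠ ⊤) :
    ∃ G : GradL2 × GradL2,
      (∀ i w, inner ℝ (G.1 i) (toL2 w) = - inner ℝ (phys c 0 y) (toL2 (pdT i w))) ∧
      (∀ i w, inner ℝ (G.2 i) (toL2 w) = - inner ℝ (phys c 1 y) (toL2 (pdT i w))) ∧
      ENNReal.ofReal (dissipationRate c G.1 G.2 (phys c 0 y) (phys c 1 y)) ≤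
        liminf (fun N => ENNReal.ofReal (dissipation c (x N))) atTop := by
  have hm := c.νMinus_pos
  have hp := c.νPlus_pos
  have hε := c.ε₀_pos
  have hα := c.α_pos
  set l := liminf (fun N => ENNReal.ofReal (dissipation c (x N))) atTop with hl
  -- Indices are selected whose dissipation is below `l + 1/(n+1)`; finiteness of `l` makes this
  -- level exceed `l` strictly.
  have hfr : ∀ n : ℕ, ∃ᶠ N in atTop,
      ENNReal.ofReal (dissipation c (x N)) < l + ((n : ℝ≥0∞) + 1)⁻¹ := fun n =>
    frequently_lt_of_liminf_lt (by isBoundedDefault)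
      (ENNReal.lt_add_right hD (ENNReal.inv_ne_zero.2 (by finiteness)))
  obtain ⟨φ, hφ, hφl⟩ := extraction_forall_of_frequently hfr
  have hbd : ∀ n, ‖dissipationVector c (x (φ n))‖ ≤ √(l + 1).toReal := by
    intro n
    refine Real.le_sqrt_of_sq_le ?_
    rw [norm_dissipationVector_sq]
    have h1 : ENNReal.ofReal (dissipation c (x (φ n))) ≤ l + 1 := by
      refine (hφl n).le.trans ?_
      gcongr
      exact ENNReal.inv_le_one.2 le_add_self
    rwa [ENNReal.ofReal_le_iff_le_toReal (by finiteness)] at h1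
  obtain ⟨χ, hχ, Z, hZ⟩ := exists_subseq_weak_limit_of_bounded hbd
  have hYs : ∀ i z, Tendsto (fun N => inner ℝ (toL2 (State.comp i (x (φ (χ N))))) z) atTop
      (𝓝 (inner ℝ (phys c i y) z)) := by
    intro i z
    have := (phys_weak c hY i z).comp (hφ.tendsto_atTop.comp hχ.tendsto_atTop)
    simpa only [phys_embed, Function.comp_def] using this
  -- The derivative is moved to the test field before the limit, so weak convergence of the states
  -- is enough; the factor `(√a)⁻¹` undoes the scaling.
  have hgrad : ∀ (i : Fin 3) (j : Fin 4) (a : ℝ) (k : Fin 3 ⊕ Fin 3 ⊕ Unit), 0 < a →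
      (∀ Φ, dissipationVector c Φ k = √a • toL2 (pdT i (State.comp j Φ))) → ∀ w,
      inner ℝ ((√a)⁻¹ • Z k) (toL2 w) = - inner ℝ (phys c j y) (toL2 (pdT i w)) := by
    intro i j a k ha hk w
    have h1 := (tendsto_inner_apply_of_weak hZ k (toL2 w)).const_mul (√a)⁻¹
    have h2 := (hYs j (toL2 (pdT i w))).neg
    have ha' : √a ≠ 0 := (Real.sqrt_pos.2 ha).ne'
    rw [inner_smul_left]
    refine tendsto_nhds_unique h1 (h2.congr fun N => ?_)
    rw [hk, inner_smul_left, inner_toL2_pdT, conj_trivial, inv_mul_cancel_left₀ ha']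
  have hrel : Z (Sum.inr (Sum.inr ())) = √(c.α / c.ε₀) • (phys c 0 y - phys c 1 y) := by
    refine ext_inner_right ℝ fun z => ?_
    refine tendsto_nhds_unique (tendsto_inner_apply_of_weak hZ (Sum.inr (Sum.inr ())) z) ?_
    simp only [dissipationVector, Sum.elim_inr, inner_smul_left, inner_sub_left]
    exact ((hYs 0 z).sub (hYs 1 z)).const_mul _
  refine ⟨(WithLp.toLp 2 fun i => (√(c.νMinus / c.ε₀))⁻¹ • Z (Sum.inl i),
    WithLp.toLp 2 fun i => (√(c.νPlus / c.ε₀))⁻¹ • Z (Sum.inr (Sum.inl i))),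
    fun i => hgrad i 0 _ (Sum.inl i) (by positivity) fun _ => rfl,
    fun i => hgrad i 1 _ (Sum.inr (Sum.inl i)) (by positivity) fun _ => rfl, ?_⟩
  have hcancel : ∀ (a : ℝ) (v : L2), 0 < a → a * ‖(√a)⁻¹ • v‖ ^ 2 = ‖v‖ ^ 2 := by
    intro a v ha
    rw [← norm_sqrt_smul_sq ha.le, smul_inv_smul₀ (Real.sqrt_pos.2 ha).ne']
  have hrate : dissipationRate c
      (WithLp.toLp 2 fun i => (√(c.νMinus / c.ε₀))⁻¹ • Z (Sum.inl i))
      (WithLp.toLp 2 fun i => (√(c.νPlus / c.ε₀))⁻¹ • Z (Sum.inr (Sum.inl i)))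
      (phys c 0 y) (phys c 1 y) = ‖Z‖ ^ 2 := by
    rw [dissipationRate, PiLp.norm_sq_eq_of_L2, PiLp.norm_sq_eq_of_L2, PiLp.norm_sq_eq_of_L2,
      Fintype.sum_sum_type, Fintype.sum_sum_type, Finset.mul_sum, Finset.mul_sum]
    simp only [Fintype.sum_unique, hrel]
    rw [norm_sqrt_smul_sq (by positivity),
      Finset.sum_congr rfl fun i _ => hcancel (c.νMinus / c.ε₀) (Z (Sum.inl i)) (by positivity),
      Finset.sum_congr rfl fun i _ =>
        hcancel (c.νPlus / c.ε₀) (Z (Sum.inr (Sum.inl i))) (by positivity), add_assoc]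
  rw [hrate]
  refine (norm_sq_le_liminf_of_weak hZ).trans ?_
  simp only [norm_dissipationVector_sq]
  have hlim : Tendsto (fun n : ℕ => l + ((n : ℝ≥0∞) + 1)⁻¹) atTop (𝓝 (l + 0)) := by
    refine tendsto_const_nhds.add ?_
    have := (ENNReal.tendsto_inv_nat_nhds_zero).comp (tendsto_add_atTop_nat 1)
    simpa [Function.comp_def] using this
  rw [add_zero] at hlim
  rw [← (hlim.comp hχ.tendsto_atTop).liminf_eq]
  exact liminf_le_liminf (Eventually.of_forall fun N => (hφl (χ N)).le)

theorem stronglyMeasurable_of_inner_apply {G : ℝ → GradL2}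
    (hG : ∀ i w, Measurable fun t => inner ℝ (G t i) (toL2 w)) : StronglyMeasurable G := by
  have h1 : ∀ i, StronglyMeasurable fun t => G t i := by
    refine fun i => stronglyMeasurable_of_inner dense_range_toL2 ?_
    rintro _ ⟨w, rfl⟩
    exact hG i w
  refine stronglyMeasurable_of_inner dense_univ fun y _ => ?_
  simp only [PiLp.inner_apply]
  exact Finset.measurable_sum _ fun i _ =>
    ((h1 i).inner stronglyMeasurable_const).measurable

variable {c} {Y₀ : L2x4} {Φ : ℕ → State} {u : ℕ → ℝ → State} {Y : ℝ → L2x4}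

/-- Fatou's lemma applied to the energy balance of the approximations. The first conclusion shows
that the truncation in `ENNReal.ofReal` loses nothing. -/
theorem IsGalerkin.lintegral_liminf_dissipation_le (h : IsGalerkin c Y₀ Φ u)
    (hY : ∀ t y, Tendsto (fun N => inner ℝ (embed c (u N t)) y) atTop (𝓝 (inner ℝ (Y t) y)))
    {t : ℝ} (ht : 0 ≤ t) : 1 / 2 * ‖Y t‖ ^ 2 ≤ 1 / 2 * ‖Y₀‖ ^ 2 ∧
      ∫⁻ s in Ioc 0 t, liminf (fun N => ENNReal.ofReal (dissipation c (u N s))) atTop ≤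
        ENNReal.ofReal (1 / 2 * ‖Y₀‖ ^ 2 - 1 / 2 * ‖Y t‖ ^ 2) := by
  have hdc := h.continuous_dissipation c
  -- `‖u N t‖²` need not converge, so it is replaced by its lower bound `2⟪u N t, Y t⟫ - ‖Y t‖²`,
  -- which does.
  let r : ℕ → ℝ := fun N => 1 / 2 * ‖embed c (u N 0)‖ ^ 2 - inner ℝ (embed c (u N t)) (Y t)
    + 1 / 2 * ‖Y t‖ ^ 2
  have hr : Tendsto r atTop (𝓝 (1 / 2 * ‖Y₀‖ ^ 2 - 1 / 2 * ‖Y t‖ ^ 2)) := by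
    have h1 := (((h.tendsto_initial.norm.pow 2).const_mul (1 / 2)).sub (hY t (Y t))).add_const
      (1 / 2 * ‖Y t‖ ^ 2)
    rw [real_inner_self_eq_norm_sq] at h1
    convert h1 using 2
    ring
  have hle : ∀ᶠ N : ℕ in atTop, ∫ s in 0..t, dissipation c (u N s) ≤ r N := by
    obtain ⟨N₀, hN₀⟩ := exists_nat_ge t
    filter_upwards [eventually_ge_atTop N₀] with N hN
    have h1 := h.energy N t ⟨ht, hN₀.trans (Nat.cast_le.2 hN)⟩
    have h2 := norm_sub_sq_real (embed c (u N t)) (Y t)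
    simp only [r]
    nlinarith [sq_nonneg ‖embed c (u N t) - Y t‖]
  have hnn : ∀ N, 0 ≤ ∫ s in 0..t, dissipation c (u N s) := fun N =>
    intervalIntegral.integral_nonneg ht fun s _ => dissipation_nonneg c _
  refine ⟨sub_nonneg.1 (ge_of_tendsto hr (hle.mono fun N hN => (hnn N).trans hN)), ?_⟩
  calc _ ≤ liminf (fun N => ∫⁻ s in Ioc 0 t, ENNReal.ofReal (dissipation c (u N s))) atTop :=
        lintegral_liminf_le fun N => (hdc N).measurable.ennreal_ofReal
    _ ≤ liminf (fun N => ENNReal.ofReal (r N)) atTop := by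
        refine liminf_le_liminf (hle.mono fun N hN => ?_)
        rw [← ofReal_integral_eq_lintegral_ofReal
          ((hdc N).integrableOn_Ioc) (Eventually.of_forall fun s => dissipation_nonneg c _),
          ← intervalIntegral.integral_of_le ht]
        exact ENNReal.ofReal_le_ofReal hN
    _ = _ := (ENNReal.tendsto_ofReal hr).liminf_eq

/-- The liminf of the dissipations is integrable on the half-line, hence finite at almost every
time; at those times gradients exist and their dissipation rate is at most the liminf. -/
theorem IsGalerkin.exists_gradients (h : IsGalerkin c Y₀ Φ u)
    (hY : ∀ t y, Tendsto (fun N => inner ℝ (embed c (u N t)) y) atTop (𝓝 (inner ℝ (Y t) y))) :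
    ∃ Gm Gp : ℝ → GradL2, StronglyMeasurable Gm ∧ StronglyMeasurable Gp ∧
      (∀ᵐ t ∂(volume.restrict (Ioi (0 : ℝ))), IsWeakGradient (phys c 0 (Y t)) (Gm t)) ∧
      (∀ᵐ t ∂(volume.restrict (Ioi (0 : ℝ))), IsWeakGradient (phys c 1 (Y t)) (Gp t)) ∧
      IntegrableOn (fun t => dissipationRate c (Gm t) (Gp t) (phys c 0 (Y t)) (phys c 1 (Y t)))
        (Ioi 0) ∧
      ∀ t, 0 ≤ t → 1 / 2 * ‖Y t‖ ^ 2 + (∫ s in 0..t,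
        dissipationRate c (Gm s) (Gp s) (phys c 0 (Y s)) (phys c 1 (Y s))) ≤
          1 / 2 * ‖Y₀‖ ^ 2 := by
  classical
  let D : ℝ → ℝ≥0∞ := fun s => liminf (fun N => ENNReal.ofReal (dissipation c (u N s))) atTop
  have hDm : Measurable D :=
    Measurable.liminf fun N => (h.continuous_dissipation c N).measurable.ennreal_ofReal
  have hen := fun {t : ℝ} => h.lintegral_liminf_dissipation_le hY (t := t)
  have hDle : ∫⁻ s in Ioi 0, D s ≤ ENNReal.ofReal (1 / 2 * ‖Y₀‖ ^ 2) := by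
    have hU : Ioi (0 : ℝ) = ⋃ n : ℕ, Ioc 0 (n : ℝ) := by
      refine (iUnion_Ioc_eq_Ioi_self_iff.2 fun x _ => ?_).symm
      exact exists_nat_ge x
    rw [hU, setLIntegral_iUnion_of_directed D (Monotone.directed_le fun m n hmn =>
      Ioc_subset_Ioc_right (Nat.cast_le.2 hmn))]
    refine iSup_le fun n => (hen n.cast_nonneg).2.trans (ENNReal.ofReal_le_ofReal ?_)
    linarith [sq_nonneg ‖Y n‖]
  have hDfin : ∀ᵐ s ∂(volume.restrict (Ioi (0 : ℝ))), D s ≠ ⊤ :=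
    (ae_lt_top hDm (hDle.trans_lt ENNReal.ofReal_lt_top).ne).mono fun s hs => hs.ne
  choose! G hG1 hG2 hG3 using fun s (hs : D s ≠ ⊤) => exists_weakGradients c (hY s) hs
  let S : Set ℝ := {s | D s ≠ ⊤}
  have hS : MeasurableSet S := hDm (measurableSet_singleton ⊤).compl
  have hYm := h.stronglyMeasurable_limit hY
  -- The gradients are chosen separately at each time, but their pairings with test fields are
  -- pairings of `Y`, and this forces measurability. Off `S` they are set to zero.
  have hmeas : ∀ (j : Fin 4) (g : ℝ → GradL2),
      (∀ s ∈ S, ∀ i w, inner ℝ (g s i) (toL2 w) =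
        - inner ℝ (phys c j (Y s)) (toL2 (pdT i w))) → StronglyMeasurable (S.indicator g) := by
    intro j g hg
    refine stronglyMeasurable_of_inner_apply fun i w => ?_
    have h1 : (fun t => inner ℝ (S.indicator g t i) (toL2 w)) =
        S.indicator fun t => - inner ℝ (phys c j (Y t)) (toL2 (pdT i w)) := by
      funext t
      by_cases ht : t ∈ S
      · rw [indicator_of_mem ht, indicator_of_mem ht, hg t ht]
      · rw [indicator_of_notMem ht, indicator_of_notMem ht, PiLp.zero_apply, inner_zero_left]
    rw [h1]
    exact ((((phys c j).continuous.comp_stronglyMeasurable hYm).inner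
      stronglyMeasurable_const).neg.indicator hS).measurable
  let Gm : ℝ → GradL2 := S.indicator fun s => (G s).1
  let Gp : ℝ → GradL2 := S.indicator fun s => (G s).2
  have hGm : StronglyMeasurable Gm := hmeas 0 _ fun s hs => hG1 s hs
  have hGp : StronglyMeasurable Gp := hmeas 1 _ fun s hs => hG2 s hs
  have hGS : ∀ s, D s ≠ ⊤ → Gm s = (G s).1 ∧ Gp s = (G s).2 := fun s hs =>
    ⟨indicator_of_mem (s := S) hs _, indicator_of_mem (s := S) hs _⟩
  let g : ℝ → ℝ := fun t => dissipationRate c (Gm t) (Gp t) (phys c 0 (Y t)) (phys c 1 (Y t))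
  have hg0 : ∀ t, 0 ≤ g t := fun t => dissipationRate_nonneg c _ _ _ _
  have hph := fun i => (phys c i).continuous.comp_stronglyMeasurable hYm
  have hgm : StronglyMeasurable g :=
    ((stronglyMeasurable_const.mul (hGm.norm.pow 2)).add
      (stronglyMeasurable_const.mul (hGp.norm.pow 2))).add
      (stronglyMeasurable_const.mul (((hph 0).sub (hph 1)).norm.pow 2))
  have hgD : ∀ s, D s ≠ ⊤ → ENNReal.ofReal (g s) ≤ D s := by
    intro s hs
    simp only [g, (hGS s hs).1, (hGS s hs).2]
    exact hG3 s hs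
  have hgint : IntegrableOn g (Ioi 0) := by
    refine ⟨hgm.aestronglyMeasurable, ?_⟩
    rw [hasFiniteIntegral_iff_ofReal (Eventually.of_forall hg0)]
    exact (lintegral_mono_ae (hDfin.mono hgD)).trans_lt (hDle.trans_lt ENNReal.ofReal_lt_top)
  refine ⟨Gm, Gp, hGm, hGp, hDfin.mono fun s hs => ?_, hDfin.mono fun s hs => ?_, hgint,
    fun t ht => ?_⟩
  · rw [(hGS s hs).1]
    exact isWeakGradient_of_inner (hG1 s hs)
  · rw [(hGS s hs).2]
    exact isWeakGradient_of_inner (hG2 s hs)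
  · have hsub : Ioc 0 t ⊆ Ioi 0 := Ioc_subset_Ioi_self
    have h1 : ENNReal.ofReal (∫ s in 0..t, g s) ≤
        ENNReal.ofReal (1 / 2 * ‖Y₀‖ ^ 2 - 1 / 2 * ‖Y t‖ ^ 2) := by
      rw [intervalIntegral.integral_of_le ht, ofReal_integral_eq_lintegral_ofReal
        (hgint.mono_set hsub) (Eventually.of_forall hg0)]
      exact (lintegral_mono_ae ((ae_restrict_of_ae_restrict_of_subset hsub hDfin).mono hgD)).trans
        (hen ht).2
    rw [ENNReal.ofReal_le_ofReal_iff (sub_nonneg.2 (hen ht).1)] at h1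
    linarith

end WeakGradient

/-! ### Space-time test fields and their time slices. -/

section SpaceTime

variable {φ : ℝ → E3 → E3}

theorem IsTestField.hasFDerivAt (h : IsTestField φ) (p : ℝ × E3) :
    HasFDerivAt (Function.uncurry φ) (fderiv ℝ (Function.uncurry φ) p) p :=
  (h.1.differentiable (by simp) p).hasFDerivAt

theorem IsTestField.fderiv_slice (h : IsTestField φ) (t : ℝ) (x : E3) :
    fderiv ℝ (φ t) x =
      (fderiv ℝ (Function.uncurry φ) (t, x)).comp (ContinuousLinearMap.inr ℝ ℝ E3) :=
  ((h.hasFDerivAt (t, x)).comp x (hasFDerivAt_prodMk_right t x)).fderiv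

theorem IsTestField.hasDerivAt_time (h : IsTestField φ) (t : ℝ) (x : E3) :
    HasDerivAt (fun s => φ s x) (fderiv ℝ (Function.uncurry φ) (t, x) (1, 0)) t := by
  have h1 := (h.hasFDerivAt (t, x)).comp_hasDerivAt t
    ((hasDerivAt_id t).prodMk (hasDerivAt_const t x))
  exact h1

theorem IsTestField.dt_eq (h : IsTestField φ) (t : ℝ) (x : E3) :
    dt φ t x = fderiv ℝ (Function.uncurry φ) (t, x) (1, 0) := (h.hasDerivAt_time t x).deriv

theorem IsTestField.pd_eq (h : IsTestField φ) (i : Fin 3) (t : ℝ) (x : E3) :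
    pd i (φ t) x =
      fderiv ℝ (Function.uncurry φ) (t, x) (0, EuclideanSpace.single i 1) := by
  rw [pd, h.fderiv_slice]
  rfl

theorem IsTestField.fderiv_apply (h : IsTestField φ) (a : ℝ × E3) :
    IsTestField fun t x => fderiv ℝ (Function.uncurry φ) (t, x) a :=
  ⟨(h.1.fderiv_right (m := ∞) (by simp)).clm_apply contDiff_const,
    (h.2.fderiv ℝ).comp_left (g := fun L : ℝ × E3 →L[ℝ] E3 => L a) rfl⟩

theorem IsTestField.dt (h : IsTestField φ) : IsTestField (dt φ) := by
  rw [show NSM.dt φ = _ from funext fun t => funext fun x => h.dt_eq t x]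
  exact h.fderiv_apply _

theorem IsTestField.pd (h : IsTestField φ) (i : Fin 3) : IsTestField fun t => pd i (φ t) := by
  rw [show (fun t => NSM.pd i (φ t)) = _ from funext fun t => funext fun x => h.pd_eq i t x]
  exact h.fderiv_apply _

theorem IsTestField.laplacian (h : IsTestField φ) :
    IsTestField fun t => Laplacian.laplacian (φ t) := by
  have h1 : (fun t => Laplacian.laplacian (φ t)) = fun t x => ∑ i, NSM.pd i (NSM.pd i (φ t)) x := by
    funext t x
    exact laplacian_eq_sum_pd (h.1.comp (contDiff_prodMk_right t)) x
  rw [h1]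
  have h2 := fun i => (h.pd i).pd i
  simp only [Fin.sum_univ_three]
  refine ⟨((h2 0).1.add (h2 1).1).add (h2 2).1, ((h2 0).2.add (h2 1).2).add (h2 2).2⟩

theorem IsTestField.hasCompactSupport_slice (h : IsTestField φ) (t : ℝ) :
    HasCompactSupport (φ t) := by
  refine HasCompactSupport.of_support_subset_isCompact (h.2.image continuous_snd) fun x hx => ?_
  exact ⟨(t, x), subset_tsupport _ hx, rfl⟩

/-- The time slices of a space-time test field. -/
def IsTestField.slice (h : IsTestField φ) (t : ℝ) : Test :=
  ⟨φ t, h.1.comp (contDiff_prodMk_right t), h.hasCompactSupport_slice t⟩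

theorem IsTestField.exists_lipschitz (h : IsTestField φ) :
    ∃ L, 0 ≤ L ∧ ∀ s t x, ‖φ t x - φ s x‖ ≤ L * |t - s| := by
  obtain ⟨L, hL⟩ := h.1.lipschitzWith_of_hasCompactSupport h.2 (by simp)
  refine ⟨L, L.2, fun s t x => ?_⟩
  have h1 := hL.dist_le_mul (t, x) (s, x)
  rwa [dist_eq_norm, Prod.dist_eq, dist_self, max_eq_left dist_nonneg, Real.dist_eq] at h1

theorem IsTestField.exists_lipschitz_fderiv (h : IsTestField φ) :
    ∃ L, 0 ≤ L ∧ ∀ s t x, ‖fderiv ℝ (φ t) x - fderiv ℝ (φ s) x‖ ≤ L * |t - s| := by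
  obtain ⟨L, hL⟩ := (h.1.fderiv_right (m := ∞) (by simp)).lipschitzWith_of_hasCompactSupport
    (h.2.fderiv ℝ) (by simp)
  refine ⟨L, L.2, fun s t x => ?_⟩
  have h1 := hL.dist_le_mul (t, x) (s, x)
  rw [dist_eq_norm, Prod.dist_eq, dist_self, max_eq_left dist_nonneg, Real.dist_eq] at h1
  rw [h.fderiv_slice, h.fderiv_slice, ← ContinuousLinearMap.sub_comp]
  refine (ContinuousLinearMap.opNorm_comp_le _ _).trans
    ((mul_le_of_le_one_right (norm_nonneg _) ?_).trans h1)
  exact ContinuousLinearMap.opNorm_le_bound _ zero_le_one fun x => by simp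

theorem IsTestField.exists_support (h : IsTestField φ) : ∃ R : ℝ, 0 < R ∧
    (∀ t, Function.support (φ t) ⊆ Metric.closedBall 0 R) ∧ ∀ t, R ≤ t → h.slice t = 0 := by
  obtain ⟨R, hR⟩ := h.2.isBounded.subset_closedBall (0 : ℝ × E3)
  have hmem : ∀ t x, φ t x ≠ 0 → |t| ≤ R ∧ ‖x‖ ≤ R := by
    intro t x hx
    have h1 := hR (subset_tsupport (Function.uncurry φ) (show (t, x) ∈ _ from hx))
    rw [mem_closedBall_zero_iff, Prod.norm_def] at h1
    exact ⟨(le_max_left _ _).trans h1, (le_max_right _ _).trans h1⟩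
  refine ⟨|R| + 1, by positivity, fun t x hx => ?_, fun t ht => ?_⟩
  · rw [mem_closedBall_zero_iff]
    linarith [(hmem t x hx).2, le_abs_self R]
  · refine Subtype.ext (funext fun x => ?_)
    by_contra hx
    linarith [(hmem t x hx).1, le_abs_self R, le_abs_self t]

/-- All slices are supported in one ball, and the field, its spatial derivative and its Laplacian
are Lipschitz in time. -/
theorem IsTestField.exists_jetNorm_le (h : IsTestField φ) :
    ∃ L, 0 ≤ L ∧ ∀ s t, jetNorm (h.slice t - h.slice s) ≤ L * |t - s| := by
  obtain ⟨R, -, hR, -⟩ := h.exists_support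
  obtain ⟨C, hC0, hC⟩ := jetNorm_le R
  obtain ⟨L₀, hL₀, b₀⟩ := h.exists_lipschitz
  obtain ⟨L₁, hL₁, b₁⟩ := h.exists_lipschitz_fderiv
  obtain ⟨L₂, hL₂, b₂⟩ := h.laplacian.exists_lipschitz
  refine ⟨C * (L₀ + L₁ + L₂), by positivity, fun s t => ?_⟩
  have hd : ∀ t, Differentiable ℝ (φ t) := fun t => (h.slice t).contDiff.differentiable (by simp)
  rw [mul_assoc]
  refine hC _ ?_ _ (by positivity) (fun x => ?_) (fun x => ?_) (fun x => ?_)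
  · intro x hx
    by_contra hx'
    refine hx ?_
    have h1 : ∀ t, φ t x = 0 := fun t => by
      by_contra h2
      exact hx' (hR t h2)
    change φ t x - φ s x = 0
    rw [h1, h1, sub_zero]
  · refine (b₀ s t x).trans ?_
    gcongr
    linarith
  · change ‖fderiv ℝ (fun y => φ t y - φ s y) x‖ ≤ _
    rw [fderiv_fun_sub (hd t x) (hd s x)]
    refine (b₁ s t x).trans ?_
    gcongr
    linarith
  · have h1 : Laplacian.laplacian ((h.slice t - h.slice s : Test) : E3 → E3) x =
        Laplacian.laplacian (φ t) x - Laplacian.laplacian (φ s) x := by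
      have h2 := lapT.map_sub (h.slice t) (h.slice s)
      have h3 := congrArg (fun w : Test => w x) h2
      rw [← lapT_apply]
      refine h3.trans ?_
      change lapT (h.slice t) x - lapT (h.slice s) x = _
      rw [lapT_apply, lapT_apply]
      rfl
    rw [h1]
    refine (b₂ s t x).trans ?_
    gcongr
    linarith

/-- Time and space derivatives commute. The time derivative must itself be admissible in the
momentum equation for the passage to moving test fields. -/
theorem IsSolenoidalTestField.dt_mem (h : IsSolenoidalTestField φ) (t : ℝ) :
    h.1.dt.slice t ∈ solenoidal := by
  intro x
  change divergence (NSM.dt φ t) x = 0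
  have hsymm : ∀ i : Fin 3, NSM.pd i (NSM.dt φ t) x = NSM.dt (fun t => NSM.pd i (φ t)) t x := by
    intro i
    let F := Function.uncurry φ
    have hF := h.1.1.fderiv_right (m := ∞) (by simp)
    have hFd : HasFDerivAt (fderiv ℝ F) (fderiv ℝ (fderiv ℝ F) (t, x)) (t, x) :=
      (hF.differentiable (by simp) (t, x)).hasFDerivAt
    have happ : ∀ a b : ℝ × E3, fderiv ℝ (fun p => fderiv ℝ F p a) (t, x) b =
        fderiv ℝ (fderiv ℝ F) (t, x) b a := by
      intro a b
      have h1 := ((ContinuousLinearMap.apply ℝ E3 a).hasFDerivAt.comp (t, x) hFd).fderiv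
      exact congrArg (fun L => L b) h1
    have h1 : Function.uncurry (NSM.dt φ) = fun p => fderiv ℝ F p (1, 0) :=
      funext fun p => h.1.dt_eq p.1 p.2
    have h2 : Function.uncurry (fun t => NSM.pd i (φ t)) =
        fun p => fderiv ℝ F p (0, EuclideanSpace.single i 1) := funext fun p => h.1.pd_eq i p.1 p.2
    rw [h.1.dt.pd_eq, (h.1.pd i).dt_eq, h1, h2, happ, happ]
    have h3 : IsSymmSndFDerivAt ℝ F (t, x) :=
      (h.1.1.contDiffAt).isSymmSndFDerivAt (by simpa using ENat.LEInfty.out)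
    exact h3 _ _
  have h1 : HasDerivAt (fun s => divergence (φ s) x)
      (∑ i, NSM.dt (fun t => NSM.pd i (φ t)) t x i) t := by
    refine HasDerivAt.fun_sum fun i _ => ?_
    have h2 := (h.1.pd i).hasDerivAt_time t x
    rw [← (h.1.pd i).dt_eq] at h2
    exact (EuclideanSpace.proj (𝕜 := ℝ) i).hasFDerivAt.comp_hasDerivAt t h2
  rw [divergence, Finset.sum_congr rfl fun i _ => congrArg (fun v : E3 => v i) (hsymm i),
    ← h1.deriv, funext fun s => h.2 s x, deriv_const]

end SpaceTime

/-! ### From fixed to time-dependent test fields. -/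

section TimeDependent

theorem continuous_comp_of_jet {X : Type*} [NormedAddCommGroup X] [NormedSpace ℝ X]
    {G : Test →ₗ[ℝ] X} (hG : ∀ w, ‖G w‖ ≤ jetNorm w) {W : ℝ → Test} {L : ℝ} (hL : 0 ≤ L)
    (hW : ∀ s t, jetNorm (W t - W s) ≤ L * |t - s|) : Continuous fun t => G (W t) := by
  refine (LipschitzWith.of_dist_le_mul (K := ⟨L, hL⟩) fun t s => ?_).continuous
  rw [dist_eq_norm, ← G.map_sub (W t) (W s)]
  exact (hG _).trans (hW s t)

theorem hasDerivAt_inner_slice {φ : ℝ → E3 → E3} (h : IsTestField φ) (u : L2) (t : ℝ) :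
    HasDerivAt (fun s => inner ℝ u (toL2 (h.slice s))) (inner ℝ u (toL2 (h.dt.slice t))) t := by
  obtain ⟨R, -, hR, -⟩ := h.dt.exists_support
  obtain ⟨M, hM⟩ := h.dt.2.exists_bound_of_continuous h.dt.1.continuous
  have hM0 : 0 ≤ M := (norm_nonneg _).trans (hM (0, 0))
  simp only [inner_toL2]
  let B : Set E3 := Metric.closedBall 0 R
  have hB : IsCompact B := isCompact_closedBall _ _
  refine (hasDerivAt_integral_of_dominated_loc_of_deriv_le
    (F := fun s x => inner ℝ (u x) (h.slice s x))
    (F' := fun s x => inner ℝ (u x) (h.dt.slice s x)) (s := univ)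
    (bound := B.indicator fun x => ‖u x‖ * M) univ_mem
    (Eventually.of_forall fun s => (integrable_inner_test u (h.slice s)).aestronglyMeasurable)
    (integrable_inner_test u (h.slice t))
    (integrable_inner_test u (h.dt.slice t)).aestronglyMeasurable
    (Eventually.of_forall fun x s _ => ?_) ?_ (Eventually.of_forall fun x s _ => ?_)).2
  · by_cases hx : x ∈ B
    · rw [indicator_of_mem hx]
      exact (norm_inner_le_norm _ _).trans
        (mul_le_mul_of_nonneg_left (hM (s, x)) (norm_nonneg _))
    · rw [indicator_of_notMem hx]
      have h0 : h.dt.slice s x = 0 := by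
        by_contra h2
        exact hx (hR s h2)
      rw [h0, inner_zero_right, norm_zero]
  · rw [integrable_indicator_iff hB.measurableSet]
    exact (((Lp.memLp u).locallyIntegrable (by norm_num)).integrableOn_isCompact hB).norm.mul_const
      M
  · have h1 := h.hasDerivAt_time s x
    rw [← h.dt_eq] at h1
    exact (innerSL ℝ (u x)).hasFDerivAt.comp_hasDerivAt s h1

/-- From test fields to space-time test fields in an integrated evolution equation. -/
theorem weak_form_of_integrated {φ : ℝ → E3 → E3} (h : IsTestField φ) {P : Submodule ℝ Test}
    (hP : ∀ t, h.slice t ∈ P) (hP' : ∀ t, h.dt.slice t ∈ P) {κ K C : ℝ} {v : ℝ → L2} {v₀ : L2}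
    (hv : StronglyMeasurable v) (hvC : ∀ t, ‖v t‖ ≤ C) {a : ℝ → Test →ₗ[ℝ] ℝ} (hK : 0 ≤ K)
    (haK : ∀ t w, |a t w| ≤ K * jetNorm w)
    (ham : ∀ W : ℝ → Test, (∃ L, 0 ≤ L ∧ ∀ s t, jetNorm (W t - W s) ≤ L * |t - s|) →
      StronglyMeasurable fun t => a t (W t))
    (hid : ∀ w ∈ P, ∀ t, 0 ≤ t →
      κ * inner ℝ (v t) (toL2 w) = κ * inner ℝ v₀ (toL2 w) + ∫ τ in 0..t, a τ w) :
    -κ * (∫ t in Ioi (0 : ℝ), inner ℝ (v t) (toL2 (h.dt.slice t)))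
        - κ * inner ℝ v₀ (toL2 (h.slice 0)) = ∫ t in Ioi (0 : ℝ), a t (h.slice t) := by
  obtain ⟨L, hL0, hL⟩ := h.exists_jetNorm_le
  obtain ⟨L', hL0', hL'⟩ := h.dt.exists_jetNorm_le
  obtain ⟨R, hR0, -, hR⟩ := h.exists_support
  obtain ⟨R', hR0', -, hR'⟩ := h.dt.exists_support
  let T := max R R'
  have hT0 : 0 < T := hR0.trans_le (le_max_left _ _)
  have hT : ∀ t, T ≤ t → h.slice t = 0 := fun t ht => hR t ((le_max_left _ _).trans ht)
  have hT' : ∀ t, T ≤ t → h.dt.slice t = 0 := fun t ht => hR' t ((le_max_right _ _).trans ht)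
  -- A Lipschitz curve that vanishes from time `T` on has size at most `L T` on `[0, T]`.
  have hjetT : ∀ {W : ℝ → Test} {L : ℝ}, 0 ≤ L → (∀ t, T ≤ t → W t = 0) →
      (∀ s t, jetNorm (W t - W s) ≤ L * |t - s|) → ∀ t, 0 ≤ t → jetNorm (W t) ≤ L * T := by
    intro W L hL0 hW hL t ht
    rcases le_total T t with h1 | h1
    · rw [hW t h1, show jetNorm 0 = 0 by simp [jetNorm]]
      positivity
    · have h2 := hL T t
      have h3 : W t - W T = W t := by
        rw [hW T le_rfl]
        exact sub_zero (W t)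
      rw [h3, abs_of_nonpos (by linarith)] at h2
      exact h2.trans (mul_le_mul_of_nonneg_left (by linarith) hL0)
  have hjet := hjetT hL0' hT' hL'
  let p : ℝ → ℝ := fun t => κ * inner ℝ (v t) (toL2 (h.dt.slice t))
  let q : ℝ → ℝ := fun t => a t (h.slice t)
  have hc' : Continuous fun t => toL2 (h.dt.slice t) :=
    continuous_comp_of_jet norm_toL2_le_jetNorm hL0' hL'
  have hpm : StronglyMeasurable p :=
    stronglyMeasurable_const.mul (hv.inner hc'.stronglyMeasurable)
  have hqm : StronglyMeasurable q := ham _ ⟨L, hL0, hL⟩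
  have hqw : ∀ w, StronglyMeasurable fun t => a t w := fun w => ham (fun _ => w)
    ⟨0, le_rfl, fun s t => by simp [jetNorm]⟩
  have hai : ∀ w s t, IntervalIntegrable (fun τ => a τ w) volume s t := fun w =>
    intervalIntegrable_of_norm_le (hqw w) fun t => haK t w
  have hpi : ∀ s t, 0 ≤ s → s ≤ t → IntervalIntegrable p volume s t := by
    intro s t hs hst
    refine (intervalIntegrable_const (c := |κ| * (C * (L' * T)))).mono_fun'
      hpm.aestronglyMeasurable ?_
    rw [uIoc_of_le hst]
    refine (ae_restrict_mem measurableSet_Ioc).mono fun τ hτ => ?_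
    simp only [p, norm_mul, Real.norm_eq_abs]
    gcongr
    refine (abs_real_inner_le_norm _ _).trans (mul_le_mul (hvC τ)
      ((norm_toL2_le_jetNorm _).trans (hjet τ (hs.trans hτ.1.le))) (norm_nonneg _)
      ((norm_nonneg _).trans (hvC τ)))
  have hqi : ∀ s t, 0 ≤ s → s ≤ t → IntervalIntegrable q volume s t := by
    intro s t hs hst
    refine (intervalIntegrable_const (c := K * (L * T))).mono_fun' hqm.aestronglyMeasurable ?_
    rw [uIoc_of_le hst]
    refine (ae_restrict_mem measurableSet_Ioc).mono fun τ hτ => ?_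
    exact (haK τ _).trans (mul_le_mul_of_nonneg_left
      (hjetT hL0 hT hL τ (hs.trans hτ.1.le)) hK)
  have hinc : ∀ w ∈ P, ∀ s t, 0 ≤ s → s ≤ t →
      κ * inner ℝ (v t) (toL2 w) - κ * inner ℝ (v s) (toL2 w) = ∫ τ in s..t, a τ w := by
    intro w hw s t hs hst
    rw [hid w hw t (hs.trans hst), hid w hw s hs,
      ← intervalIntegral.integral_interval_sub_left (hai w 0 t) (hai w 0 s)]
    ring
  -- The product rule says that `f` is constant. As `v` has no time derivative, this is shown
  -- through increments of `f` that are quadratic in the time step.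
  let f : ℝ → ℝ := fun t => κ * inner ℝ (v t) (toL2 (h.slice t)) - (∫ τ in 0..t, p τ)
    - ∫ τ in 0..t, q τ
  let M : ℝ := K * (L' * T) + K * L
  have hM0 : 0 ≤ M := by positivity
  have hf : ∀ s t, 0 ≤ s → s ≤ t → |f t - f s| ≤ M * (t - s) ^ 2 := by
    intro s t hs hst
    -- The increment is split by moving first the test field with `v` frozen at `t` (`e1`), then `v`
    -- with the test field frozen at `s` (`e2`). Each freezing error is linear in the step, and
    -- integration gains the second power.
    have e1 : κ * inner ℝ (v t) (toL2 (h.slice t)) - κ * inner ℝ (v t) (toL2 (h.slice s)) =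
        ∫ τ in s..t, κ * inner ℝ (v t) (toL2 (h.dt.slice τ)) := by
      rw [intervalIntegral.integral_const_mul, ← mul_sub]
      congr 1
      exact (intervalIntegral.integral_eq_sub_of_hasDerivAt
        (fun τ _ => hasDerivAt_inner_slice h (v t) τ)
        ((continuous_const.inner hc').intervalIntegrable _ _)).symm
    have e2 := hinc _ (hP s) s t hs hst
    have e3 := intervalIntegral.integral_interval_sub_left (hpi 0 t le_rfl (hs.trans hst))
      (hpi 0 s le_rfl hs)
    have e4 := intervalIntegral.integral_interval_sub_left (hqi 0 t le_rfl (hs.trans hst))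
      (hqi 0 s le_rfl hs)
    have i1 : IntervalIntegrable (fun τ => κ * inner ℝ (v t) (toL2 (h.dt.slice τ)))
        volume s t := (continuous_const.mul (continuous_const.inner hc')).intervalIntegrable _ _
    have e5 : f t - f s = ∫ τ in s..t, ((κ * inner ℝ (v t) (toL2 (h.dt.slice τ)) - p τ)
        + (a τ (h.slice s) - q τ)) := by
      rw [intervalIntegral.integral_add (i1.sub (hpi s t hs hst))
        ((hai _ s t).sub (hqi s t hs hst)), intervalIntegral.integral_sub i1 (hpi s t hs hst),
        intervalIntegral.integral_sub (hai _ s t) (hqi s t hs hst), ← e1, ← e2, ← e3, ← e4]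
      simp only [f]
      ring
    rw [e5, ← Real.norm_eq_abs]
    have h1 : ∀ τ ∈ uIoc s t, ‖(κ * inner ℝ (v t) (toL2 (h.dt.slice τ)) - p τ)
        + (a τ (h.slice s) - q τ)‖ ≤ M * (t - s) := by
      intro τ hτ
      rw [uIoc_of_le hst] at hτ
      have hτ0 := hs.trans hτ.1.le
      have b1 : ‖κ * inner ℝ (v t) (toL2 (h.dt.slice τ)) - p τ‖ ≤ K * (L' * T) * (t - s) := by
        simp only [p]
        rw [hinc _ (hP' τ) τ t hτ0 hτ.2]
        refine (intervalIntegral.norm_integral_le_of_norm_le_const fun σ _ =>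
          (haK σ _).trans (mul_le_mul_of_nonneg_left (hjet τ hτ0) hK)).trans ?_
        rw [abs_of_nonneg (by linarith [hτ.2])]
        gcongr
        exact hτ.1.le
      have b2 : ‖a τ (h.slice s) - q τ‖ ≤ K * L * (t - s) := by
        simp only [q]
        rw [← (a τ).map_sub (h.slice s) (h.slice τ)]
        refine (haK τ _).trans ?_
        rw [mul_assoc]
        refine mul_le_mul_of_nonneg_left ((hL τ s).trans ?_) hK
        rw [abs_of_nonpos (by linarith [hτ.1])]
        gcongr
        linarith [hτ.2]
      refine (norm_add_le _ _).trans ((add_le_add b1 b2).trans_eq ?_)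
      simp only [M]
      ring
    refine (intervalIntegral.norm_integral_le_of_norm_le_const h1).trans_eq ?_
    rw [abs_of_nonneg (by linarith)]
    ring
  have hconst : f T = f 0 := by
    -- Quadratic increments give a vanishing right derivative, which with continuity makes `f`
    -- constant.
    have hder : ∀ x ∈ Ico 0 T, HasDerivWithinAt f 0 (Ici x) x := by
      intro x hx
      rw [hasDerivWithinAt_iff_isLittleO]
      have h1 : (fun y => f y - f x - (y - x) • (0 : ℝ)) =O[𝓝[Ici x] x] fun y => (y - x) ^ 2 := by
        refine Asymptotics.IsBigO.of_bound M ?_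
        filter_upwards [self_mem_nhdsWithin] with y hy
        rw [smul_zero, sub_zero, norm_pow, Real.norm_eq_abs, Real.norm_eq_abs, sq_abs]
        exact hf x y hx.1 hy
      refine h1.trans_isLittleO ?_
      have h2 : (fun y : ℝ => (y - x) ^ 2) =o[𝓝 x] fun y => y - x := by
        have := (Asymptotics.isLittleO_pow_id (𝕜 := ℝ) one_lt_two).comp_tendsto
          (show Tendsto (fun y => y - x) (𝓝 x) (𝓝 0) by
            rw [← sub_self x]
            exact tendsto_id.sub_const x)
        exact this
      exact h2.mono nhdsWithin_le_nhds
    have hcont : ContinuousOn f (Icc 0 T) := by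
      intro x hx
      rw [ContinuousWithinAt, tendsto_iff_norm_sub_tendsto_zero]
      have h3 : Tendsto (fun y => M * (y - x) ^ 2) (𝓝[Icc 0 T] x) (𝓝 0) := by
        have : Tendsto (fun y => M * (y - x) ^ 2) (𝓝 x) (𝓝 (M * (x - x) ^ 2)) :=
          Continuous.tendsto (by fun_prop) x
        rw [sub_self, zero_pow two_ne_zero, mul_zero] at this
        exact this.mono_left nhdsWithin_le_nhds
      refine squeeze_zero' (Eventually.of_forall fun _ => norm_nonneg _) ?_ h3
      filter_upwards [self_mem_nhdsWithin] with y hy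
      rw [Real.norm_eq_abs]
      rcases le_total x y with hxy | hxy
      · exact hf x y hx.1 hxy
      · rw [abs_sub_comm, sub_sq_comm]
        exact hf y x hy.1 hxy
    exact constant_of_has_deriv_right_zero hcont hder T ⟨hT0.le, le_rfl⟩
  have hIoi : ∀ g : ℝ → ℝ, (∀ t, T ≤ t → g t = 0) →
      ∫ t in Ioi 0, g t = ∫ t in 0..T, g t := by
    intro g hg
    rw [intervalIntegral.integral_of_le hT0.le]
    refine (setIntegral_eq_of_subset_of_forall_sdiff_eq_zero measurableSet_Ioi
      Ioc_subset_Ioi_self fun t ht => hg t ?_)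
    by_contra! h1
    exact ht.2 ⟨ht.1, h1.le⟩
  have hp0 : ∫ t in Ioi 0, inner ℝ (v t) (toL2 (h.dt.slice t)) =
      ∫ t in 0..T, inner ℝ (v t) (toL2 (h.dt.slice t)) :=
    hIoi _ fun t ht => by rw [hT' t ht, map_zero, inner_zero_right]
  have hq0 : ∫ t in Ioi 0, a t (h.slice t) = ∫ t in 0..T, a t (h.slice t) :=
    hIoi _ fun t ht => by rw [hT t ht, map_zero]
  have hpκ : ∫ t in 0..T, p t = κ * ∫ t in 0..T, inner ℝ (v t) (toL2 (h.dt.slice t)) :=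
    intervalIntegral.integral_const_mul _ _
  -- At time `0` the integrated equation turns the pairing with `v 0` into that with `v₀`; at time
  -- `T` the test field is gone.
  have h0 := hid _ (hP 0) 0 le_rfl
  simp only [f, hT T le_rfl, map_zero, inner_zero_right, mul_zero, intervalIntegral.integral_same,
    sub_zero, hpκ] at hconst h0
  rw [hp0, hq0]
  simp only [q, add_zero] at hconst h0
  linarith

end TimeDependent

/-! ### Assembly of the weak solution. -/

section WeakForms

theorem weakMomentum_of_integrated {n m ν q C : ℝ} {v₀ : L2} {v E B F : ℝ → L2}
    (hv : StronglyMeasurable v) (hE : StronglyMeasurable E) (hB : StronglyMeasurable B)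
    (hF : StronglyMeasurable F) (hvC : ∀ t, ‖v t‖ ≤ C) (hEC : ∀ t, ‖E t‖ ≤ C)
    (hBC : ∀ t, ‖B t‖ ≤ C) (hFC : ∀ t, ‖F t‖ ≤ C)
    (hid : ∀ w ∈ solenoidal, ∀ t, 0 ≤ t →
      n * m * inner ℝ (v t) (toL2 w) = n * m * inner ℝ v₀ (toL2 w)
        + ∫ τ in 0..t, momentumForm n m ν q (v τ) (E τ) (B τ) (F τ) w) :
    WeakMomentum n m ν q v₀ v E B F := by
  intro φ hφ
  obtain ⟨K, hK0, hK⟩ := exists_abs_momentumForm_le n m ν q C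
  have h1 := weak_form_of_integrated hφ.1 (P := solenoidal) (fun t x => hφ.2 t x) hφ.dt_mem hv hvC
    (a := fun t => momentumForm n m ν q (v t) (E t) (B t) (F t)) hK0
    (fun t w => hK _ _ _ _ (hvC t) (hEC t) (hBC t) (hFC t) w) ?_ hid
  · simp only [momentumForm_eq_integral, inner_toL2] at h1
    exact h1
  · rintro W ⟨L, hL0, hL⟩
    have c0 := (continuous_comp_of_jet norm_toL2_le_jetNorm hL0 hL).stronglyMeasurable
    have c1 := (continuous_comp_of_jet (G := toL2 ∘ₗ lapT) norm_lapT_le_jetNorm hL0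
      hL).stronglyMeasurable
    have hact : ∀ {G : Test →ₗ[ℝ] LTop}, (∀ w, ‖G w‖ ≤ jetNorm w) →
        StronglyMeasurable fun t => actL (G (W t)) (v t) := fun hG =>
      (actL.continuous₂.comp_stronglyMeasurable
        ((continuous_comp_of_jet hG hL0 hL).stronglyMeasurable.prodMk hv) :)
    simp only [momentumForm_apply]
    exact (((stronglyMeasurable_const.mul (hv.inner c1)).add
      (stronglyMeasurable_const.mul (hv.inner (hact norm_jacobian_le_jetNorm)))).add
      (stronglyMeasurable_const.mul
        ((hE.inner c0).add (hB.inner (hact norm_crossMatrix_le_jetNorm))))).add (hF.inner c0)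

theorem weakMaxwell_of_integrated {k C : ℝ} {U₀ : L2} {U W J : ℝ → L2}
    (hU : StronglyMeasurable U) (hW : StronglyMeasurable W) (hJ : StronglyMeasurable J)
    (hUC : ∀ t, ‖U t‖ ≤ C) (hWC : ∀ t, ‖W t‖ ≤ C) (hJC : ∀ t, ‖J t‖ ≤ C)
    (hid : ∀ (w : Test) (t : ℝ), 0 ≤ t → inner ℝ (U t) (toL2 w) = inner ℝ U₀ (toL2 w)
      + ∫ τ in 0..t, maxwellForm k (W τ) (J τ) w) :
    WeakMaxwell k U₀ U W J := by
  intro φ hφ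
  obtain ⟨K, hK0, hK⟩ := exists_abs_maxwellForm_le k C
  have h1 := weak_form_of_integrated hφ (P := ⊤) (κ := 1) (v₀ := U₀) (fun t => trivial)
    (fun t => trivial) hU hUC (a := fun t => maxwellForm k (W t) (J t)) hK0
    (fun t w => hK _ _ (hWC t) (hJC t) w) ?_ (fun w _ t ht => by
      rw [one_mul, one_mul]
      exact hid w t ht)
  · simp only [maxwellForm_eq_integral, inner_toL2, one_mul, neg_mul] at h1
    exact h1
  · rintro V ⟨L, hL0, hL⟩
    have c0 := (continuous_comp_of_jet norm_toL2_le_jetNorm hL0 hL).stronglyMeasurable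
    have c1 := (continuous_comp_of_jet (G := toL2 ∘ₗ curlT) norm_curlT_le_jetNorm hL0
      hL).stronglyMeasurable
    simp only [maxwellForm_apply]
    exact (stronglyMeasurable_const.mul (hW.inner c1)).add (hJ.inner c0)

variable {c : Constants} {Y₀ : L2x4} {Y : ℝ → L2x4}

theorem IsIntegrated.isWeakSolution (h : IsIntegrated c Y₀ Y)
    (hcl : ∀ t, Y t ∈ (LinearMap.range (embed c)).topologicalClosure)
    (h0 : ∀ t, IsDivFree (phys c 0 (Y t))) (h1 : ∀ t, IsDivFree (phys c 1 (Y t)))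
    (hY0 : Y 0 = Y₀) :
    IsWeakSolution c (phys c 0 Y₀) (phys c 1 Y₀) (phys c 2 Y₀) (phys c 3 Y₀)
      (fun t => phys c 0 (Y t)) (fun t => phys c 1 (Y t)) (fun t => phys c 2 (Y t))
      (fun t => phys c 3 (Y t)) := by
  have hm := fun i => (phys c i).continuous.comp_stronglyMeasurable h.stronglyMeasurable
  let A : ℝ := ∑ i, ‖phys c i‖ * (‖Y₀‖ + 1)
  have hA : ∀ i t, ‖phys c i (Y t)‖ ≤ A := fun i t => ((phys c i).le_opNorm _).trans
    ((mul_le_mul_of_nonneg_left (h.norm_le t) (norm_nonneg _)).trans (Finset.single_le_sum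
      (f := fun i => ‖phys c i‖ * (‖Y₀‖ + 1)) (fun _ _ => by positivity) (Finset.mem_univ i)))
  let F : L2x4 →L[ℝ] L2 := -c.α • (phys c 1 - phys c 0)
  let J : L2x4 →L[ℝ] L2 := -(c.n * c.e / c.ε₀) • (c.Z • phys c 1 - phys c 0)
  let C : ℝ := A + ‖F‖ * (‖Y₀‖ + 1) + ‖J‖ * (‖Y₀‖ + 1)
  have hA0 : 0 ≤ A := (norm_nonneg _).trans (hA 0 0)
  have hF0 : 0 ≤ ‖F‖ * (‖Y₀‖ + 1) := by positivity
  have hJ0 : 0 ≤ ‖J‖ * (‖Y₀‖ + 1) := by positivity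
  have hAC : ∀ i t, ‖phys c i (Y t)‖ ≤ C := fun i t => (hA i t).trans (by simp only [C]; linarith)
  have hFC : ∀ t, ‖F (Y t)‖ ≤ C := fun t => ((F.le_opNorm _).trans
    (mul_le_mul_of_nonneg_left (h.norm_le t) (norm_nonneg _))).trans (by simp only [C]; linarith)
  have hJC : ∀ t, ‖J (Y t)‖ ≤ C := fun t => ((J.le_opNorm _).trans
    (mul_le_mul_of_nonneg_left (h.norm_le t) (norm_nonneg _))).trans (by simp only [C]; linarith)
  have hFm := F.continuous.comp_stronglyMeasurable h.stronglyMeasurable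
  have hJm := J.continuous.comp_stronglyMeasurable h.stronglyMeasurable
  exact
  { momentum_minus := weakMomentum_of_integrated (hm 0) (hm 2) (hm 3) hFm.neg (hAC 0) (hAC 2)
      (hAC 3) (fun t => (norm_neg (F (Y t))).trans_le (hFC t))
      fun w hw t ht => h.momentum_minus hw ht
    momentum_plus := weakMomentum_of_integrated (hm 1) (hm 2) (hm 3) hFm (hAC 1) (hAC 2)
      (hAC 3) hFC fun w hw t ht => h.momentum_plus hw ht
    ampere := weakMaxwell_of_integrated (hm 2) (hm 3) hJm (hAC 2) (hAC 3) hJC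
      fun w t ht => h.ampere w ht
    faraday := weakMaxwell_of_integrated (C := C) (hm 3) (hm 2) stronglyMeasurable_const (hAC 3)
      (hAC 2) (fun _ => by rw [norm_zero]; exact (norm_nonneg _).trans (hAC 0 0))
      fun w t ht => h.faraday w ht
    div_minus := fun t _ => h0 t
    div_plus := fun t _ => h1 t
    gauss_electric := fun hE t ht => h.gauss_electric h0 h1 hE ht
    gauss_magnetic := fun hB t ht => h.gauss_magnetic hB ht
    continuous_minus := h.isWeaklyContinuous hcl 0
    continuous_plus := h.isWeaklyContinuous hcl 1
    continuous_electric := h.isWeaklyContinuous hcl 2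
    continuous_magnetic := h.isWeaklyContinuous hcl 3
    initial_minus := by rw [hY0]
    initial_plus := by rw [hY0]
    initial_electric := by rw [hY0]
    initial_magnetic := by rw [hY0] }

end WeakForms

end NSM

end

/-! ### Conclusion. -/

theorem theorem1p2 (c : NSM.Constants) (vm₀ vp₀ E₀ B₀ : NSM.L2)
    (hvm₀ : NSM.IsDivFree vm₀) (hvp₀ : NSM.IsDivFree vp₀) :
    ∃ (vm vp E B : ℝ → NSM.L2) (Gm Gp : ℝ → NSM.GradL2),
      -- the fields belong to `L^∞(0,∞; L²)`
      MemLp vm ∞ (volume.restrict (Ioi (0 : ℝ))) ∧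
      MemLp vp ∞ (volume.restrict (Ioi (0 : ℝ))) ∧
      MemLp E ∞ (volume.restrict (Ioi (0 : ℝ))) ∧
      MemLp B ∞ (volume.restrict (Ioi (0 : ℝ))) ∧
      -- the velocities belong to `L²(0,∞; Ḣ¹)`, with gradients `Gm`, `Gp`
      (∀ᵐ t ∂(volume.restrict (Ioi (0 : ℝ))), NSM.IsWeakGradient (vm t) (Gm t)) ∧
      (∀ᵐ t ∂(volume.restrict (Ioi (0 : ℝ))), NSM.IsWeakGradient (vp t) (Gp t)) ∧
      MemLp Gm 2 (volume.restrict (Ioi (0 : ℝ))) ∧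
      MemLp Gp 2 (volume.restrict (Ioi (0 : ℝ))) ∧
      -- the friction belongs to `L²(0,∞; L²)`
      MemLp (NSM.friction c vm vp) 2 (volume.restrict (Ioi (0 : ℝ))) ∧
      -- the system and the initial conditions
      NSM.IsWeakSolution c vm₀ vp₀ E₀ B₀ vm vp E B ∧
      -- the energy inequality
      ∀ t : ℝ, 0 ≤ t →
        NSM.energy c (vm t) (vp t) (E t) (B t)
          + c.νMinus / c.ε₀ * (∫ s in (0 : ℝ)..t, ‖Gm s‖ ^ 2)
          + c.νPlus / c.ε₀ * (∫ s in (0 : ℝ)..t, ‖Gp s‖ ^ 2)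
          + c.α / c.ε₀ * (∫ s in (0 : ℝ)..t, ‖vm s - vp s‖ ^ 2)
        ≤ NSM.energy c vm₀ vp₀ E₀ B₀ := by
  let U : Fin 4 → NSM.L2 := ![vm₀, vp₀, E₀, B₀]
  let Y₀ := NSM.scaled c U
  obtain ⟨Φ, hΦ⟩ := NSM.exists_isDenseSeq
  obtain ⟨u, Y, hu, hY⟩ :=
    NSM.exists_weak_limit c (NSM.scaled_mem_closure (c := c) (U := U) hvm₀ hvp₀) hΦ
  obtain ⟨Gm, Gp, hGm, hGp, hwm, hwp, hint, hen⟩ := hu.exists_gradients hY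
  have hI := hu.isIntegrated hΦ hY
  have hm := fun i => (NSM.phys c i).continuous.comp_stronglyMeasurable hI.stronglyMeasurable
  have hcl : ∀ t, Y t ∈ (LinearMap.range (NSM.embed c)).topologicalClosure := fun t =>
    NSM.mem_closure_range_embed_of_weak (hY t)
  have hdiv : ∀ i, i = 0 ∨ i = 1 → ∀ t, NSM.IsDivFree (NSM.phys c i (Y t)) := by
    intro i hi t
    refine NSM.isDivFree_of_weak (x := fun N => NSM.State.comp i (u N t)) (fun N => ?_) fun z => ?_
    · rcases hi with rfl | rfl
      exacts [(u N t).2.1, (u N t).2.2]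
    · simpa only [NSM.phys_embed] using NSM.phys_weak c (hY t) i z
  have htop : ∀ i, MemLp (fun t => NSM.phys c i (Y t)) ∞ (volume.restrict (Ioi (0 : ℝ))) :=
    fun i => memLp_top_of_bound (hm i).aestronglyMeasurable (‖NSM.phys c i‖ * (‖Y₀‖ + 1))
      (Filter.Eventually.of_forall fun t => ((NSM.phys c i).le_opNorm _).trans
        (mul_le_mul_of_nonneg_left (hI.norm_le t) (norm_nonneg _)))
  have hν := c.νMinus_pos
  have hν' := c.νPlus_pos
  have hα := c.α_pos
  have hε := c.ε₀_pos
  -- Every term of the dissipation rate is nonnegative, so integrability of the sum gives that of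
  -- each term.
  have hsq : ∀ {X : Type} [NormedAddCommGroup X] {g : ℝ → X} (κ : ℝ), 0 < κ →
      MeasureTheory.StronglyMeasurable g →
      (∀ t, κ * ‖g t‖ ^ 2 ≤ NSM.dissipationRate c (Gm t) (Gp t) (NSM.phys c 0 (Y t))
        (NSM.phys c 1 (Y t))) →
      IntegrableOn (fun t => ‖g t‖ ^ 2) (Ioi 0) := by
    intro X _ g κ hκ hg hle
    have h1 : IntegrableOn (fun t => κ * ‖g t‖ ^ 2) (Ioi 0) := by
      refine hint.mono' ((hg.norm.pow 2).const_mul κ).aestronglyMeasurable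
        (Filter.Eventually.of_forall fun t => ?_)
      rw [Real.norm_of_nonneg (by positivity)]
      exact hle t
    refine (h1.const_mul κ⁻¹).congr (Filter.Eventually.of_forall fun t => ?_)
    exact inv_mul_cancel_left₀ hκ.ne' _
  have h1 : IntegrableOn (fun t => ‖Gm t‖ ^ 2) (Ioi 0) :=
    hsq (c.νMinus / c.ε₀) (by positivity) hGm fun t => by
      unfold NSM.dissipationRate
      rw [add_assoc]
      exact le_add_of_nonneg_right (by positivity)
  have h2 : IntegrableOn (fun t => ‖Gp t‖ ^ 2) (Ioi 0) :=
    hsq (c.νPlus / c.ε₀) (by positivity) hGp fun t => by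
      unfold NSM.dissipationRate
      rw [add_right_comm]
      exact le_add_of_nonneg_left (by positivity)
  have h3 : IntegrableOn (fun t => ‖NSM.phys c 0 (Y t) - NSM.phys c 1 (Y t)‖ ^ 2) (Ioi 0) :=
    hsq (c.α / c.ε₀) (by positivity) ((hm 0).sub (hm 1)) fun t => by
      unfold NSM.dissipationRate
      exact le_add_of_nonneg_left (by positivity)
  have h4 : MemLp (fun t => NSM.phys c 0 (Y t) - NSM.phys c 1 (Y t)) 2
      (volume.restrict (Ioi (0 : ℝ))) :=
    (memLp_two_iff_integrable_sq_norm ((hm 0).sub (hm 1)).aestronglyMeasurable).2 h3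
  have hsol := hI.isWeakSolution hcl (hdiv 0 (Or.inl rfl)) (hdiv 1 (Or.inr rfl)) (hu.limit_zero hY)
  have hU : ∀ i, NSM.phys c i Y₀ = U i := NSM.phys_scaled c U
  rw [hU, hU, hU, hU] at hsol
  refine ⟨fun t => NSM.phys c 0 (Y t), fun t => NSM.phys c 1 (Y t), fun t => NSM.phys c 2 (Y t),
    fun t => NSM.phys c 3 (Y t), Gm, Gp, htop 0, htop 1, htop 2, htop 3, hwm, hwp,
    (memLp_two_iff_integrable_sq_norm hGm.aestronglyMeasurable).2 h1,
    (memLp_two_iff_integrable_sq_norm hGp.aestronglyMeasurable).2 h2, ?_, hsol, fun t ht => ?_⟩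
  -- The friction equals `α (v₋ - v₊)`, and the relative velocity is square integrable in time by
  -- the dissipation bound.
  · refine (h4.const_smul c.α).congr_norm ?_ (Filter.Eventually.of_forall fun t => ?_)
    · exact (((hm 1).sub (hm 0)).const_smul (-c.α)).aestronglyMeasurable
    · change ‖c.α • (NSM.phys c 0 (Y t) - NSM.phys c 1 (Y t))‖ =
        ‖-c.α • (NSM.phys c 1 (Y t) - NSM.phys c 0 (Y t))‖
      rw [neg_smul, ← smul_neg, neg_sub]
  · have hE₀ : NSM.energy c vm₀ vp₀ E₀ B₀ = 1 / 2 * ‖Y₀‖ ^ 2 := by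
      rw [← NSM.energy_phys c Y₀, hU, hU, hU, hU]
      rfl
    have hii : ∀ {g : ℝ → ℝ}, IntegrableOn g (Ioi 0) → IntervalIntegrable g volume 0 t :=
      fun hg => (intervalIntegrable_iff_integrableOn_Ioc_of_le ht).2
        (hg.mono_set Ioc_subset_Ioi_self)
    have h5 := hen t ht
    unfold NSM.dissipationRate at h5
    -- The dissipation integral may be split because its three terms are separately integrable.
    rw [intervalIntegral.integral_add (((hii h1).const_mul _).add ((hii h2).const_mul _))
      ((hii h3).const_mul _), intervalIntegral.integral_add ((hii h1).const_mul _)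
      ((hii h2).const_mul _), intervalIntegral.integral_const_mul,
      intervalIntegral.integral_const_mul, intervalIntegral.integral_const_mul] at h5
    rw [hE₀, NSM.energy_phys]
    linarith
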